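/- Let $d\ge 1$, $s\in(0,1)$ and $2\le p<\frac{2}{1-s}$. For $q,\alpha,R>0$ write $\mathrm{Tail}_{q,\alpha}(u,R)=\Big(\int_{\mathbb R^d\setminus B_R}\frac{|u(y)|^q}{|y|^{d+\alpha}}\,dy\Big)^{1/q}$, where $B_R$ is the open ball of radius $R$ centred at the origin of $\mathbb R^d$. A weak solution of $(-\Delta_p)^s u=0$ in an open set $\Omega$ is a function $u\in W^{s,p}_{loc}(\Omega)$ with $u\in L^{p-1}_{loc}(\mathbb R^d)$, $\int_{\mathbb R^d}\frac{|u(y)|^{p-1}}{(1+|y|)^{d+sp}}\,dy<\infty$, and $$\int_{\mathbb R^d}\int_{\mathbb R^d}\frac{|u(x)-u(y)|^{p-2}(u(x)-u(y))(\varphi(x)-\varphi(y))}{|x-y|^{d+sp}}\,dx\,dy=0\qquad\text{for all nonnegative }\varphi\in C_0^\infty(\Omega).$$ **Lemma.** For all $r,\mu>0$ there exist $\delta\in(0,1)$, $\varepsilon_1>0$ and an integer $K_0\ge 1$, depending only on $r,\mu,d,s,p$, such that the following holds. Let $e\in\mathbb R^d$ be a unit vector and let $u:\mathbb R^d\to\mathbb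 R$ be of class $C^1$ in $B_{2^{K_0+1}}$ and satisfy 1. $u$ is a weak solution of $(-\Delta_p)^s u=0$ in $B_{2^{K_0+1}}$; 2. $u(0)=0$; 3. $\|\nabla u\|_{L^\infty(B_{2^n})}\le(1-\delta)^{-n}$ for $n=0,1,\dots,K_0$; 4. $\mathrm{Tail}_{p-1,sp+1}(u,2^{K_0})\le\varepsilon_1$; 5. $\big|\{x\in B_1:\ |\nabla u(x)-e|\ge r\}\big|\ge\mu$. Then $e\cdot\nabla u\le 1-\delta$ in $B_{1/2}$. -/

import Mathlib

open MeasureTheory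

open scoped ENNReal ContDiff

noncomputable section

/-- The `(q, α)`-tail of `u` outside the ball `B_R(x)`:
`(∫_{B_R(x)ᶜ} |u(y)|^q / |x - y|^(d + α) dy)^(1/q)`, with values in `[0, ∞]`. -/
def tailFun {d : ℕ} (q α : ℝ) (u : EuclideanSpace ℝ (Fin d) → ℝ)
    (x : EuclideanSpace ℝ (Fin d)) (R : ℝ) : ℝ≥0∞ :=
  (∫⁻ y in (Metric.ball x R)ᶜ,
    ENNReal.ofReal (|u y| ^ q / ‖x - y‖ ^ ((d : ℝ) + α))) ^ (1 / q)

/-- The tail space `L^q_α(ℝ^d)`: functions in `L^q_loc` with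
`∫ |u(y)|^q / (1 + |y|)^(d + α) dy < ∞`. -/
def MemTailSpace {d : ℕ} (q α : ℝ) (u : EuclideanSpace ℝ (Fin d) → ℝ) : Prop :=
  (∀ K : Set (EuclideanSpace ℝ (Fin d)), IsCompact K →
    MemLp u (ENNReal.ofReal q) (volume.restrict K)) ∧
  ∫⁻ y, ENNReal.ofReal (|u y| ^ q / (1 + ‖y‖) ^ ((d : ℝ) + α)) < ⊤

/-- The fractional Sobolev space `W^{s,p}(Ω)`. -/
def MemFracSobolev {d : ℕ} (s p : ℝ) (Ω : Set (EuclideanSpace ℝ (Fin d)))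
    (v : EuclideanSpace ℝ (Fin d) → ℝ) : Prop :=
  MemLp v (ENNReal.ofReal p) (volume.restrict Ω) ∧
  ∫⁻ x in Ω, ∫⁻ y in Ω,
    ENNReal.ofReal (|v x - v y| ^ p / ‖x - y‖ ^ ((d : ℝ) + s * p)) < ⊤

/-- The local space `W^{s,p}_loc(Ω)`: membership in `W^{s,p}(U)` for all open `U ⋐ Ω`. -/
def MemFracSobolevLoc {d : ℕ} (s p : ℝ) (Ω : Set (EuclideanSpace ℝ (Fin d)))
    (v : EuclideanSpace ℝ (Fin d) → ℝ) : Prop :=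
  ∀ U : Set (EuclideanSpace ℝ (Fin d)), IsOpen U → IsCompact (closure U) →
    closure U ⊆ Ω → MemFracSobolev s p U v

/-- The form
`∬ |u(x) - u(y)|^(p-2) (u(x) - u(y)) (φ(x) - φ(y)) |x - y|^(-d-sp) dx dy`
associated with the fractional `p`-Laplacian. The integral converges absolutely for
`u ∈ W^{s,p}_loc(Ω) ∩ L^{p-1}_{sp}(ℝ^d)` and `φ ∈ C^∞_0(Ω)`. -/
def fracPLapForm {d : ℕ} (s p : ℝ) (u φ : EuclideanSpace ℝ (Fin d) → ℝ) : ℝ :=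
  ∫ x, ∫ y, |u x - u y| ^ (p - 2) * (u x - u y) * (φ x - φ y) /
    ‖x - y‖ ^ ((d : ℝ) + s * p)

/-- Nonnegative test functions in `C^∞_0(Ω)`. -/
def IsNonnegTest {d : ℕ} (Ω : Set (EuclideanSpace ℝ (Fin d)))
    (φ : EuclideanSpace ℝ (Fin d) → ℝ) : Prop :=
  ContDiff ℝ ∞ φ ∧ HasCompactSupport φ ∧ tsupport φ ⊆ Ω ∧ ∀ x, 0 ≤ φ x

/-- Weak subsolutions of `(-Δ_p)^s u = 0` in `Ω`. -/
def IsWeakSubsolution {d : ℕ} (s p : ℝ) (Ω : Set (EuclideanSpace ℝ (Fin d)))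
    (u : EuclideanSpace ℝ (Fin d) → ℝ) : Prop :=
  MemFracSobolevLoc s p Ω u ∧ MemTailSpace (p - 1) (s * p) u ∧
  ∀ φ, IsNonnegTest Ω φ → fracPLapForm s p u φ ≤ 0

/-- Weak supersolutions of `(-Δ_p)^s u = 0` in `Ω`. -/
def IsWeakSupersolution {d : ℕ} (s p : ℝ) (Ω : Set (EuclideanSpace ℝ (Fin d)))
    (u : EuclideanSpace ℝ (Fin d) → ℝ) : Prop :=
  MemFracSobolevLoc s p Ω u ∧ MemTailSpace (p - 1) (s * p) u ∧
  ∀ φ, IsNonnegTest Ω φ → 0 ≤ fracPLapForm s p u φ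

/-- Weak solutions of `(-Δ_p)^s u = 0` in `Ω`. -/
def IsWeakSolution {d : ℕ} (s p : ℝ) (Ω : Set (EuclideanSpace ℝ (Fin d)))
    (u : EuclideanSpace ℝ (Fin d) → ℝ) : Prop :=
  IsWeakSubsolution s p Ω u ∧ IsWeakSupersolution s p Ω u

end

/-! Differentiating the equation along `e` shows that `e·∇u` formally solves a linear nonlocal
equation with kernel comparable to `|u(x)-u(y)|^(p-2) |x-y|^(-a)`, where `a = d + sp`. The statement
is a De Giorgi argument for this equation. The difficulty is that the kernel degenerates where `u(x)
= u(y)`, and the argument rests on the fact that `∇u` must be near `e` wherever `e·∇u` is near its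
maximum.

Upper bound (`IncrementBounds.energy_gradient_le`). Let `w = e·∇u - b|x| - m` with `b` of order `δ`
and `m` within `O(δ)` of 1. The barrier `b|x|` makes `w` negative in `B_8` outside `B_1`, so `w_+`
is an admissible test function without a cutoff. Testing the difference of the equations for `u(· +
te)` and `u`, and letting `t` tend to 0, bounds the energy of `w_+`, including the cross term
`w_+(x) w_-(y)`, by `C δ² |{w ≥ 0} ∩ B_1|`. Every error is of this size because `(1-δ)^(-n) ≤ 1 + C
δ 2^(nβ)` for a small power `β` (`exists_zpow_neg_le`). At distances beyond `T` increments of `u`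
are not controlled, so the increment is put on the kernel. This costs one extra power of decay,
hence the tail exponent `sp + 1`, and monotonicity of `oddPow` supplies the sign
(`neg_le_farOperator_sub`).

Lower bound. Take `x` with `w(x) ≥ γ` and a radius `R`, and put `q = p - 2` and `τ = a - q - d = sp
- (p-2)`, which is positive exactly because `p < 2/(1-s)`. Either `u` is flat with slope `e` around
`x` in `B_R(x)`. Then `|u(x)-u(y)|` is of order `R` on a ball ahead of `x`, at least half of which
misses `{w ≥ 0}` once that set is small, and the energy at `x` is at least `c γ² R^(-τ)`
(`le_lintegral_energy_of_flat`). Or flatness fails. Then at the first scale of failure `e·∇u` has a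
definite deficit on a set where `u` differs from `u(x)`, and the cross term gives at least `c γ
R^(-τ)` (`le_lintegral_kernel_deficit`, `le_lintegral_energy_of_not_flat`).

Iteration (`inner_gradient_le_of_energy`). The measure hypothesis on `∇u` rules out flatness in
`B_4(x)`, so the first step uses the cross term. This is linear in `γ ~ δ` against an upper bound of
order `δ²`, so the superlevel set has measure `O(δ)`. Afterwards the levels rise by `δ 2^(-j)` and
the radii shrink like `4^(-j/τ)`, so that `γ² R^(-τ)` stays of order `δ²` and the measures decay
geometrically to zero. -/

/-! ### Inequalities for the odd power and for negative powers -/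

/-- The odd power `t ↦ |t|^(p-2) t`. -/
noncomputable def oddPow (p t : ℝ) : ℝ := |t| ^ (p - 2) * t

lemma oddPow_neg (p t : ℝ) : oddPow p (-t) = -oddPow p t := by
  simp [oddPow]

lemma oddPow_sub_comm (p a b : ℝ) : oddPow p (a - b) = -oddPow p (b - a) := by
  rw [← oddPow_neg, neg_sub]

lemma continuous_oddPow {p : ℝ} (hp : 2 ≤ p) : Continuous (oddPow p) := by
  unfold oddPow
  exact (continuous_abs.rpow_const fun _ => Or.inr (by linarith)).mul continuous_id

lemma abs_oddPow {p : ℝ} (hp : 2 ≤ p) (t : ℝ) : |oddPow p t| = |t| ^ (p - 1) := by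
  unfold oddPow
  rw [abs_mul, abs_of_nonneg (Real.rpow_nonneg (abs_nonneg t) _)]
  have h := Real.rpow_add_one' (abs_nonneg t) (y := p - 2) (by linarith)
  rw [← h]; congr 1; ring

lemma abs_oddPow_sub_le {p : ℝ} (hp : 2 ≤ p) (a b : ℝ) :
    |oddPow p (a - b)| ≤ 2 ^ (p - 1) * (|a| ^ (p - 1) + |b| ^ (p - 1)) := by
  rw [abs_oddPow hp]
  have h1 : |a - b| ≤ 2 * max |a| |b| := by
    have := abs_sub a b
    have h2 := le_max_left |a| |b|
    have h3 := le_max_right |a| |b|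
    linarith
  have hp1 : 0 ≤ p - 1 := by linarith
  calc |a - b| ^ (p - 1) ≤ (2 * max |a| |b|) ^ (p - 1) :=
        Real.rpow_le_rpow (abs_nonneg _) h1 hp1
    _ = 2 ^ (p - 1) * (max |a| |b|) ^ (p - 1) :=
        Real.mul_rpow (by norm_num) (le_max_of_le_left (abs_nonneg _))
    _ ≤ _ := by
        gcongr
        rcases max_choice |a| |b| with h | h <;> rw [h]
        · linarith [Real.rpow_nonneg (abs_nonneg b) (p - 1)]
        · linarith [Real.rpow_nonneg (abs_nonneg a) (p - 1)]

/-- The right side minus the left side is half of `(|a|^(p-2) - |b|^(p-2)) (a² - b²)`, whose factors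
have the same sign. -/
lemma half_mul_sq_le_oddPow_sub_mul {p : ℝ} (hp : 2 ≤ p) (a b : ℝ) :
    (|a| ^ (p - 2) + |b| ^ (p - 2)) / 2 * (a - b) ^ 2 ≤
      (oddPow p a - oddPow p b) * (a - b) := by
  have h : 0 ≤ (|a| ^ (p - 2) - |b| ^ (p - 2)) * (|a| ^ 2 - |b| ^ 2) := by
    rcases le_total |a| |b| with h | h
    · apply mul_nonneg_of_nonpos_of_nonpos
      · have := Real.rpow_le_rpow (abs_nonneg a) h (by linarith : 0 ≤ p - 2); linarith
      · have := pow_le_pow_left₀ (abs_nonneg a) h 2; linarith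
    · apply mul_nonneg
      · have := Real.rpow_le_rpow (abs_nonneg b) h (by linarith : 0 ≤ p - 2); linarith
      · have := pow_le_pow_left₀ (abs_nonneg b) h 2; linarith
  rw [sq_abs, sq_abs] at h
  unfold oddPow
  nlinarith [h]

lemma monotone_oddPow {p : ℝ} (hp : 2 ≤ p) : Monotone (oddPow p) := by
  intro b a hab
  have h := half_mul_sq_le_oddPow_sub_mul hp a b
  rcases hab.eq_or_lt with rfl | hlt
  · exact le_rfl
  · have h0 : 0 ≤ (|a| ^ (p - 2) + |b| ^ (p - 2)) / 2 * (a - b) ^ 2 := by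
      have := Real.rpow_nonneg (abs_nonneg a) (p - 2)
      have := Real.rpow_nonneg (abs_nonneg b) (p - 2)
      positivity
    have := nonneg_of_mul_nonneg_left (h0.trans h) (by linarith)
    linarith

/-- This is Bernoulli's inequality with exponent `q + 1` at the ratio `t / s`. It avoids the mean
value theorem for `t ↦ t^q`, whose derivative is singular at 0 when `q < 1`. -/
lemma rpow_sub_mul_le {q s t : ℝ} (hq : 0 ≤ q) (ht : 0 ≤ t) (hts : t ≤ s) :
    (s ^ q - t ^ q) * t ≤ q * s ^ q * (s - t) := by
  rcases (ht.trans hts).eq_or_lt with h0 | hs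
  · have : t = 0 := by linarith
    simp [this, ← h0]
  have hb := one_add_mul_self_le_rpow_one_add (s := t / s - 1) (p := q + 1)
    (by have := div_nonneg ht hs.le; linarith) (by linarith)
  rw [add_sub_cancel, Real.rpow_add_one' (by positivity) (by linarith),
    Real.div_rpow ht hs.le] at hb
  have hsq : 0 < s ^ q := Real.rpow_pos_of_pos hs q
  have e1 : t ^ q / s ^ q * (t / s) = t ^ q * t / (s ^ q * s) := by field_simp
  have e2 : 1 + (q + 1) * (t / s - 1) = (s + (q + 1) * (t - s)) / s := by field_simp
  rw [e1, e2, div_le_div_iff₀ hs (by positivity)] at hb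
  have hb' : (s + (q + 1) * (t - s)) * s ^ q ≤ t ^ q * t := by
    have : ((s + (q + 1) * (t - s)) * s ^ q) * s ≤ (t ^ q * t) * s := by linarith
    exact le_of_mul_le_mul_right this hs
  nlinarith

/-- By symmetry `|b| ≤ |a|`. The increment splits into `|a|^(p-2) (a - b)` and the change of the
weight times `b`, and `rpow_sub_mul_le` bounds the latter by `(p-2) |a|^(p-2) |a - b|`. -/
lemma abs_oddPow_sub_oddPow_le {p : ℝ} (hp : 2 ≤ p) (a b : ℝ) :
    |oddPow p a - oddPow p b| ≤ (p - 1) * (|a| + |b|) ^ (p - 2) * |a - b| := by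
  wlog h : |b| ≤ |a| generalizing a b
  · have := this b a (by linarith)
    rw [abs_sub_comm, abs_sub_comm a b, add_comm |a|]; exact this
  have hq : 0 ≤ p - 2 := by linarith
  have e : oddPow p a - oddPow p b
      = |a| ^ (p - 2) * (a - b) + (|a| ^ (p - 2) - |b| ^ (p - 2)) * b := by
    unfold oddPow; ring
  have hA := Real.rpow_nonneg (abs_nonneg a) (p - 2)
  have hd : 0 ≤ |a| ^ (p - 2) - |b| ^ (p - 2) := by
    have := Real.rpow_le_rpow (abs_nonneg b) h hq; linarith
  have h1 := rpow_sub_mul_le hq (abs_nonneg b) h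
  have h2 : |a| - |b| ≤ |a - b| := abs_sub_abs_le_abs_sub a b
  have h3 : |a| ^ (p - 2) ≤ (|a| + |b|) ^ (p - 2) :=
    Real.rpow_le_rpow (abs_nonneg a) (by linarith [abs_nonneg b]) hq
  calc |oddPow p a - oddPow p b|
      ≤ |a| ^ (p - 2) * |a - b| + (|a| ^ (p - 2) - |b| ^ (p - 2)) * |b| := by
        rw [e]
        refine (abs_add_le _ _).trans ?_
        rw [abs_mul, abs_mul, abs_of_nonneg hA, abs_of_nonneg hd]
    _ ≤ |a| ^ (p - 2) * |a - b| + (p - 2) * |a| ^ (p - 2) * |a - b| := by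
        have : (p - 2) * |a| ^ (p - 2) * (|a| - |b|) ≤ (p - 2) * |a| ^ (p - 2) * |a - b| := by
          gcongr
        linarith
    _ = (p - 1) * |a| ^ (p - 2) * |a - b| := by ring
    _ ≤ _ := by
        have : 0 ≤ p - 1 := by linarith
        gcongr

/-- The increments of `oddPow` factor through a slope with two-sided bounds. -/
lemma exists_slope_oddPow {p : ℝ} (hp : 2 ≤ p) (a b : ℝ) :
    ∃ κ : ℝ, |b| ^ (p - 2) / 2 ≤ κ ∧ κ ≤ (p - 1) * (|a| + |b|) ^ (p - 2) ∧
      oddPow p a - oddPow p b = κ * (a - b) := by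
  have hq : 0 ≤ p - 2 := by linarith
  have hA := Real.rpow_nonneg (abs_nonneg a) (p - 2)
  have hB := Real.rpow_nonneg (abs_nonneg b) (p - 2)
  by_cases hab : a = b
  · subst hab
    refine ⟨|a| ^ (p - 2), by linarith, ?_, by simp⟩
    have h3 : |a| ^ (p - 2) ≤ (|a| + |a|) ^ (p - 2) :=
      Real.rpow_le_rpow (abs_nonneg a) (by linarith [abs_nonneg a]) hq
    nlinarith
  · have hne : a - b ≠ 0 := sub_ne_zero.mpr hab
    have hpos : 0 < (a - b) ^ 2 := by positivity
    refine ⟨(oddPow p a - oddPow p b) / (a - b), ?_, ?_, by field_simp⟩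
    · have h := half_mul_sq_le_oddPow_sub_mul hp a b
      have e : (oddPow p a - oddPow p b) / (a - b)
          = (oddPow p a - oddPow p b) * (a - b) / (a - b) ^ 2 := by field_simp
      rw [e, le_div_iff₀ hpos]
      nlinarith
    · have h := abs_oddPow_sub_oddPow_le hp a b
      have hpos' : 0 < |a - b| := abs_pos.mpr hne
      calc _ ≤ |(oddPow p a - oddPow p b) / (a - b)| := le_abs_self _
        _ = |oddPow p a - oddPow p b| / |a - b| := abs_div _ _
        _ ≤ _ := by rw [div_le_iff₀ hpos']; exact h

lemma rpow_neg_sub_rpow_neg_le {a s t : ℝ} (ha : 0 ≤ a) (ht : 0 < t) (hts : t ≤ s) :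
    t ^ (-a) - s ^ (-a) ≤ a * t ^ (-a - 1) * (s - t) := by
  have hs : 0 < s := ht.trans_le hts
  have e : s ^ (-a) = t ^ (-a) * (s / t) ^ (-a) := by
    rw [← Real.mul_rpow ht.le (by positivity)]; congr 1; field_simp
  have h1 : 1 - a * (s / t - 1) ≤ (s / t) ^ (-a) := by
    rw [Real.rpow_def_of_pos (by positivity)]
    have h2 := Real.add_one_le_exp (Real.log (s / t) * -a)
    have h3 := Real.log_le_sub_one_of_pos (show 0 < s / t by positivity)
    nlinarith
  have e2 : t ^ (-a - 1) = t ^ (-a) / t := by rw [Real.rpow_sub_one ht.ne']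
  have hta : 0 < t ^ (-a) := Real.rpow_pos_of_pos ht _
  have e3 : a * t ^ (-a - 1) * (s - t) = t ^ (-a) * (a * (s / t - 1)) := by
    rw [e2]; field_simp
  rw [e, e3]
  nlinarith

/-! ### Local integrability of power kernels -/

section Kernels

variable {d : ℕ}

local notation "V" => EuclideanSpace ℝ (Fin d)

lemma lintegral_rpow_norm_ball_lt_top [Nontrivial V] {c r : ℝ} (hc : 0 < c) :
    ∫⁻ z in Metric.ball (0 : V) r, ENNReal.ofReal (‖z‖ ^ (c - (d : ℝ))) < ⊤ := by
  have hd : 0 < d := by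
    rcases Nat.eq_zero_or_pos d with h | h
    · subst h
      exact absurd ‹Nontrivial (EuclideanSpace ℝ (Fin 0))› (not_nontrivial _)
    · exact h
  have key : Integrable (fun z : V => (Set.Iio r).indicator (fun t : ℝ => t ^ (c - (d:ℝ))) ‖z‖) := by
    rw [integrable_fun_norm_addHaar volume (f := (Set.Iio r).indicator (fun t : ℝ => t ^ (c - (d:ℝ))))]
    rw [finrank_euclideanSpace_fin]
    have h1 : IntegrableOn (fun t : ℝ => t ^ (c - 1)) (Set.Ioo 0 r) := by
      rcases le_or_gt r 0 with h | h
      · simp [Set.Ioo_eq_empty_of_le h]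
      · exact (intervalIntegral.integrableOn_Ioo_rpow_iff h).2 (by linarith)
    have h2 : IntegrableOn ((Set.Iio r).indicator fun t : ℝ => t ^ (c - 1)) (Set.Ioi 0) := by
      rw [IntegrableOn, integrable_indicator_iff measurableSet_Iio, IntegrableOn,
        Measure.restrict_restrict measurableSet_Iio]
      rwa [Set.Iio_inter_Ioi]
    refine h2.congr_fun ?_ measurableSet_Ioi
    intro t ht
    have ht : 0 < t := ht
    by_cases htr : t ∈ Set.Iio r
    · simp only [Set.indicator_of_mem htr, smul_eq_mul]
      rw [← Real.rpow_natCast, ← Real.rpow_add ht]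
      congr 1
      rw [Nat.cast_sub hd]; push_cast; ring
    · simp [Set.indicator_of_notMem htr]
  have h3 := key.lintegral_lt_top
  refine lt_of_le_of_lt ?_ h3
  rw [← lintegral_indicator Metric.isOpen_ball.measurableSet]
  refine lintegral_mono fun z => ?_
  by_cases hz : z ∈ Metric.ball (0:V) r
  · have hz' : ‖z‖ ∈ Set.Iio r := by simpa using hz
    simp [Set.indicator_of_mem hz, Set.indicator_of_mem hz']
  · simp [Set.indicator_of_notMem hz]

end Kernels

/-! ### Flatness of `u` versus a deficit of the directional derivative -/

section Geometry

variable {d : ℕ}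

local notation "V" => EuclideanSpace ℝ (Fin d)

lemma lintegral_ball_translate (g : V → ℝ≥0∞) (w : V) (r : ℝ) :
    ∫⁻ ξ in Metric.ball (0 : V) r, g (w + ξ) = ∫⁻ y in Metric.ball w r, g y := by
  rw [← lintegral_indicator Metric.isOpen_ball.measurableSet,
    ← lintegral_indicator Metric.isOpen_ball.measurableSet,
    ← lintegral_add_left_eq_self ((Metric.ball w r).indicator g) w]
  refine lintegral_congr fun ξ => ?_
  by_cases h : ξ ∈ Metric.ball (0 : V) r
  · rw [Set.indicator_of_mem h, Set.indicator_of_mem]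
    simpa [dist_eq_norm] using h
  · rw [Set.indicator_of_notMem h, Set.indicator_of_notMem]
    simpa [dist_eq_norm] using h

lemma lintegral_swap_translate {g : V → ℝ≥0∞} (hg : Measurable g) (z ζ : V) (r : ℝ) :
    ∫⁻ ξ in Metric.ball (0 : V) r, ∫⁻ s in Set.Icc (0 : ℝ) 1, g (z + s • ζ + ξ) =
      ∫⁻ s in Set.Icc (0 : ℝ) 1, ∫⁻ y in Metric.ball (z + s • ζ) r, g y := by
  rw [lintegral_lintegral_swap]
  · exact lintegral_congr fun s => lintegral_ball_translate g _ r
  · apply Measurable.aemeasurable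
    apply hg.comp
    fun_prop

/-- Averaging over parallel translates of one segment turns a bound on each line integral into a
bound on a volume integral over the tube `U`. The next lemma is the reverse estimate. -/
lemma mul_volume_ball_le_lintegral {g : V → ℝ≥0∞} (hg : Measurable g) {z ζ : V} {r : ℝ}
    {c : ℝ≥0∞} {U : Set V}
    (h1 : ∀ ξ ∈ Metric.ball (0 : V) r, c ≤ ∫⁻ s in Set.Icc (0 : ℝ) 1, g (z + s • ζ + ξ))
    (h2 : ∀ s ∈ Set.Icc (0 : ℝ) 1, Metric.ball (z + s • ζ) r ⊆ U) :
    c * volume (Metric.ball (0 : V) r) ≤ ∫⁻ y in U, g y := by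
  calc c * volume (Metric.ball (0 : V) r) = ∫⁻ _ξ in Metric.ball (0 : V) r, c := by
        rw [setLIntegral_const]
    _ ≤ ∫⁻ ξ in Metric.ball (0 : V) r, ∫⁻ s in Set.Icc (0 : ℝ) 1, g (z + s • ζ + ξ) :=
        setLIntegral_mono' Metric.isOpen_ball.measurableSet h1
    _ = ∫⁻ s in Set.Icc (0 : ℝ) 1, ∫⁻ y in Metric.ball (z + s • ζ) r, g y :=
        lintegral_swap_translate hg z ζ r
    _ ≤ ∫⁻ _s in Set.Icc (0 : ℝ) 1, ∫⁻ y in U, g y :=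
        setLIntegral_mono' measurableSet_Icc fun s hs => lintegral_mono_set (h2 s hs)
    _ = ∫⁻ y in U, g y := by rw [setLIntegral_const]; simp

lemma lintegral_le_mul_volume_ball {g : V → ℝ≥0∞} (hg : Measurable g) {z ζ : V} {r : ℝ}
    {c : ℝ≥0∞} {U : Set V}
    (h1 : ∀ ξ ∈ Metric.ball (0 : V) r, ∫⁻ s in Set.Icc (0 : ℝ) 1, g (z + s • ζ + ξ) ≤ c)
    (h2 : ∀ s ∈ Set.Icc (0 : ℝ) 1, U ⊆ Metric.ball (z + s • ζ) r) :
    ∫⁻ y in U, g y ≤ c * volume (Metric.ball (0 : V) r) := by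
  calc ∫⁻ y in U, g y = ∫⁻ _s in Set.Icc (0 : ℝ) 1, ∫⁻ y in U, g y := by
        rw [setLIntegral_const]; simp
    _ ≤ ∫⁻ s in Set.Icc (0 : ℝ) 1, ∫⁻ y in Metric.ball (z + s • ζ) r, g y :=
        setLIntegral_mono' measurableSet_Icc fun s hs => lintegral_mono_set (h2 s hs)
    _ = ∫⁻ ξ in Metric.ball (0 : V) r, ∫⁻ s in Set.Icc (0 : ℝ) 1, g (z + s • ζ + ξ) :=
        (lintegral_swap_translate hg z ζ r).symm
    _ ≤ ∫⁻ _ξ in Metric.ball (0 : V) r, c :=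
        setLIntegral_mono' Metric.isOpen_ball.measurableSet h1
    _ = _ := by rw [setLIntegral_const]

lemma measurable_gradient (u : V → ℝ) : Measurable (fun x => gradient u x) := by
  unfold gradient
  exact (LinearIsometryEquiv.continuous _).measurable.comp (measurable_fderiv ℝ u)

lemma inner_gradient_eq (u : V → ℝ) (x y : V) :
    inner ℝ (gradient u x) y = fderiv ℝ u x y := by
  unfold gradient
  rw [← InnerProductSpace.toDual_apply_apply (𝕜 := ℝ), LinearIsometryEquiv.apply_symm_apply]

lemma norm_gradient_eq (u : V → ℝ) (x : V) : ‖gradient u x‖ = ‖fderiv ℝ u x‖ := by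
  unfold gradient
  exact LinearIsometryEquiv.norm_map _ _

lemma hasDerivAt_segment {u : V → ℝ} {z ζ : V} {s : ℝ}
    (h : DifferentiableAt ℝ u (z + s • ζ)) :
    HasDerivAt (fun s : ℝ => u (z + s • ζ)) (inner ℝ (gradient u (z + s • ζ)) ζ) s := by
  rw [inner_gradient_eq]
  have h1 : HasDerivAt (fun s : ℝ => z + s • ζ) ζ s := by
    simpa using ((hasDerivAt_id s).smul_const ζ).const_add z
  exact h.hasFDerivAt.comp_hasDerivAt s h1

/-- Fundamental theorem of calculus along a segment. -/
lemma sub_eq_integral_inner_gradient {u : V → ℝ} {B : Set V}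
    (hd : ∀ y ∈ B, DifferentiableAt ℝ u y) (hc : ContinuousOn (fun y => gradient u y) B)
    {z ζ : V} (hz : ∀ s ∈ Set.Icc (0 : ℝ) 1, z + s • ζ ∈ B) :
    u (z + ζ) - u z = ∫ s in (0 : ℝ)..1, inner ℝ (gradient u (z + s • ζ)) ζ := by
  have hI : Set.uIcc (0 : ℝ) 1 = Set.Icc 0 1 := Set.uIcc_of_le zero_le_one
  rw [intervalIntegral.integral_eq_sub_of_hasDerivAt (f := fun s : ℝ => u (z + s • ζ))]
  · simp
  · intro s hs
    rw [hI] at hs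
    exact hasDerivAt_segment (hd _ (hz s hs))
  · apply ContinuousOn.intervalIntegrable
    rw [hI]
    refine ContinuousOn.inner ?_ continuousOn_const
    exact hc.comp (by fun_prop) hz

lemma continuousOn_inner_gradient_segment {u : V → ℝ} {B : Set V}
    (hc : ContinuousOn (fun y => gradient u y) B) (e : V)
    {z ζ : V} (hz : ∀ s ∈ Set.Icc (0 : ℝ) 1, z + s • ζ ∈ B) :
    ContinuousOn (fun s : ℝ => inner ℝ e (gradient u (z + s • ζ))) (Set.Icc 0 1) :=
  continuousOn_const.inner (hc.comp (by fun_prop) hz)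

/-- Expanding the square and using that `g` is almost of norm at most 1, the distance of `g` to the
unit vector `e` is controlled by the defect of `e·g` from 1 alone. -/
lemma norm_gradient_sub_sq_le {g e : V} {η : ℝ} (he : ‖e‖ = 1) (hη0 : 0 ≤ η) (hη : η ≤ 1)
    (hg : ‖g‖ ≤ 1 + η) :
    ‖g - e‖ ^ 2 ≤ 2 * max (1 - η - inner ℝ e g) 0 + 5 * η := by
  have h := norm_sub_sq_real g e
  rw [he, real_inner_comm] at h
  have h1 := le_max_left (1 - η - inner ℝ e g) 0
  have h2 : ‖g‖ ^ 2 ≤ (1 + η) ^ 2 := pow_le_pow_left₀ (norm_nonneg _) hg 2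
  nlinarith

/-- If the deviation of `u` from the slope `e` changes along a segment, the deficit
`(1 - η - e·∇u)_+` has a definite integral over that segment. -/
lemma le_lintegral_deficit_segment {u : V → ℝ} {B : Set V} {e : V} {η ε ρ : ℝ}
    (hd : ∀ y ∈ B, DifferentiableAt ℝ u y) (hc : ContinuousOn (fun y => gradient u y) B)
    (hg : ∀ y ∈ B, ‖gradient u y‖ ≤ 1 + η) (he : ‖e‖ = 1)
    (hε : 0 < ε) (hε1 : ε ≤ 1) (hη0 : 0 ≤ η) (hη : η ≤ ε ^ 2 / 2560) (hρ : 0 < ρ)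
    {z ζ : V} (hz : ∀ s ∈ Set.Icc (0 : ℝ) 1, z + s • ζ ∈ B) (hζ : ‖ζ‖ ≤ ρ)
    (hf : ε * ρ / 16 ≤ |u (z + ζ) - u z - inner ℝ e ζ|) :
    ENNReal.ofReal (ε ^ 2 / 1024) ≤ ∫⁻ s in Set.Icc (0 : ℝ) 1,
      ENNReal.ofReal (max (1 - η - inner ℝ e (gradient u (z + s • ζ))) 0) := by
  set N : ℝ → ℝ := fun s => max (1 - η - inner ℝ e (gradient u (z + s • ζ))) 0 with hN
  have hη1 : η ≤ 1 := by nlinarith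
  have hNc : ContinuousOn N (Set.Icc 0 1) :=
    (continuousOn_const.sub (continuousOn_inner_gradient_segment hc e hz)).sup continuousOn_const
  have hNi : IntervalIntegrable N volume 0 1 :=
    ContinuousOn.intervalIntegrable (by rwa [Set.uIcc_of_le zero_le_one])
  have h1 : u (z + ζ) - u z - inner ℝ e ζ =
      ∫ s in (0 : ℝ)..1, inner ℝ (gradient u (z + s • ζ) - e) ζ := by
    rw [sub_eq_integral_inner_gradient hd hc hz]
    have : inner ℝ e ζ = ∫ _s in (0 : ℝ)..1, (inner ℝ e ζ : ℝ) := by simp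
    rw [this, ← intervalIntegral.integral_sub]
    · simp only [inner_sub_left]
    · apply ContinuousOn.intervalIntegrable
      rw [Set.uIcc_of_le zero_le_one]
      exact (hc.comp (by fun_prop) hz).inner continuousOn_const
    · simp
  have h2 : |u (z + ζ) - u z - inner ℝ e ζ| ≤
      ∫ s in (0 : ℝ)..1, ρ * (ε / 32 + 40 * η / ε + 16 / ε * N s) := by
    rw [h1, ← Real.norm_eq_abs]
    apply intervalIntegral.norm_integral_le_of_norm_le zero_le_one
    · refine Filter.Eventually.of_forall fun s hs => ?_
      have hs' : s ∈ Set.Icc (0 : ℝ) 1 := ⟨hs.1.le, hs.2⟩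
      refine (norm_inner_le_norm _ _).trans ?_
      rw [mul_comm]
      have h3 := norm_gradient_sub_sq_le he hη0 hη1 (hg _ (hz s hs'))
      set t := ‖gradient u (z + s • ζ) - e‖
      have h4 : t ≤ ε / 32 + 40 * η / ε + 16 / ε * N s := by
        -- Young's inequality trades the linear deviation for its square, which the deficit controls
        -- linearly.
        have h5 : t ≤ ε / 32 + 8 / ε * t ^ 2 := by
          have : 0 ≤ 8 / ε * (t - ε / 16) ^ 2 := by positivity
          have e1 : 8 / ε * (t - ε / 16) ^ 2 = 8 / ε * t ^ 2 - t + ε / 32 := by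
            field_simp; ring
          linarith
        have h6 : 8 / ε * t ^ 2 ≤ 8 / ε * (2 * N s + 5 * η) := by gcongr
        have e2 : 8 / ε * (2 * N s + 5 * η) = 40 * η / ε + 16 / ε * N s := by
          field_simp; ring
        linarith
      exact mul_le_mul hζ h4 (norm_nonneg _) hρ.le
    · exact ((intervalIntegrable_const).add (hNi.const_mul _)).const_mul _
  rw [intervalIntegral.integral_const_mul, intervalIntegral.integral_add intervalIntegrable_const
    (hNi.const_mul _), intervalIntegral.integral_const_mul] at h2
  simp only [intervalIntegral.integral_const, sub_zero, smul_eq_mul, one_mul] at h2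
  have h3 : ε / 16 ≤ ε / 32 + 40 * η / ε + 16 / ε * ∫ s in (0 : ℝ)..1, N s := by
    have : ρ * (ε / 16) ≤ ρ * (ε / 32 + 40 * η / ε + 16 / ε * ∫ s in (0 : ℝ)..1, N s) := by
      linarith
    exact le_of_mul_le_mul_left this hρ
  -- The bound `η ≤ ε² / 2560` is calibrated here, since `2560 = 40 · 64`.
  have h4 : 40 * η / ε ≤ ε / 64 := by
    rw [div_le_iff₀ hε]; nlinarith
  have h5 : ε ^ 2 / 1024 ≤ ∫ s in (0 : ℝ)..1, N s := by
    have h6 : ε / 64 ≤ 16 / ε * ∫ s in (0 : ℝ)..1, N s := by linarith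
    have h7 : ε * (ε / 64) ≤ ε * (16 / ε * ∫ s in (0 : ℝ)..1, N s) := by gcongr
    have e1 : ε * (16 / ε * ∫ s in (0 : ℝ)..1, N s) = 16 * ∫ s in (0 : ℝ)..1, N s := by
      field_simp
    nlinarith
  rw [intervalIntegral.integral_of_le zero_le_one, ← integral_Icc_eq_integral_Ioc] at h5
  rw [← ofReal_integral_eq_lintegral_ofReal]
  · exact ENNReal.ofReal_le_ofReal h5
  · exact hNc.integrableOn_Icc
  · exact Filter.Eventually.of_forall fun s => le_max_right _ _


/-- A first violation of `|f y| ≤ ε ‖y - x‖` when it holds near `x`. -/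
lemma exists_first_violation {f : V → ℝ} {x y₀ : V} {ε R : ℝ}
    (hf : ContinuousOn f (Metric.ball x R))
    (hnear : ∀ᶠ y in nhds x, y ≠ x → |f y| < ε * ‖y - x‖)
    (hy₀ : ‖y₀ - x‖ < R) (hne : y₀ ≠ x) (hbad : ε * ‖y₀ - x‖ ≤ |f y₀|) :
    ∃ y₁, 0 < ‖y₁ - x‖ ∧ ‖y₁ - x‖ < R ∧ ε * ‖y₁ - x‖ ≤ |f y₁| ∧
      ∀ y, ‖y - x‖ < ‖y₁ - x‖ → y ≠ x → |f y| ≤ ε * ‖y - x‖ := by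
  obtain ⟨r₀, hr₀, hball⟩ := Metric.eventually_nhds_iff.1 hnear
  set ρ := ‖y₀ - x‖ with hρ
  have hsub : Metric.closedBall x ρ ⊆ Metric.ball x R := Metric.closedBall_subset_ball hy₀
  -- The estimate near `x` keeps all violations at distance at least `r₀`, so those in the closed
  -- ball of radius `ρ` form a compact set, and the nearest one to `x` is taken.
  set C : Set V := Metric.closedBall x ρ ∩ {y | r₀ ≤ ‖y - x‖} with hC
  have hCc : IsCompact C :=
    (isCompact_closedBall x ρ).inter_right (isClosed_le continuous_const (by fun_prop))
  have hCf : ContinuousOn (fun y => |f y| - ε * ‖y - x‖) C := by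
    refine ContinuousOn.sub ((hf.mono (Set.inter_subset_left.trans hsub)).abs) ?_
    fun_prop
  have hK : IsCompact (C ∩ (fun y => |f y| - ε * ‖y - x‖) ⁻¹' Set.Ici 0) :=
    hCc.of_isClosed_subset (hCf.preimage_isClosed_of_isClosed hCc.isClosed isClosed_Ici)
      Set.inter_subset_left
  have hfar : ∀ y, y ≠ x → ε * ‖y - x‖ ≤ |f y| → r₀ ≤ ‖y - x‖ := by
    intro y hy hb
    by_contra! hlt
    have := hball (show dist y x < r₀ by rwa [dist_eq_norm]) hy
    linarith
  obtain ⟨y₁, hy₁, hmin⟩ := hK.exists_isMinOn (f := fun y => ‖y - x‖)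
    ⟨y₀, ⟨⟨by simp [hρ, dist_eq_norm], hfar _ hne hbad⟩, by simpa using hbad⟩⟩ (by fun_prop)
  obtain ⟨⟨hy₁ρ, hy₁r⟩, hy₁b⟩ := hy₁
  have hy₁ρ' : ‖y₁ - x‖ ≤ ρ := by simpa [dist_eq_norm] using hy₁ρ
  refine ⟨y₁, hr₀.trans_le hy₁r, hy₁ρ'.trans_lt hy₀, by simpa using hy₁b, ?_⟩
  intro y hy hyx
  by_contra! hlt
  have hmem : y ∈ C ∩ (fun y => |f y| - ε * ‖y - x‖) ⁻¹' Set.Ici 0 := by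
    refine ⟨⟨?_, hfar _ hyx hlt.le⟩, by simpa using hlt.le⟩
    rw [Metric.mem_closedBall, dist_eq_norm]; linarith
  have := hmin hmem
  simp only [Set.mem_ofPred_eq] at this
  linarith

lemma eventually_deviation_lt {u : V → ℝ} {x e : V} {ε : ℝ} (hd : DifferentiableAt ℝ u x)
    (h : ‖gradient u x - e‖ < ε) :
    ∀ᶠ y in nhds x, y ≠ x → |u y - u x - inner ℝ e (y - x)| < ε * ‖y - x‖ := by
  have h1 := hd.hasFDerivAt.isLittleO
  rw [Asymptotics.isLittleO_iff] at h1
  have hpos : 0 < (ε - ‖gradient u x - e‖) / 2 := by linarith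
  filter_upwards [h1 hpos] with y hy hne
  have hn : 0 < ‖y - x‖ := norm_pos_iff.mpr (sub_ne_zero.mpr hne)
  rw [← inner_gradient_eq, Real.norm_eq_abs] at hy
  have e1 : u y - u x - inner ℝ e (y - x) =
      (u y - u x - inner ℝ (gradient u x) (y - x)) + inner ℝ (gradient u x - e) (y - x) := by
    rw [inner_sub_left]; ring
  have h2 : |inner ℝ (gradient u x - e) (y - x)| ≤ ‖gradient u x - e‖ * ‖y - x‖ :=
    abs_real_inner_le_norm _ _
  rw [e1]
  refine (abs_add_le _ _).trans_lt ?_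
  nlinarith

lemma abs_sub_le_of_norm_gradient_le {u : V → ℝ} {B : Set V} {L : ℝ}
    (hd : ∀ y ∈ B, DifferentiableAt ℝ u y) (hg : ∀ y ∈ B, ‖gradient u y‖ ≤ L)
    (hB : Convex ℝ B) {x y : V} (hx : x ∈ B) (hy : y ∈ B) : |u y - u x| ≤ L * ‖y - x‖ := by
  have := hB.norm_image_sub_le_of_norm_fderiv_le hd
    (fun z hz => by rw [← norm_gradient_eq]; exact hg z hz) hx hy
  simpa using this

/-- One-sided growth in the direction `e`. -/
lemma sub_le_of_inner_gradient_le {u : V → ℝ} {B : Set V} {e : V} {L t : ℝ}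
    (hd : ∀ y ∈ B, DifferentiableAt ℝ u y) (hg : ∀ y ∈ B, inner ℝ e (gradient u y) ≤ L)
    (hB : Convex ℝ B) {y : V} (hy : y ∈ B) (hty : y + t • e ∈ B) (ht : 0 ≤ t) :
    u (y + t • e) - u y ≤ L * t := by
  have hseg : ∀ s ∈ Set.Icc (0 : ℝ) t, y + s • e ∈ B := by
    intro s hs
    rcases ht.eq_or_lt with h0 | h0
    · have : s = 0 := le_antisymm (by linarith [hs.2]) hs.1
      simpa [this] using hy
    · have := hB.add_smul_sub_mem hy hty (t := s / t)
        ⟨div_nonneg hs.1 ht, div_le_one_of_le₀ hs.2 ht⟩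
      rwa [add_sub_cancel_left, smul_smul, div_mul_cancel₀ _ h0.ne'] at this
  have h := (convex_Icc 0 t).image_sub_le_mul_sub_of_deriv_le (f := fun s : ℝ => u (y + s • e))
    (C := L) ?_ ?_ ?_ 0 ⟨le_rfl, ht⟩ t ⟨ht, le_rfl⟩ ht
  · simpa using h
  · intro s hs
    exact (hasDerivAt_segment (hd _ (hseg s hs))).continuousAt.continuousWithinAt
  · intro s hs
    exact (hasDerivAt_segment (hd _ (hseg s (interior_subset hs)))).differentiableAt.differentiableWithinAt
  · intro s hs
    rw [(hasDerivAt_segment (hd _ (hseg s (interior_subset hs)))).deriv, real_inner_comm]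
    exact hg _ (hseg s (interior_subset hs))

/-- From a point of first violation one reaches a nearby violation transversal to the
hyperplane orthogonal to `e`. -/
lemma exists_transversal_violation {u : V → ℝ} {B : Set V} {e w : V} {x : V} {η ε : ℝ}
    (hd : ∀ y ∈ B, DifferentiableAt ℝ u y)
    (hg : ∀ y ∈ B, ‖gradient u y‖ ≤ 1 + η) (he : ‖e‖ = 1) (hB : Convex ℝ B)
    (hε : 0 < ε) (hε1 : ε ≤ 1 / 3000) (hη : η ≤ ε ^ 2 / 2560)
    (hw : 0 < ‖w‖) (hBx : Metric.closedBall x ‖w‖ ⊆ B)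
    (hbad : ε * ‖w‖ ≤ |u (x + w) - u x - inner ℝ e w|) :
    ∃ z : V, ‖z‖ ≤ (1 - ε / 20) * ‖w‖ ∧ 5 * ε * ‖w‖ ≤ |inner ℝ e z| ∧
      ε * ‖w‖ / 2 ≤ |u (x + z) - u x - inner ℝ e z| := by
  set ρ := ‖w‖ with hρ
  have hη1 : η ≤ 1 / 2560 := by nlinarith
  -- The violation is first pulled towards `x`. This leaves room, inside radius `(1 - ε/20) ρ`, for
  -- a move along `e` and later for a tube around the segment.
  obtain ⟨w', hw'⟩ : ∃ w' : V, w' = (1 - ε / 10) • w := ⟨_, rfl⟩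
  have hn' : ‖w'‖ = (1 - ε / 10) * ρ := by
    rw [hw', norm_smul, Real.norm_of_nonneg (by linarith)]
  set f : V → ℝ := fun z => u (x + z) - u x - inner ℝ e z with hf
  have hmem : ∀ z : V, ‖z‖ ≤ ρ → x + z ∈ B := fun z hz => hBx (by simpa [dist_eq_norm] using hz)
  have hL : ∀ z z' : V, ‖z‖ ≤ ρ → ‖z'‖ ≤ ρ → |f z - f z'| ≤ 3 * ‖z - z'‖ := by
    intro z z' hz hz'
    have h1 := abs_sub_le_of_norm_gradient_le hd hg hB (hmem z' hz') (hmem z hz)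
    have h2 : |inner ℝ e (z - z')| ≤ 1 * ‖z - z'‖ := by
      rw [← he]; exact abs_real_inner_le_norm _ _
    have e1 : f z - f z' = (u (x + z) - u (x + z')) - inner ℝ e (z - z') := by
      simp only [hf, inner_sub_right]; ring
    rw [add_sub_add_left_eq_sub] at h1
    rw [e1]
    refine (abs_sub _ _).trans ?_
    nlinarith [norm_nonneg (z - z')]
  have hin : inner ℝ e w' = (1 - ε / 10) * inner ℝ e w := by rw [hw', inner_smul_right]
  have hfw' : |f w' - f w| ≤ 3 * (ε / 10 * ρ) := by
    have h1 := hL w' w (by rw [hn']; nlinarith) le_rfl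
    have e1 : w' - w = (-(ε / 10)) • w := by rw [hw']; module
    rwa [e1, norm_smul, Real.norm_eq_abs, abs_neg, abs_of_nonneg (a := ε / 10) (by positivity)]
      at h1
  have hfw'' : 7 / 10 * ε * ρ ≤ |f w'| := by
    have h1 : |f w| ≤ |f w'| + |f w' - f w| := by
      have := abs_sub_abs_le_abs_sub (f w) (f w')
      rw [abs_sub_comm (f w)] at this; linarith
    have h2 : ε * ρ ≤ |f w| := hbad
    linarith
  -- If `w` is nearly orthogonal to `e`, then `u(x + w)` may equal `u(x)` and the kernel weight may
  -- vanish. In that case the point is moved by `12 ε ρ` along `e`.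
  by_cases hcase : 6 * ε * ρ ≤ |inner ℝ e w|
  · refine ⟨w', ?_, ?_, ?_⟩
    · rw [hn']; nlinarith
    · rw [hin, abs_mul, abs_of_nonneg (by linarith : (0:ℝ) ≤ 1 - ε / 10)]
      have h1 : (1 - ε / 10) * (6 * ε * ρ) ≤ (1 - ε / 10) * |inner ℝ e w| := by
        gcongr; linarith
      have : 0 < ε * ρ := by positivity
      nlinarith
    · change ε * ρ / 2 ≤ |f w'|
      have : 0 < ε * ρ := by positivity
      linarith
  · push Not at hcase
    have hin' : |inner ℝ e w'| ≤ 6 * ε * ρ := by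
      rw [hin, abs_mul, abs_of_nonneg (by linarith : (0:ℝ) ≤ 1 - ε / 10)]
      have : (1 - ε / 10) * |inner ℝ e w| ≤ 1 * |inner ℝ e w| := by gcongr; linarith
      linarith
    have hee : inner ℝ e e = (1 : ℝ) := by rw [real_inner_self_eq_norm_sq, he]; norm_num
    -- As `w'` is almost orthogonal to `e`, the move adds at most `288 ε² ρ²` to the squared norm,
    -- less than the room of order `ε ρ²` when `ε ≤ 1/3000`.
    have hnorm : ∀ t : ℝ, |t| = 12 * ε * ρ → ‖w' + t • e‖ ≤ (1 - ε / 20) * ρ := by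
      intro t ht
      apply le_of_sq_le_sq _ (by nlinarith)
      rw [norm_add_sq_real, inner_smul_right, real_inner_comm, norm_smul, he, hn', mul_one,
        Real.norm_eq_abs, ht]
      have h1 : t * inner ℝ e w' ≤ (12 * ε * ρ) * (6 * ε * ρ) := by
        refine (le_abs_self _).trans ?_
        rw [abs_mul, ht]; gcongr
      have h2 : 0 ≤ ε * ρ ^ 2 * (1 / 3000 - ε) := by
        have : 0 ≤ 1 / 3000 - ε := by linarith
        positivity
      have h3 : 0 ≤ ε * ρ ^ 2 := by positivity
      nlinarith
    have hinn : ∀ t : ℝ, |t| = 12 * ε * ρ → 5 * ε * ρ ≤ |inner ℝ e (w' + t • e)| := by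
      intro t ht
      rw [inner_add_right, inner_smul_right, hee, mul_one]
      have h1 : |t| ≤ |inner ℝ e w' + t| + |inner ℝ e w'| := by
        have := abs_sub (inner ℝ e w' + t) (inner ℝ e w'); simpa using this
      have : 0 < ε * ρ := by positivity
      linarith
    have ht0 : (0:ℝ) ≤ 12 * ε * ρ := by positivity
    have hgB : ∀ y ∈ B, inner ℝ e (gradient u y) ≤ 1 + η := by
      intro y hy
      refine (real_inner_le_norm _ _).trans ?_
      rw [he, one_mul]; exact hg y hy
    have hsmall : η * (12 * ε * ρ) ≤ ε * ρ / 100 := by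
      have : 0 < ε * ρ := by positivity
      nlinarith
    have hεle : (1 - ε / 20) * ρ ≤ ρ := by nlinarith
    have hw'le : ‖w'‖ ≤ ρ := by rw [hn']; nlinarith
    -- Since `e·∇u ≤ 1 + η`, the deviation `f` grows in direction `e` at rate at most `η`. A
    -- negative deviation therefore survives a move along `+e`, and a positive one a move along
    -- `-e`.
    rcases le_total (f w') 0 with hs | hs
    · have htt : |12 * ε * ρ| = 12 * ε * ρ := abs_of_nonneg ht0
      refine ⟨w' + (12 * ε * ρ) • e, hnorm _ htt, hinn _ htt, ?_⟩
      have h1 := sub_le_of_inner_gradient_le hd hgB hB (hmem w' hw'le)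
        (t := 12 * ε * ρ) (by
          rw [add_assoc]; exact hmem _ ((hnorm _ htt).trans hεle)) ht0
      rw [abs_of_nonpos hs] at hfw''
      rw [add_assoc] at h1
      rw [le_abs]; right
      have : f w' = u (x + w') - u x - inner ℝ e w' := rfl
      rw [inner_add_right, inner_smul_right, hee]
      have : 0 < ε * ρ := by positivity
      nlinarith
    · have htt : |(-(12 * ε * ρ))| = 12 * ε * ρ := by rw [abs_neg, abs_of_nonneg ht0]
      refine ⟨w' + (-(12 * ε * ρ)) • e, hnorm _ htt, hinn _ htt, ?_⟩
      have h0 := hmem _ ((hnorm _ htt).trans hεle)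
      have h1 := sub_le_of_inner_gradient_le hd hgB hB h0
        (t := 12 * ε * ρ) (by
          have : x + (w' + (-(12 * ε * ρ)) • e) + (12 * ε * ρ) • e = x + w' := by module
          rw [this]; exact hmem _ hw'le) ht0
      have e1 : x + (w' + (-(12 * ε * ρ)) • e) + (12 * ε * ρ) • e = x + w' := by module
      rw [e1] at h1
      rw [abs_of_nonneg hs] at hfw''
      rw [le_abs]; left
      have : f w' = u (x + w') - u x - inner ℝ e w' := rfl
      rw [inner_add_right, inner_smul_right, hee]
      have : 0 < ε * ρ := by positivity
      nlinarith


lemma volume_ball_eq [Nontrivial V] (x : V) {r : ℝ} (hr : 0 ≤ r) :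
    volume (Metric.ball x r) =
      ENNReal.ofReal (r ^ d * (volume (Metric.ball (0 : V) 1)).toReal) := by
  rw [Measure.addHaar_ball volume x hr, finrank_euclideanSpace_fin,
    ENNReal.ofReal_mul (by positivity), ENNReal.ofReal_toReal measure_ball_lt_top.ne]

/-- The constant in `le_lintegral_kernel_deficit`. -/
noncomputable def deficitConst (d : ℕ) (q ε : ℝ) : ℝ :=
  (ε / 3) ^ q * (ε ^ 2 / 1024) *
    ((ε / 20) ^ d * (volume (Metric.ball (0 : EuclideanSpace ℝ (Fin d)) 1)).toReal)

lemma volume_unit_ball_pos : 0 < (volume (Metric.ball (0 : V) 1)).toReal :=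
  ENNReal.toReal_pos (Metric.measure_ball_pos _ _ one_pos).ne' measure_ball_lt_top.ne

lemma deficitConst_pos (d : ℕ) (q : ℝ) {ε : ℝ} (hε : 0 < ε) : 0 < deficitConst d q ε := by
  have h := volume_unit_ball_pos (d := d)
  unfold deficitConst
  positivity

/-- Dichotomy: either `u` stays close to slope `e` around `x` in `B_R(x)`, or the deficit
`(1 - η - e·∇u)_+` has a definite weighted integral in `B_R(x)`. -/
theorem le_lintegral_kernel_deficit [Nontrivial V] {u : V → ℝ} {e x y₀ : V}
    {η ε R q a : ℝ}
    (hd : ∀ y ∈ Metric.ball (0 : V) 8, DifferentiableAt ℝ u y)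
    (hc : ContinuousOn (fun y => gradient u y) (Metric.ball 0 8))
    (hg : ∀ y ∈ Metric.ball (0 : V) 8, ‖gradient u y‖ ≤ 1 + η) (he : ‖e‖ = 1)
    (hε : 0 < ε) (hε1 : ε ≤ 1 / 3000) (hη0 : 0 ≤ η) (hη : η ≤ ε ^ 2 / 2560)
    (hq : 0 ≤ q) (hqa : q + d ≤ a)
    (hx : x ∈ Metric.ball (0 : V) 1) (hvx : 1 - η ≤ inner ℝ e (gradient u x))
    (hR4 : R ≤ 4) (hy₀ : ‖y₀ - x‖ < R)
    (hbad : ε * ‖y₀ - x‖ < |u y₀ - u x - inner ℝ e (y₀ - x)|) :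
    ENNReal.ofReal (deficitConst d q ε * R ^ (-(a - q - d))) ≤
      ∫⁻ y in Metric.ball x R, ENNReal.ofReal
        (|u x - u y| ^ q * ‖x - y‖ ^ (-a) * max (1 - η - inner ℝ e (gradient u y)) 0) := by
  have hx1 : ‖x‖ < 1 := by simpa using hx
  have hsub : Metric.ball x R ⊆ Metric.ball (0 : V) 8 := by
    apply Metric.ball_subset_ball'
    rw [dist_zero_right]; linarith
  have hucont : ContinuousOn u (Metric.ball 0 8) := fun y hy =>
    (hd y hy).continuousAt.continuousWithinAt
  have hx8 : x ∈ Metric.ball (0 : V) 8 := by rw [mem_ball_zero_iff]; linarith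
  have hη1 : η ≤ 1 := by nlinarith
  -- A nearly maximal directional derivative forces `∇u(x)` to be close to `e`. So flatness holds
  -- near `x`, and a first violation exists.
  have hgx : ‖gradient u x - e‖ < ε := by
    have h := norm_gradient_sub_sq_le he hη0 hη1 (hg x hx8)
    rw [max_eq_right (by linarith)] at h
    apply lt_of_pow_lt_pow_left₀ 2 hε.le
    nlinarith
  set f : V → ℝ := fun y => u y - u x - inner ℝ e (y - x) with hf
  have hne : y₀ ≠ x := by
    rintro rfl
    simp at hbad
  obtain ⟨y₁, hρ0, hρR, hb1, hmin⟩ := exists_first_violation (f := f) (ε := ε) (R := R)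
    (by
      refine ContinuousOn.sub ((hucont.mono hsub).sub continuousOn_const) ?_
      fun_prop)
    (eventually_deviation_lt (hd x hx8) hgx) hy₀ hne hbad.le
  set ρ := ‖y₁ - x‖ with hρ
  have hcl : Metric.closedBall x ρ ⊆ Metric.ball (0 : V) 8 :=
    (Metric.closedBall_subset_ball hρR).trans hsub
  obtain ⟨z, hz1, hz2, hz3⟩ := exists_transversal_violation (w := y₁ - x) (x := x) hd hg he
    (convex_ball 0 8) hε hε1 hη hρ0 hcl (by rw [add_sub_cancel]; exact hb1)
  rw [← hρ] at hz1 hz2 hz3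
  have hερ : 0 < ε * ρ := by positivity
  have hfb : ∀ w : V, ‖w‖ < ρ → |u (x + w) - u x - inner ℝ e w| ≤ ε * ‖w‖ := by
    intro w hw
    by_cases hw0 : w = 0
    · simp [hw0]
    · have := hmin (x + w) (by simpa using hw) (by simpa using hw0)
      simpa [hf] using this
  -- This tube radius fits in `B_ρ(x)` because `‖z‖ ≤ (1 - ε/20) ρ`.
  set r := ε * ρ / 20 with hr
  have hr0 : 0 < r := by positivity
  have hzr : ‖z‖ + r ≤ ρ := by rw [hr]; nlinarith
  have hpath : ∀ s ∈ Set.Icc (1 / 8 : ℝ) 1, ∀ ξ : V, ‖ξ‖ < r → ‖s • z + ξ‖ < ρ := by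
    intro s hs ξ hξ
    calc ‖s • z + ξ‖ ≤ ‖s • z‖ + ‖ξ‖ := norm_add_le _ _
      _ ≤ 1 * ‖z‖ + ‖ξ‖ := by
          rw [norm_smul, Real.norm_of_nonneg (by linarith [hs.1])]
          gcongr; exact hs.2
      _ < ρ := by linarith
  -- Inside `B_ρ(x)` the deviation is still at most `ε` times the distance, while `|e·z| ≥ 5ερ`.
  -- From one eighth of the way onwards the linear part therefore dominates, and `u` differs from
  -- `u(x)` by more than `ερ/3`.
  have hlow : ∀ s ∈ Set.Icc (1 / 8 : ℝ) 1, ∀ ξ : V, ‖ξ‖ < r →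
      ε * ρ / 3 < |u x - u (x + (s • z + ξ))| := by
    intro s hs ξ hξ
    have h1 := hfb _ (hpath s hs ξ hξ)
    have hn : ‖s • z + ξ‖ ≤ s * ρ + r := by
      refine (norm_add_le _ _).trans ?_
      rw [norm_smul, Real.norm_of_nonneg (by linarith [hs.1])]
      have : s * ‖z‖ ≤ s * ρ := by
        have h0 : (0:ℝ) ≤ s := by linarith [hs.1]
        have : ‖z‖ ≤ ρ := by linarith
        gcongr
      linarith
    have h2 : s * (5 * ε * ρ) - r ≤ |inner ℝ e (s • z + ξ)| := by
      rw [inner_add_right, inner_smul_right]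
      have h3 : |inner ℝ e ξ| ≤ ‖ξ‖ := by
        simpa [he] using abs_real_inner_le_norm e ξ
      have h4 : |s * inner ℝ e z| ≤ |s * inner ℝ e z + inner ℝ e ξ| + |inner ℝ e ξ| := by
        have := abs_sub (s * inner ℝ e z + inner ℝ e ξ) (inner ℝ e ξ); simpa using this
      rw [abs_mul, abs_of_nonneg (by linarith [hs.1] : (0:ℝ) ≤ s)] at h4
      have h5 : s * (5 * ε * ρ) ≤ s * |inner ℝ e z| := by
        have h0 : (0:ℝ) ≤ s := by linarith [hs.1]
        gcongr
      linarith
    have h3 : |inner ℝ e (s • z + ξ)| ≤ |u (x + (s • z + ξ)) - u x - inner ℝ e (s • z + ξ)| +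
        |u x - u (x + (s • z + ξ))| := by
      have := abs_add_le (u (x + (s • z + ξ)) - u x - inner ℝ e (s • z + ξ))
        (u x - u (x + (s • z + ξ)))
      rw [← abs_neg] at this
      have e1 : -(u (x + (s • z + ξ)) - u x - inner ℝ e (s • z + ξ) +
        (u x - u (x + (s • z + ξ)))) = inner ℝ e (s • z + ξ) := by ring
      rwa [e1] at this
    have h4 : ε * ‖s • z + ξ‖ ≤ ε * (s * ρ + r) := by gcongr
    have h5 : ε * r ≤ r := by nlinarith
    have h6 : (1/8) * (ε * ρ) ≤ s * (ε * ρ) := by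
      have := hs.1; gcongr
    nlinarith
  -- the region swept by the segments
  set U : Set V := Metric.ball x ρ ∩ {y | ε * ρ / 3 < |u x - u y|} with hU
  have hUo : IsOpen U :=
    ((continuousOn_const.sub (hucont.mono (Metric.ball_subset_closedBall.trans hcl))).abs).isOpen_inter_preimage
      Metric.isOpen_ball isOpen_Ioi
  set N : V → ℝ := fun y => max (1 - η - inner ℝ e (gradient u y)) 0 with hN
  have hNm : Measurable N := by
    have := measurable_gradient u
    exact (measurable_const.sub (measurable_const.inner this)).max measurable_const
  -- On each segment from `x + z/8 + ξ` to `x + z + ξ` the deviation starts at most of size `ε(ρ/8 +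
  -- r)` and ends at least of size `ερ/2 - 3r`. The change exceeds `ερ/16`, which forces a deficit
  -- on each segment.
  have hsweep : ENNReal.ofReal (ε ^ 2 / 1024) * volume (Metric.ball (0 : V) r) ≤
      ∫⁻ y in U, ENNReal.ofReal (N y) := by
    apply mul_volume_ball_le_lintegral hNm.ennreal_ofReal (z := x + (1 / 8 : ℝ) • z)
      (ζ := (7 / 8 : ℝ) • z)
    · intro ξ hξ
      have hξ' : ‖ξ‖ < r := by simpa using hξ
      have hz' : ∀ s : ℝ, x + (1 / 8 : ℝ) • z + s • (7 / 8 : ℝ) • z + ξ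
          = x + (1 / 8 : ℝ) • z + ξ + s • (7 / 8 : ℝ) • z := fun s => by abel
      simp only [hz']
      apply le_lintegral_deficit_segment hd hc hg he hε (by linarith) hη0 hη hρ0
      · intro s hs
        apply hcl
        have := hpath (1 / 8 + s * (7 / 8)) ⟨by linarith [hs.1], by linarith [hs.2]⟩ ξ hξ'
        rw [Metric.mem_closedBall, dist_eq_norm]
        have e1 : x + (1 / 8 : ℝ) • z + ξ + s • (7 / 8 : ℝ) • z - x =
          (1 / 8 + s * (7 / 8)) • z + ξ := by module
        rw [e1]; exact this.le
      · rw [norm_smul]; norm_num; linarith [norm_nonneg z]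
      · have e1 : x + (1 / 8 : ℝ) • z + ξ + (7 / 8 : ℝ) • z = x + ((1 : ℝ) • z + ξ) := by module
        have e2 : x + (1 / 8 : ℝ) • z + ξ = x + ((1 / 8 : ℝ) • z + ξ) := by module
        rw [e1, e2]
        have h1 := hfb _ (hpath (1 / 8) ⟨le_rfl, by norm_num⟩ ξ hξ')
        have hn : ‖(1 / 8 : ℝ) • z + ξ‖ ≤ 1 / 8 * ρ + r := by
          refine (norm_add_le _ _).trans ?_
          rw [norm_smul]; norm_num; linarith
        have h2 : ε * ‖(1 / 8 : ℝ) • z + ξ‖ ≤ ε * (1 / 8 * ρ + r) := by gcongr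
        have h2' : ε * r ≤ r / 3000 := by nlinarith
        have hend : x + ((1 : ℝ) • z + ξ) ∈ Metric.ball (0 : V) 8 := hcl (by
          rw [Metric.mem_closedBall, dist_eq_norm, add_sub_cancel_left]
          exact (hpath 1 ⟨by norm_num, le_rfl⟩ ξ hξ').le)
        have hz8 : x + z ∈ Metric.ball (0 : V) 8 := hcl (by
          rw [Metric.mem_closedBall, dist_eq_norm, add_sub_cancel_left]; linarith)
        have h3 := abs_sub_le_of_norm_gradient_le hd hg (convex_ball 0 8) hz8 hend
        have e3 : x + ((1 : ℝ) • z + ξ) - (x + z) = ξ := by module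
        rw [e3] at h3
        have h3' : |u (x + ((1 : ℝ) • z + ξ)) - u (x + z)| ≤ 2 * r := by
          refine h3.trans ?_
          have : (1 + η) * ‖ξ‖ ≤ 2 * r := by gcongr; linarith
          exact this
        have h4 : |inner ℝ e ξ| ≤ r := by
          have := abs_real_inner_le_norm e ξ
          rw [he, one_mul] at this; linarith
        have e4 : u (x + z) - u x - inner ℝ e z =
            (u (x + ((1 : ℝ) • z + ξ)) - u (x + ((1 / 8 : ℝ) • z + ξ)) - inner ℝ e ((7 / 8 : ℝ) • z))
            + (u (x + ((1 / 8 : ℝ) • z + ξ)) - u x - inner ℝ e ((1 / 8 : ℝ) • z + ξ))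
            - (u (x + ((1 : ℝ) • z + ξ)) - u (x + z)) + inner ℝ e ξ := by
          simp only [inner_add_right, inner_smul_right]; ring
        rw [e4] at hz3
        have t1 := abs_add_le ((u (x + ((1 : ℝ) • z + ξ)) - u (x + ((1 / 8 : ℝ) • z + ξ)) - inner ℝ e ((7 / 8 : ℝ) • z))
            + (u (x + ((1 / 8 : ℝ) • z + ξ)) - u x - inner ℝ e ((1 / 8 : ℝ) • z + ξ))
            - (u (x + ((1 : ℝ) • z + ξ)) - u (x + z))) (inner ℝ e ξ)
        have t2 := abs_sub ((u (x + ((1 : ℝ) • z + ξ)) - u (x + ((1 / 8 : ℝ) • z + ξ)) - inner ℝ e ((7 / 8 : ℝ) • z))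
            + (u (x + ((1 / 8 : ℝ) • z + ξ)) - u x - inner ℝ e ((1 / 8 : ℝ) • z + ξ)))
            (u (x + ((1 : ℝ) • z + ξ)) - u (x + z))
        have t3 := abs_add_le (u (x + ((1 : ℝ) • z + ξ)) - u (x + ((1 / 8 : ℝ) • z + ξ)) - inner ℝ e ((7 / 8 : ℝ) • z))
            (u (x + ((1 / 8 : ℝ) • z + ξ)) - u x - inner ℝ e ((1 / 8 : ℝ) • z + ξ))
        have hr' : r = ε * ρ / 20 := hr
        linarith
    · intro s hs y hy
      have hy' : ‖y - (x + (1 / 8 : ℝ) • z + s • (7 / 8 : ℝ) • z)‖ < r := by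
        simpa [dist_eq_norm] using hy
      set ξ := y - (x + (1 / 8 : ℝ) • z + s • (7 / 8 : ℝ) • z) with hξ
      have e1 : y = x + ((1 / 8 + s * (7 / 8)) • z + ξ) := by rw [hξ]; module
      have hs' : (1 / 8 + s * (7 / 8)) ∈ Set.Icc (1 / 8 : ℝ) 1 :=
        ⟨by linarith [hs.1], by linarith [hs.2]⟩
      refine ⟨?_, ?_⟩
      · rw [Metric.mem_ball, dist_eq_norm, e1, add_sub_cancel_left]
        exact hpath _ hs' ξ hy'
      · change ε * ρ / 3 < |u x - u y|
        rw [e1]; exact hlow _ hs' ξ hy'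
  have hK0 : 0 ≤ (ε * ρ / 3) ^ q * ρ ^ (-a) := by positivity
  calc ENNReal.ofReal (deficitConst d q ε * R ^ (-(a - q - d)))
      ≤ ENNReal.ofReal (deficitConst d q ε * ρ ^ (-(a - q - d))) := by
        apply ENNReal.ofReal_le_ofReal
        have := (deficitConst_pos d q hε).le
        gcongr ?_ * ?_
        apply Real.rpow_le_rpow_of_nonpos hρ0 hρR.le
        linarith
    _ = ENNReal.ofReal ((ε * ρ / 3) ^ q * ρ ^ (-a)) *
        (ENNReal.ofReal (ε ^ 2 / 1024) * volume (Metric.ball (0 : V) r)) := by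
        rw [volume_ball_eq _ hr0.le, ← ENNReal.ofReal_mul (by positivity),
          ← ENNReal.ofReal_mul hK0]
        congr 1
        unfold deficitConst
        have e1 : (ε * ρ / 3) ^ q = (ε / 3) ^ q * ρ ^ q := by
          rw [← Real.mul_rpow (by positivity) hρ0.le]; congr 1; ring
        have e2 : r ^ d = (ε / 20) ^ d * ρ ^ (d : ℝ) := by
          rw [Real.rpow_natCast, ← mul_pow]; congr 1; rw [hr]; ring
        have e3 : ρ ^ (-(a - q - d)) = ρ ^ q * ρ ^ (-a) * ρ ^ (d : ℝ) := by
          rw [← Real.rpow_add hρ0, ← Real.rpow_add hρ0]; congr 1; ring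
        rw [e1, e2, e3]; ring
    _ ≤ ENNReal.ofReal ((ε * ρ / 3) ^ q * ρ ^ (-a)) * ∫⁻ y in U, ENNReal.ofReal (N y) := by
        gcongr
    _ = ∫⁻ y in U, ENNReal.ofReal ((ε * ρ / 3) ^ q * ρ ^ (-a)) * ENNReal.ofReal (N y) :=
        (lintegral_const_mul _ hNm.ennreal_ofReal).symm
    _ ≤ ∫⁻ y in U, ENNReal.ofReal (|u x - u y| ^ q * ‖x - y‖ ^ (-a) * N y) := by
        apply setLIntegral_mono' hUo.measurableSet
        intro y hy
        rw [← ENNReal.ofReal_mul hK0]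
        apply ENNReal.ofReal_le_ofReal
        have hy2 : ε * ρ / 3 < |u x - u y| := hy.2
        have hxy : 0 < ‖x - y‖ := by
          rw [norm_pos_iff, sub_ne_zero]
          rintro rfl
          simp at hy2; linarith
        have hxyρ : ‖x - y‖ ≤ ρ := by
          have := hy.1
          rw [Metric.mem_ball', dist_eq_norm] at this; exact this.le
        have hN0 : 0 ≤ N y := le_max_right _ _
        have h1 : ρ ^ (-a) ≤ ‖x - y‖ ^ (-a) := by
          apply Real.rpow_le_rpow_of_nonpos hxy hxyρ
          have : (0:ℝ) ≤ d := Nat.cast_nonneg d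
          linarith
        gcongr
    _ ≤ _ := lintegral_mono_set
        (Set.inter_subset_left.trans (Metric.ball_subset_ball hρR.le))

/-- A function close to slope `e` in `B_4(x)` has small total deficit in `B_1`. -/
theorem lintegral_deficit_le_of_flat {u : V → ℝ} {e x : V} {η ε : ℝ}
    (hd : ∀ y ∈ Metric.ball (0 : V) 8, DifferentiableAt ℝ u y)
    (hc : ContinuousOn (fun y => gradient u y) (Metric.ball 0 8))
    (hg : ∀ y ∈ Metric.ball (0 : V) 8, ‖gradient u y‖ ≤ 1 + η) (he : ‖e‖ = 1)
    (hε : 0 < ε) (hx : x ∈ Metric.ball (0 : V) 1)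
    (hflat : ∀ y, ‖y - x‖ < 4 → |u y - u x - inner ℝ e (y - x)| ≤ ε * ‖y - x‖) :
    ∫⁻ y in Metric.ball (0 : V) 1, ENNReal.ofReal (1 + η - inner ℝ e (gradient u y)) ≤
      ENNReal.ofReal (8 * ε + η) * volume (Metric.ball (0 : V) 2) := by
  have hx1 : ‖x‖ < 1 := by simpa using hx
  have hm : Measurable fun y => ENNReal.ofReal (1 + η - inner ℝ e (gradient u y)) := by
    have := measurable_gradient u
    exact (measurable_const.sub (measurable_const.inner this)).ennreal_ofReal
  -- On a unit segment in direction `e` the integral of `e·∇u` is `u(ξ + e) - u(ξ)`. The endpoints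
  -- lie within 3 and 4 of `x`, so flatness puts this difference within `7ε` of 1.
  apply lintegral_le_mul_volume_ball hm (z := 0) (ζ := e)
  · intro ξ hξ
    have hξ2 : ‖ξ‖ < 2 := by simpa using hξ
    have hcomm : ∀ s : ℝ, (0 : V) + s • e + ξ = ξ + s • e := fun s => by abel
    simp only [hcomm]
    have hseg : ∀ s ∈ Set.Icc (0 : ℝ) 1, ξ + s • e ∈ Metric.ball (0 : V) 8 := by
      intro s hs
      rw [mem_ball_zero_iff]
      refine (norm_add_le _ _).trans_lt ?_
      rw [norm_smul, he, Real.norm_of_nonneg hs.1]; linarith [hs.2]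
    have hcont : ContinuousOn (fun s : ℝ => 1 + η - inner ℝ e (gradient u (ξ + s • e)))
        (Set.Icc 0 1) :=
      continuousOn_const.sub (continuousOn_inner_gradient_segment hc e hseg)
    have hcont' := continuousOn_inner_gradient_segment hc e hseg
    rw [← ofReal_integral_eq_lintegral_ofReal hcont.integrableOn_Icc]
    · apply ENNReal.ofReal_le_ofReal
      rw [integral_Icc_eq_integral_Ioc, ← intervalIntegral.integral_of_le zero_le_one,
        intervalIntegral.integral_sub (by simp)
          (ContinuousOn.intervalIntegrable (by rwa [Set.uIcc_of_le zero_le_one]))]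
      have h1 := sub_eq_integral_inner_gradient hd hc hseg
      have h2 : ∫ s in (0 : ℝ)..1, inner ℝ e (gradient u (ξ + s • e)) = u (ξ + e) - u ξ := by
        rw [h1]; simp only [real_inner_comm]
      rw [h2]
      have n1 : ‖ξ - x‖ < 3 := (norm_sub_le _ _).trans_lt (by linarith)
      have n2 : ‖ξ + e - x‖ < 4 := by
        have : ξ + e - x = (ξ - x) + e := by abel
        rw [this]
        exact (norm_add_le _ _).trans_lt (by linarith)
      have f1 := (abs_le.1 (hflat ξ (by linarith))).2
      have f2 := (abs_le.1 (hflat (ξ + e) n2)).1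
      have e1 : inner ℝ e (ξ + e - x) = inner ℝ e (ξ - x) + 1 := by
        have : ξ + e - x = (ξ - x) + e := by abel
        rw [this, inner_add_right, real_inner_self_eq_norm_sq, he]; norm_num
      rw [e1] at f2
      have g1 : ε * ‖ξ - x‖ ≤ ε * 3 := by gcongr
      have g2 : ε * ‖ξ + e - x‖ ≤ ε * 4 := by gcongr
      simp only [intervalIntegral.integral_const, sub_zero, smul_eq_mul, one_mul]
      linarith
    · rw [Filter.EventuallyLE, ae_restrict_iff' measurableSet_Icc]
      refine Filter.Eventually.of_forall fun s hs => ?_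
      have h1 := real_inner_le_norm e (gradient u (ξ + s • e))
      rw [he, one_mul] at h1
      have h2 := hg _ (hseg s hs)
      simp only [Pi.zero_apply]; linarith
  · intro s hs
    apply Metric.ball_subset_ball'
    rw [dist_eq_norm, zero_sub, norm_neg, zero_add, norm_smul, he, Real.norm_of_nonneg hs.1]
    linarith [hs.2]

end Geometry

/-! ### De Giorgi iteration from the energy inequality -/

section DeGiorgi

variable {d : ℕ}

local notation "V" => EuclideanSpace ℝ (Fin d)

/-- The directional derivative `e·∇u` minus the barrier `b‖x‖` and the level `m`. -/
noncomputable def excess (u : V → ℝ) (e : V) (b m : ℝ) (x : V) : ℝ :=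
  inner ℝ e (gradient u x) - b * ‖x‖ - m

/-- The superlevel set of the excess in the unit ball. -/
def excessSet (u : V → ℝ) (e : V) (b m : ℝ) : Set V :=
  {x | x ∈ Metric.ball (0 : V) 1 ∧ 0 ≤ excess u e b m x}

/-- The energy density of the positive part of a function `w`. -/
noncomputable def energyDensity (u : V → ℝ) (q a : ℝ) (w : V → ℝ) (x y : V) : ℝ :=
  |u x - u y| ^ q * ‖x - y‖ ^ (-a) *
    ((max (w x) 0 - max (w y) 0) ^ 2 + max (w x) 0 * max (-w y) 0)

lemma measurable_excess (u : V → ℝ) (e : V) (b m : ℝ) : Measurable (excess u e b m) := by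
  unfold excess
  have := measurable_gradient u
  exact ((measurable_const.inner this).sub (measurable_norm.const_mul _)).sub measurable_const

lemma measurableSet_excessSet (u : V → ℝ) (e : V) (b m : ℝ) :
    MeasurableSet (excessSet u e b m) :=
  Metric.isOpen_ball.measurableSet.inter
    (measurableSet_le measurable_const (measurable_excess u e b m))

lemma volume_excessSet_le (u : V → ℝ) (e : V) (b m : ℝ) :
    volume (excessSet u e b m) ≤ volume (Metric.ball (0 : V) 1) :=
  measure_mono fun _ h => h.1

lemma volume_excessSet_ne_top (u : V → ℝ) (e : V) (b m : ℝ) :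
    volume (excessSet u e b m) ≠ ⊤ :=
  ((volume_excessSet_le u e b m).trans_lt measure_ball_lt_top).ne

lemma excess_sub (u : V → ℝ) (e : V) (b m m' : ℝ) (x : V) :
    excess u e b m x = excess u e b m' x + (m' - m) := by
  unfold excess; ring

lemma mul_rpow_cross_bound {q a R : ℝ} (hR : 0 < R) :
    (R / 8) ^ q * R ^ (-a) * (R / 4) ^ d = (1 / 8) ^ q * (1 / 4) ^ d * R ^ (-(a - q - d)) := by
  have e1 : (R / 8) ^ q = (1 / 8) ^ q * R ^ q := by
    rw [← Real.mul_rpow (by norm_num) hR.le]; congr 1; ring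
  have e2 : (R / 4) ^ d = (1 / 4) ^ d * R ^ (d : ℝ) := by
    rw [Real.rpow_natCast, ← mul_pow]; congr 1; ring
  have e3 : R ^ (-(a - q - d)) = R ^ q * R ^ (-a) * R ^ (d : ℝ) := by
    rw [← Real.rpow_add hR, ← Real.rpow_add hR]; congr 1; ring
  rw [e1, e2, e3]; ring

/-- The lower bound constant for the energy in the flat case. -/
noncomputable def flatConst (d : ℕ) (q : ℝ) : ℝ :=
  (1 / 8) ^ q * (1 / 4) ^ d * (volume (Metric.ball (0 : EuclideanSpace ℝ (Fin d)) 1)).toReal / 2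

lemma flatConst_pos (d : ℕ) (q : ℝ) : 0 < flatConst d q := by
  have h := volume_unit_ball_pos (d := d)
  unfold flatConst
  positivity

/-- In the ball of radius `R/4` about `x + (R/2)e` flatness gives `u(y) - u(x) ≥ R/8`. At least half
of that ball lies off the superlevel set, where the excess is negative, so the square term of the
energy density is at least `γ²` there. -/
lemma le_lintegral_energy_of_flat [Nontrivial V] {u : V → ℝ} {e x : V}
    {ε R q a b m γ : ℝ} (he : ‖e‖ = 1)
    (hε1 : ε ≤ 1 / 8) (hq : 0 ≤ q) (ha : 0 ≤ a) (hγ : 0 ≤ γ)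
    (hx : x ∈ Metric.ball (0 : V) 1) (hwx : γ ≤ excess u e b m x)
    (hneg : ∀ y ∈ Metric.ball (0 : V) 8, y ∉ Metric.ball (0 : V) 1 → excess u e b m y < 0)
    (hR : 0 < R) (hR4 : R ≤ 4)
    (hflat : ∀ y, ‖y - x‖ < R → |u y - u x - inner ℝ e (y - x)| ≤ ε * ‖y - x‖)
    (hS : (volume (excessSet u e b m)).toReal ≤
      (R / 4) ^ d * (volume (Metric.ball (0 : V) 1)).toReal / 2) :
    ENNReal.ofReal (flatConst d q * γ ^ 2 * R ^ (-(a - q - d))) ≤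
      ∫⁻ y in Metric.ball x R, ENNReal.ofReal (energyDensity u q a (excess u e b m) x y) := by
  have hx1 : ‖x‖ < 1 := by simpa using hx
  set D : Set V := Metric.ball (x + (R / 2) • e) (R / 4) \ excessSet u e b m with hD
  have hDm : MeasurableSet D :=
    Metric.isOpen_ball.measurableSet.diff (measurableSet_excessSet u e b m)
  have hvol : ENNReal.ofReal ((R / 4) ^ d * (volume (Metric.ball (0 : V) 1)).toReal / 2) ≤
      volume D := by
    refine le_trans ?_ (le_measure_sdiff)
    rw [volume_ball_eq (x + (R / 2) • e) (by positivity : 0 ≤ R / 4)]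
    rw [ENNReal.le_sub_iff_add_le_right (volume_excessSet_ne_top u e b m)]
    · rw [← ENNReal.ofReal_toReal (volume_excessSet_ne_top u e b m),
        ← ENNReal.ofReal_add (by positivity) (by positivity)]
      apply ENNReal.ofReal_le_ofReal
      linarith
    · rw [← ENNReal.ofReal_toReal (volume_excessSet_ne_top u e b m)]
      apply ENNReal.ofReal_le_ofReal
      refine hS.trans ?_
      have : 0 ≤ (R / 4) ^ d * (volume (Metric.ball (0 : V) 1)).toReal := by positivity
      linarith
  have hDdist : ∀ y ∈ D, ‖y - x‖ < R ∧ R / 4 ≤ inner ℝ e (y - x) := by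
    intro y hy
    have h1 : ‖y - (x + (R / 2) • e)‖ < R / 4 := by simpa [dist_eq_norm] using hy.1
    have e1 : y - x = (y - (x + (R / 2) • e)) + (R / 2) • e := by abel
    constructor
    · rw [e1]
      refine (norm_add_le _ _).trans_lt ?_
      rw [norm_smul, he, Real.norm_of_nonneg (by positivity)]; linarith
    · rw [e1, inner_add_right, inner_smul_right, real_inner_self_eq_norm_sq, he]
      have := abs_real_inner_le_norm e (y - (x + (R / 2) • e))
      rw [he, one_mul] at this
      have := (abs_le.1 this).1
      linarith
  calc ENNReal.ofReal (flatConst d q * γ ^ 2 * R ^ (-(a - q - d)))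
      = ENNReal.ofReal ((R / 8) ^ q * R ^ (-a) * γ ^ 2) *
        ENNReal.ofReal ((R / 4) ^ d * (volume (Metric.ball (0 : V) 1)).toReal / 2) := by
        rw [← ENNReal.ofReal_mul (by positivity)]
        congr 1
        have := mul_rpow_cross_bound (d := d) (q := q) (a := a) hR
        unfold flatConst
        calc _ = ((1 / 8) ^ q * (1 / 4) ^ d * R ^ (-(a - q - d))) *
              (γ ^ 2 * (volume (Metric.ball (0 : V) 1)).toReal / 2) := by ring
          _ = _ := by rw [← this]; ring
    _ ≤ ENNReal.ofReal ((R / 8) ^ q * R ^ (-a) * γ ^ 2) * volume D := by gcongr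
    _ = ∫⁻ _y in D, ENNReal.ofReal ((R / 8) ^ q * R ^ (-a) * γ ^ 2) := by
        rw [setLIntegral_const]
    _ ≤ ∫⁻ y in D, ENNReal.ofReal (energyDensity u q a (excess u e b m) x y) := by
        apply setLIntegral_mono' hDm
        intro y hy
        apply ENNReal.ofReal_le_ofReal
        obtain ⟨h1, h2⟩ := hDdist y hy
        have hy8 : y ∈ Metric.ball (0 : V) 8 := by
          rw [mem_ball_zero_iff]
          have : y = (y - x) + x := by abel
          rw [this]
          exact (norm_add_le _ _).trans_lt (by linarith)
        have hwy : excess u e b m y < 0 := by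
          by_cases hy1 : y ∈ Metric.ball (0 : V) 1
          · by_contra! h
            exact hy.2 ⟨hy1, h⟩
          · exact hneg y hy8 hy1
        have hdiff : R / 8 ≤ |u x - u y| := by
          have h3 := (abs_le.1 (hflat y h1)).1
          have h4 : ε * ‖y - x‖ ≤ 1 / 8 * R := by gcongr
          rw [abs_sub_comm]
          exact (by linarith : R / 8 ≤ u y - u x).trans (le_abs_self _)
        have hxy : 0 < ‖x - y‖ := by
          rw [norm_pos_iff, sub_ne_zero]
          rintro rfl
          simp at h2; linarith
        have hker : R ^ (-a) ≤ ‖x - y‖ ^ (-a) := by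
          apply Real.rpow_le_rpow_of_nonpos hxy _ (by linarith)
          rw [norm_sub_rev]; exact h1.le
        unfold energyDensity
        have hw1 : γ ^ 2 ≤ (max (excess u e b m x) 0 - max (excess u e b m y) 0) ^ 2 +
            max (excess u e b m x) 0 * max (-excess u e b m y) 0 := by
          rw [max_eq_right hwy.le, sub_zero]
          have h3 : γ ≤ max (excess u e b m x) 0 := le_max_of_le_left hwx
          have h4 : γ ^ 2 ≤ max (excess u e b m x) 0 ^ 2 := pow_le_pow_left₀ hγ h3 2
          have h5 : 0 ≤ max (excess u e b m x) 0 * max (-excess u e b m y) 0 := by positivity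
          linarith
        gcongr
    _ ≤ _ := by
        apply lintegral_mono_set
        intro y hy
        rw [Metric.mem_ball, dist_eq_norm]
        exact (hDdist y hy).1

/-- Since `m ≥ 1 - η`, the deficit at `y` is at most the negative part of the excess at `y`. The
cross term of the energy density thus dominates `γ` times the deficit integrand, which gives a bound
linear in `γ`. -/
lemma le_lintegral_energy_of_not_flat [Nontrivial V] {u : V → ℝ} {e x y₀ : V}
    {η ε R q a b m γ : ℝ}
    (hd : ∀ y ∈ Metric.ball (0 : V) 8, DifferentiableAt ℝ u y)
    (hc : ContinuousOn (fun y => gradient u y) (Metric.ball 0 8))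
    (hg : ∀ y ∈ Metric.ball (0 : V) 8, ‖gradient u y‖ ≤ 1 + η) (he : ‖e‖ = 1)
    (hε : 0 < ε) (hε1 : ε ≤ 1 / 3000) (hη0 : 0 ≤ η) (hη : η ≤ ε ^ 2 / 2560)
    (hq : 0 ≤ q) (hqa : q + d ≤ a) (hb : 0 ≤ b) (hm : 1 - η ≤ m)
    (hx : x ∈ Metric.ball (0 : V) 1) (hγ : 0 ≤ γ) (hwx : γ ≤ excess u e b m x)
    (hR4 : R ≤ 4) (hy₀ : ‖y₀ - x‖ < R)
    (hbad : ε * ‖y₀ - x‖ < |u y₀ - u x - inner ℝ e (y₀ - x)|) :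
    ENNReal.ofReal (deficitConst d q ε * γ * R ^ (-(a - q - d))) ≤
      ∫⁻ y in Metric.ball x R, ENNReal.ofReal (energyDensity u q a (excess u e b m) x y) := by
  have hvx : 1 - η ≤ inner ℝ e (gradient u x) := by
    unfold excess at hwx
    have : 0 ≤ b * ‖x‖ := by positivity
    linarith
  have h := le_lintegral_kernel_deficit hd hc hg he hε hε1 hη0 hη hq hqa hx hvx hR4 hy₀ hbad
  calc ENNReal.ofReal (deficitConst d q ε * γ * R ^ (-(a - q - d)))
      = ENNReal.ofReal γ * ENNReal.ofReal (deficitConst d q ε * R ^ (-(a - q - d))) := by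
        rw [← ENNReal.ofReal_mul hγ]; congr 1; ring
    _ ≤ ENNReal.ofReal γ * ∫⁻ y in Metric.ball x R, ENNReal.ofReal
        (|u x - u y| ^ q * ‖x - y‖ ^ (-a) * max (1 - η - inner ℝ e (gradient u y)) 0) := by
        gcongr
    _ = ∫⁻ y in Metric.ball x R, ENNReal.ofReal γ * ENNReal.ofReal
        (|u x - u y| ^ q * ‖x - y‖ ^ (-a) * max (1 - η - inner ℝ e (gradient u y)) 0) :=
        (lintegral_const_mul' _ _ ENNReal.ofReal_ne_top).symm
    _ ≤ _ := by
        refine lintegral_mono fun y => ?_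
        rw [← ENNReal.ofReal_mul hγ]
        apply ENNReal.ofReal_le_ofReal
        unfold energyDensity
        have h1 : γ ≤ max (excess u e b m x) 0 := le_max_of_le_left hwx
        have h2 : max (1 - η - inner ℝ e (gradient u y)) 0 ≤ max (-excess u e b m y) 0 := by
          apply max_le_max _ le_rfl
          unfold excess
          have : 0 ≤ b * ‖y‖ := by positivity
          linarith
        have h3 : γ * max (1 - η - inner ℝ e (gradient u y)) 0 ≤
            max (excess u e b m x) 0 * max (-excess u e b m y) 0 := by gcongr
        have h4 : 0 ≤ |u x - u y| ^ q * ‖x - y‖ ^ (-a) := by positivity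
        calc _ = |u x - u y| ^ q * ‖x - y‖ ^ (-a) *
              (γ * max (1 - η - inner ℝ e (gradient u y)) 0) := by ring
          _ ≤ _ := by
              gcongr
              have := sq_nonneg (max (excess u e b m x) 0 - max (excess u e b m y) 0)
              linarith

/-- From a pointwise lower bound on the energy to a bound on the superlevel set. -/
lemma mul_volume_excessSet_le {u : V → ℝ} {e : V} {q a b m m' X Y : ℝ}
    (hY : 0 ≤ Y) {R : ℝ} (hR4 : R ≤ 4) (hX : 0 ≤ X)
    (hpt : ∀ x ∈ excessSet u e b m', ENNReal.ofReal X ≤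
      ∫⁻ y in Metric.ball x R, ENNReal.ofReal (energyDensity u q a (excess u e b m) x y))
    (hE : ∫⁻ x in Metric.ball (0 : V) 8, ∫⁻ y in Metric.ball (0 : V) 8,
      ENNReal.ofReal (energyDensity u q a (excess u e b m) x y) ≤
      ENNReal.ofReal Y * volume (excessSet u e b m)) :
    X * (volume (excessSet u e b m')).toReal ≤ Y * (volume (excessSet u e b m)).toReal := by
  have h : ENNReal.ofReal X * volume (excessSet u e b m') ≤
      ENNReal.ofReal Y * volume (excessSet u e b m) := by
    calc ENNReal.ofReal X * volume (excessSet u e b m')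
        = ∫⁻ _x in excessSet u e b m', ENNReal.ofReal X := by rw [setLIntegral_const]
      _ ≤ ∫⁻ x in excessSet u e b m', ∫⁻ y in Metric.ball (0 : V) 8,
          ENNReal.ofReal (energyDensity u q a (excess u e b m) x y) := by
          apply setLIntegral_mono' (measurableSet_excessSet u e b m')
          intro x hx
          refine (hpt x hx).trans (lintegral_mono_set ?_)
          apply Metric.ball_subset_ball'
          have : dist x 0 < 1 := hx.1
          linarith
      _ ≤ ∫⁻ x in Metric.ball (0 : V) 8, ∫⁻ y in Metric.ball (0 : V) 8,
          ENNReal.ofReal (energyDensity u q a (excess u e b m) x y) :=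
          lintegral_mono_set (fun x hx => Metric.ball_subset_ball (by norm_num) hx.1)
      _ ≤ _ := hE
  have h2 := ENNReal.toReal_mono
    (ENNReal.mul_ne_top ENNReal.ofReal_ne_top (volume_excessSet_ne_top u e b m)) h
  rwa [ENNReal.toReal_mul, ENNReal.toReal_mul, ENNReal.toReal_ofReal hX,
    ENNReal.toReal_ofReal hY] at h2

/-- A function whose gradient is far from `e` on a set of positive measure is not flat. -/
lemma not_flat_of_measure [Nontrivial V] {u : V → ℝ} {e x : V} {η ε r μ : ℝ}
    (hd : ∀ y ∈ Metric.ball (0 : V) 8, DifferentiableAt ℝ u y)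
    (hc : ContinuousOn (fun y => gradient u y) (Metric.ball 0 8))
    (hg : ∀ y ∈ Metric.ball (0 : V) 8, ‖gradient u y‖ ≤ 1 + η) (he : ‖e‖ = 1)
    (hg1 : ∀ y ∈ Metric.ball (0 : V) 1, ‖gradient u y‖ ≤ 1)
    (hε : 0 < ε) (hη0 : 0 ≤ η) (hr : 0 < r)
    (hμ : ENNReal.ofReal μ ≤
      volume {x : V | x ∈ Metric.ball 0 1 ∧ r ≤ ‖gradient u x - e‖})
    (hsmall : (8 * ε + η) * (2 ^ d * (volume (Metric.ball (0 : V) 1)).toReal) < r ^ 2 / 2 * μ)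
    (hx : x ∈ Metric.ball (0 : V) 1) :
    ∃ y, ‖y - x‖ < 4 ∧ ε * ‖y - x‖ < |u y - u x - inner ℝ e (y - x)| := by
  by_contra! hflat
  have h1 := lintegral_deficit_le_of_flat hd hc hg he hε hx hflat
  set T : Set V := {x : V | x ∈ Metric.ball 0 1 ∧ r ≤ ‖gradient u x - e‖} with hT
  have hTm : MeasurableSet T :=
    Metric.isOpen_ball.measurableSet.inter
      (measurableSet_le measurable_const ((measurable_gradient u).sub_const e).norm)
  have h2 : ENNReal.ofReal (r ^ 2 / 2) * ENNReal.ofReal μ ≤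
      ∫⁻ y in Metric.ball (0 : V) 1, ENNReal.ofReal (1 + η - inner ℝ e (gradient u y)) := by
    calc ENNReal.ofReal (r ^ 2 / 2) * ENNReal.ofReal μ
        ≤ ENNReal.ofReal (r ^ 2 / 2) * volume T := by gcongr
      _ = ∫⁻ _y in T, ENNReal.ofReal (r ^ 2 / 2) := by rw [setLIntegral_const]
      _ ≤ ∫⁻ y in T, ENNReal.ofReal (1 + η - inner ℝ e (gradient u y)) := by
          apply setLIntegral_mono' hTm
          intro y hy
          apply ENNReal.ofReal_le_ofReal
          -- With `‖∇u‖ ≤ 1`, a gradient at distance at least `r` from `e` satisfies `e·∇u ≤ 1 -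
          -- r²/2`.
          have h3 := norm_sub_sq_real (gradient u y) e
          rw [he, real_inner_comm] at h3
          have h4 : r ^ 2 ≤ ‖gradient u y - e‖ ^ 2 := pow_le_pow_left₀ hr.le hy.2 2
          have h5 : ‖gradient u y‖ ^ 2 ≤ 1 ^ 2 := pow_le_pow_left₀ (norm_nonneg _) (hg1 y hy.1) 2
          nlinarith
      _ ≤ _ := lintegral_mono_set fun y hy => hy.1
  have h3 := h2.trans h1
  rw [volume_ball_eq _ (by norm_num : (0:ℝ) ≤ 2), ← ENNReal.ofReal_mul (by positivity),
    ← ENNReal.ofReal_mul (by positivity), ENNReal.ofReal_le_ofReal_iff (by positivity)] at h3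
  linarith


lemma excessSet_antitone (u : V → ℝ) (e : V) (b : ℝ) {m m' : ℝ} (h : m ≤ m') :
    excessSet u e b m' ⊆ excessSet u e b m := by
  intro x hx
  refine ⟨hx.1, ?_⟩
  have := hx.2
  rw [excess_sub u e b m m']; linarith

set_option maxHeartbeats 1000000 in
/-- De Giorgi type iteration for `e·∇u` based on the energy inequality. -/
theorem inner_gradient_le_of_energy [Nontrivial V] {q a r μ C₀ C₁ : ℝ} (hq : 0 ≤ q)
    (hqa : q + d < a) (hr : 0 < r) (hμ : 0 < μ) (hC₀ : 0 ≤ C₀) (hC₁ : 0 ≤ C₁) :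
    ∃ δ₀ : ℝ, 0 < δ₀ ∧ ∀ δ : ℝ, 0 < δ → δ ≤ δ₀ → ∀ (e : V) (u : V → ℝ), ‖e‖ = 1 →
      (∀ y ∈ Metric.ball (0 : V) 8, DifferentiableAt ℝ u y) →
      ContinuousOn (fun y => gradient u y) (Metric.ball 0 8) →
      (∀ y ∈ Metric.ball (0 : V) 8, ‖gradient u y‖ ≤ 1 + C₀ * δ) →
      (∀ y ∈ Metric.ball (0 : V) 1, ‖gradient u y‖ ≤ 1) →
      ENNReal.ofReal μ ≤ volume {x : V | x ∈ Metric.ball 0 1 ∧ r ≤ ‖gradient u x - e‖} →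
      (∀ m : ℝ, 1 - δ - (4 * C₀ + 12) * δ / 2 - δ ≤ m → m ≤ 1 - δ - (4 * C₀ + 12) * δ / 2 →
        ∫⁻ x in Metric.ball (0 : V) 8, ∫⁻ y in Metric.ball (0 : V) 8,
          ENNReal.ofReal (energyDensity u q a (excess u e ((4 * C₀ + 12) * δ) m) x y) ≤
        ENNReal.ofReal (C₁ * δ ^ 2) * volume (excessSet u e ((4 * C₀ + 12) * δ) m)) →
      ∀ x ∈ Metric.ball (0 : V) (1 / 2), inner ℝ e (gradient u x) ≤ 1 - δ := by
  have hν := volume_unit_ball_pos (d := d)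
  set ν := (volume (Metric.ball (0 : V) 1)).toReal with hνdef
  set A := 4 * C₀ + 12 with hA
  -- With `η = C₂ δ`, every level used in the iteration is at least `1 - η`, and `1 + η` bounds the
  -- gradient in `B_8`.
  set C₂ := C₀ + 2 + A / 2 with hC₂
  have hC₂0 : 0 < C₂ := by rw [hC₂, hA]; linarith
  have hC₂1 : 1 ≤ C₂ := by rw [hC₂, hA]; linarith
  -- The factor 20 leaves room for `8ε + η ≤ 9ε` in the strict inequality that excludes flatness in
  -- `B_4(x)`.
  obtain ⟨ε, hε, hε1, hε2⟩ : ∃ ε : ℝ, 0 < ε ∧ ε ≤ 1 / 3000 ∧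
      ε * (20 * (2 ^ d * ν)) ≤ r ^ 2 * μ := by
    refine ⟨min (1 / 3000) (r ^ 2 * μ / (20 * (2 ^ d * ν))), by positivity, min_le_left _ _, ?_⟩
    rw [← le_div_iff₀ (by positivity)]
    exact min_le_right _ _
  set cN := deficitConst d q ε with hcN
  have hcN0 : 0 < cN := deficitConst_pos d q hε
  set c := min (flatConst d q) cN with hc'
  have hc0 : 0 < c := lt_min (flatConst_pos d q) hcN0
  set τ := a - q - d with hτ
  have hτ0 : 0 < τ := by rw [hτ]; linarith
  -- With `l^τ = 1/4`, the factor `R^(-τ)` at radius `R₀ l^j` grows as `4^j`, which compensates the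
  -- decay of the squared level gap.
  set l : ℝ := (4 : ℝ) ^ (-(1 / τ)) with hl
  have hl0 : 0 < l := by positivity
  have hl1 : l < 1 := Real.rpow_lt_one_of_one_lt_of_neg (by norm_num)
    (by have : 0 < 1 / τ := by positivity
        linarith)
  have hlτ : l ^ τ = 1 / 4 := by
    rw [hl, ← Real.rpow_mul (by norm_num)]
    have : -(1 / τ) * τ = -1 := by field_simp
    rw [this, Real.rpow_neg_one]; norm_num
  -- A small initial radius makes each step contract the measure by `l^d`, the rate at which the
  -- volume of a ball of radius `R₀ l^j` shrinks.
  obtain ⟨R₀, hR₀, hR₀4, hR₀c⟩ : ∃ R₀ : ℝ, 0 < R₀ ∧ R₀ ≤ 4 ∧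
      4 * C₁ * R₀ ^ τ ≤ c * l ^ d := by
    set t := c * l ^ d / (4 * (C₁ + 1)) with ht
    have ht0 : 0 < t := by positivity
    refine ⟨min 4 (t ^ (1 / τ)), by positivity, min_le_left _ _, ?_⟩
    have h1 : (min 4 (t ^ (1 / τ))) ^ τ ≤ t := by
      calc (min 4 (t ^ (1 / τ))) ^ τ ≤ (t ^ (1 / τ)) ^ τ :=
            Real.rpow_le_rpow (by positivity) (min_le_right _ _) hτ0.le
        _ = t := by
            rw [← Real.rpow_mul ht0.le]
            have : 1 / τ * τ = 1 := by field_simp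
            rw [this, Real.rpow_one]
    calc 4 * C₁ * (min 4 (t ^ (1 / τ))) ^ τ ≤ 4 * (C₁ + 1) * t := by
          gcongr
          linarith
      _ = c * l ^ d := by rw [ht]; field_simp
  -- The second entry makes `η` admissible in the dichotomy. The third makes the superlevel set
  -- after the first step small compared with a ball of radius `R₀ l / 4`.
  set δ₀ : ℝ := min 1 (min (ε ^ 2 / 2560 / C₂)
    ((R₀ * l / 4) ^ d * cN / (4 * (C₁ + 1) * 4 ^ τ))) with hδ₀
  refine ⟨δ₀, by positivity, ?_⟩
  intro δ hδ hδδ₀ e u he hd hcont hg hg1 hμm hEI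
  have hδ1 : δ ≤ 1 := hδδ₀.trans (min_le_left _ _)
  have hδ2 : C₂ * δ ≤ ε ^ 2 / 2560 := by
    have : δ ≤ ε ^ 2 / 2560 / C₂ := hδδ₀.trans ((min_le_right _ _).trans (min_le_left _ _))
    rwa [le_div_iff₀ hC₂0, mul_comm] at this
  have hδ3 : δ * (4 * (C₁ + 1) * 4 ^ τ) ≤ (R₀ * l / 4) ^ d * cN := by
    have := hδδ₀.trans ((min_le_right _ _).trans (min_le_right _ _))
    rwa [le_div_iff₀ (by positivity)] at this
  set η := C₂ * δ with hη
  have hη0 : 0 ≤ η := by positivity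
  have hgη : ∀ y ∈ Metric.ball (0 : V) 8, ‖gradient u y‖ ≤ 1 + η := by
    intro y hy
    refine (hg y hy).trans ?_
    have : C₀ * δ ≤ C₂ * δ := by
      gcongr; rw [hC₂, hA]; linarith
    linarith
  set b := A * δ with hb
  have hb0 : 0 ≤ b := by rw [hb, hA]; positivity
  set M := 1 - δ - A * δ / 2 with hM
  have hηM : 1 - η ≤ M - δ := by
    have : η = C₀ * δ + 2 * δ + A * δ / 2 := by rw [hη, hC₂]; ring
    have : 0 ≤ C₀ * δ := by positivity
    linarith
  -- Outside `B_1` the excess is at most `(C₀ + 2 - A/2) δ`, which is negative for `A = 4C₀ + 12`.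
  have hneg : ∀ m, M - δ ≤ m → ∀ y ∈ Metric.ball (0 : V) 8, y ∉ Metric.ball (0 : V) 1 →
      excess u e b m y < 0 := by
    intro m hm y hy hy1
    have hy1' : 1 ≤ ‖y‖ := by simpa using hy1
    have h1 := real_inner_le_norm e (gradient u y)
    rw [he, one_mul] at h1
    have h2 := hg y hy
    have h3 : b * 1 ≤ b * ‖y‖ := by gcongr
    unfold excess
    have h4 : (C₀ + 2 - A / 2) * δ < 0 := by
      apply mul_neg_of_neg_of_pos _ hδ
      rw [hA]; linarith
    have h5 : b = A * δ := rfl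
    nlinarith
  have hsmall : (8 * ε + η) * (2 ^ d * ν) < r ^ 2 / 2 * μ := by
    have h1 : η ≤ ε := by nlinarith
    have h2 : 0 < ε * (2 ^ d * ν) := by positivity
    have h3 : η * (2 ^ d * ν) ≤ ε * (2 ^ d * ν) := by gcongr
    nlinarith
  set S : ℕ → ℝ := fun j => (volume (excessSet u e b (M - δ * (1 / 2) ^ j))).toReal with hS
  have hlev : ∀ j : ℕ, M - δ ≤ M - δ * (1 / 2) ^ j := by
    intro j
    have : δ * ((1:ℝ) / 2) ^ j ≤ δ :=
      mul_le_of_le_one_right hδ.le (pow_le_one₀ (by norm_num) (by norm_num))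
    linarith
  have hlev' : ∀ j : ℕ, M - δ * (1 / 2) ^ j ≤ M := by
    intro j
    have : 0 ≤ δ * (1 / 2) ^ j := by positivity
    linarith
  have hgap : ∀ j : ℕ, ∀ x ∈ excessSet u e b (M - δ * (1 / 2) ^ (j + 1)),
      δ * (1 / 2) ^ (j + 1) ≤ excess u e b (M - δ * (1 / 2) ^ j) x := by
    intro j x hx
    have h1 := hx.2
    rw [excess_sub u e b _ (M - δ * (1 / 2) ^ (j + 1))]
    have : δ * ((1:ℝ) / 2) ^ j = 2 * (δ * (1 / 2) ^ (j + 1)) := by rw [pow_succ]; ring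
    linarith
  have hqa' : q + d ≤ a := hqa.le
  have ha0 : 0 ≤ a := by
    have : (0:ℝ) ≤ d := Nat.cast_nonneg d
    linarith
  -- Flatness in `B_4(x)` is excluded at every `x`, so only the cross term enters. A lower bound of
  -- order `δ` against an upper bound of order `δ²` gives `S 1` of order `δ`.
  have hS0 : S 1 ≤ (R₀ * l ^ 1 / 4) ^ d * ν / 2 := by
    have h := mul_volume_excessSet_le (u := u) (e := e) (q := q) (a := a) (b := b)
      (m := M - δ * (1 / 2) ^ 0) (m' := M - δ * (1 / 2) ^ (0 + 1))
      (X := cN * (δ * (1 / 2) ^ (0 + 1)) * 4 ^ (-τ)) (Y := C₁ * δ ^ 2) (R := 4)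
      (by positivity) le_rfl (by positivity)
      (fun x hx => by
        obtain ⟨y₀, hy₀, hbad⟩ := not_flat_of_measure hd hcont hgη he hg1 hε hη0 hr hμm hsmall hx.1
        exact le_lintegral_energy_of_not_flat hd hcont hgη he hε hε1 hη0 hδ2 hq hqa' hb0
          (hηM.trans (hlev 0)) hx.1 (by positivity) (hgap 0 x hx) le_rfl hy₀ hbad)
      (hEI _ (hlev 0) (hlev' 0))
    have hS0le : (volume (excessSet u e b (M - δ * (1 / 2) ^ 0))).toReal ≤ ν :=
      ENNReal.toReal_mono measure_ball_lt_top.ne (volume_excessSet_le _ _ _ _)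
    have h2 : cN * (δ * (1 / 2)) * 4 ^ (-τ) * S 1 ≤ C₁ * δ ^ 2 * ν := by
      have h3 : C₁ * δ ^ 2 * (volume (excessSet u e b (M - δ * (1 / 2) ^ 0))).toReal ≤
        C₁ * δ ^ 2 * ν := by gcongr
      have h4 := h.trans h3
      simpa only [hS, zero_add, pow_one] using h4
    have h4pos : (0:ℝ) < 4 ^ τ := by positivity
    rw [Real.rpow_neg (by norm_num)] at h2
    have h3 : cN * S 1 ≤ 2 * C₁ * δ * ν * 4 ^ τ := by
      have e1 : cN * (δ * (1 / 2)) * ((4:ℝ) ^ τ)⁻¹ * S 1 = (cN * S 1) * (δ / (2 * 4 ^ τ)) := by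
        field_simp
      have e2 : C₁ * δ ^ 2 * ν = (2 * C₁ * δ * ν * 4 ^ τ) * (δ / (2 * 4 ^ τ)) := by field_simp
      rw [e1, e2] at h2
      exact le_of_mul_le_mul_right h2 (by positivity)
    have h5 : 2 * C₁ * δ * ν * 4 ^ τ ≤ cN * ((R₀ * l ^ 1 / 4) ^ d * ν / 2) := by
      rw [pow_one]
      have h6 : δ * (4 * C₁ * 4 ^ τ) ≤ (R₀ * l / 4) ^ d * cN := by
        refine le_trans ?_ hδ3
        gcongr; linarith
      have h7 := mul_le_mul_of_nonneg_right h6 (show (0:ℝ) ≤ ν / 2 by positivity)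
      linarith
    exact le_of_mul_le_mul_left (h3.trans h5) hcN0
  -- The induction hypothesis is exactly the smallness required in the flat case at radius `R₀ l^j`.
  have hstep : ∀ j : ℕ, 1 ≤ j → S j ≤ (R₀ * l ^ j / 4) ^ d * ν / 2 := by
    intro j hj
    induction j, hj using Nat.le_induction with
    | base => exact hS0
    | succ j hj ih =>
      set R := R₀ * l ^ j with hR
      have hR0 : 0 < R := by positivity
      have hR4 : R ≤ 4 := by
        have : R ≤ R₀ := mul_le_of_le_one_right hR₀.le (pow_le_one₀ hl0.le hl1.le)
        linarith
      set γ := δ * (1 / 2) ^ (j + 1) with hγ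
      have hγ0 : 0 < γ := by positivity
      have hγ1 : γ ≤ 1 := by
        have : γ ≤ δ :=
          mul_le_of_le_one_right hδ.le (pow_le_one₀ (by norm_num) (by norm_num))
        linarith
      have h := mul_volume_excessSet_le (u := u) (e := e) (q := q) (a := a) (b := b)
        (m := M - δ * (1 / 2) ^ j) (m' := M - δ * (1 / 2) ^ (j + 1))
        (X := c * γ ^ 2 * R ^ (-τ)) (Y := C₁ * δ ^ 2) (R := R)
        (by positivity) hR4 (by positivity)
        (fun x hx => by
          by_cases hflat : ∀ y, ‖y - x‖ < R →
              |u y - u x - inner ℝ e (y - x)| ≤ ε * ‖y - x‖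
          · refine le_trans ?_ (le_lintegral_energy_of_flat he (by linarith) hq ha0 hγ0.le hx.1
              (hgap j x hx) (hneg _ (hlev j)) hR0 hR4 hflat ih)
            apply ENNReal.ofReal_le_ofReal
            gcongr
            exact min_le_left _ _
          · push Not at hflat
            obtain ⟨y₀, hy₀, hbad⟩ := hflat
            refine le_trans ?_ (le_lintegral_energy_of_not_flat hd hcont hgη he hε hε1 hη0 hδ2 hq
              hqa' hb0 (hηM.trans (hlev j)) hx.1 hγ0.le (hgap j x hx) hR4 hy₀ hbad)
            apply ENNReal.ofReal_le_ofReal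
            -- As `γ ≤ 1`, the bound of the non-flat case is the stronger one.
            have h1 : c * γ ^ 2 ≤ cN * γ := by
              have h2 : γ ^ 2 ≤ γ := by
                rw [sq]; exact mul_le_of_le_one_left hγ0.le hγ1
              have h3 : c ≤ cN := min_le_right _ _
              gcongr
            gcongr)
        (hEI _ (hlev j) (hlev' j))
      have hRτ : R ^ τ = R₀ ^ τ * (1 / 4) ^ j := by
        rw [hR, Real.mul_rpow hR₀.le (by positivity), ← hlτ, ← Real.rpow_natCast, ← Real.rpow_mul hl0.le,
          mul_comm (j : ℝ), Real.rpow_mul hl0.le, Real.rpow_natCast]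
      have hRpos : 0 < R ^ τ := by positivity
      have hγsq : γ ^ 2 = δ ^ 2 * (1 / 4) ^ j / 4 := by
        rw [hγ, mul_pow, ← pow_mul, mul_comm (j + 1), pow_mul, pow_succ]; norm_num; ring
      have h2 : c * S (j + 1) ≤ 4 * C₁ * R₀ ^ τ * S j := by
        rw [Real.rpow_neg hR0.le, hRτ, hγsq] at h
        have e1 : c * (δ ^ 2 * (1 / 4) ^ j / 4) * (R₀ ^ τ * (1 / 4) ^ j)⁻¹ * S (j + 1) =
            (c * S (j + 1)) * (δ ^ 2 / (4 * R₀ ^ τ)) := by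
          field_simp
        have e2 : C₁ * δ ^ 2 * S j = (4 * C₁ * R₀ ^ τ * S j) * (δ ^ 2 / (4 * R₀ ^ τ)) := by
          field_simp
        have h3 : c * (δ ^ 2 * (1 / 4) ^ j / 4) * (R₀ ^ τ * (1 / 4) ^ j)⁻¹ * S (j + 1) ≤
          C₁ * δ ^ 2 * S j := h
        rw [e1, e2] at h3
        exact le_of_mul_le_mul_right h3 (by positivity)
      have h3 : c * S (j + 1) ≤ c * (l ^ d * ((R / 4) ^ d * ν / 2)) := by
        have hSj0 : 0 ≤ S j := ENNReal.toReal_nonneg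
        calc c * S (j + 1) ≤ 4 * C₁ * R₀ ^ τ * S j := h2
          _ ≤ (c * l ^ d) * S j := by gcongr
          _ ≤ (c * l ^ d) * ((R / 4) ^ d * ν / 2) := by gcongr
          _ = _ := by ring
      have h4 := le_of_mul_le_mul_left h3 hc0
      refine h4.trans_eq ?_
      have : R₀ * l ^ (j + 1) / 4 = l * (R / 4) := by rw [hR]; ring
      rw [this, mul_pow]; ring
  have hlim : (volume (excessSet u e b M)).toReal ≤ 0 := by
    have hd0 : d ≠ 0 := by
      rintro rfl
      exact not_nontrivial _ ‹Nontrivial (EuclideanSpace ℝ (Fin 0))›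
    have hT : Filter.Tendsto (fun j : ℕ => (R₀ * l ^ j / 4) ^ d * ν / 2) Filter.atTop (nhds 0) := by
      have h1 := tendsto_pow_atTop_nhds_zero_of_lt_one hl0.le hl1
      have h2 := ((((h1.const_mul R₀).div_const 4).pow d).mul_const ν).div_const 2
      simpa [hd0] using h2
    refine ge_of_tendsto hT ?_
    filter_upwards [Filter.eventually_ge_atTop 1] with j hj
    refine le_trans ?_ (hstep j hj)
    exact ENNReal.toReal_mono (volume_excessSet_ne_top _ _ _ _)
      (measure_mono (excessSet_antitone u e b (hlev' j)))
  have hnull : volume (excessSet u e b M) = 0 := by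
    have h0 := le_antisymm hlim ENNReal.toReal_nonneg
    rcases (ENNReal.toReal_eq_zero_iff _).1 h0 with h | h
    · exact h
    · exact absurd h (volume_excessSet_ne_top _ _ _ _)
  intro x hx
  by_contra! hlt
  have hx' : ‖x‖ < 1 / 2 := by simpa using hx
  have hcontE : ContinuousOn (excess u e b M) (Metric.ball (0 : V) 1) := by
    unfold excess
    have h1 : ContinuousOn (fun y => gradient u y) (Metric.ball (0 : V) 1) :=
      hcont.mono (Metric.ball_subset_ball (by norm_num))
    have h2 : ContinuousOn (fun y => inner ℝ e (gradient u y)) (Metric.ball (0 : V) 1) :=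
      continuousOn_const.inner h1
    fun_prop
  -- By continuity a point violating the claim would give a nonempty open subset of a null set. In
  -- `B_{1/2}` the barrier is at most `Aδ/2`, and `M + Aδ/2 = 1 - δ`.
  have hopen : IsOpen (Metric.ball (0 : V) 1 ∩ excess u e b M ⁻¹' Set.Ioi 0) :=
    hcontE.isOpen_inter_preimage Metric.isOpen_ball isOpen_Ioi
  have hpos := hopen.measure_pos volume ⟨x, by
    refine ⟨by rw [mem_ball_zero_iff]; linarith, ?_⟩
    change 0 < excess u e b M x
    unfold excess
    have : b * ‖x‖ ≤ b * (1 / 2) := by gcongr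
    rw [hM]
    have h5 : b = A * δ := rfl
    linarith⟩
  have hsub : Metric.ball (0 : V) 1 ∩ excess u e b M ⁻¹' Set.Ioi 0 ⊆ excessSet u e b M :=
    fun y hy => ⟨hy.1, (show 0 < excess u e b M y from hy.2).le⟩
  exact hpos.ne' (measure_mono_null hsub hnull)

end DeGiorgi

/-! ### The weak form and Lipschitz test functions -/

section Form

variable {d : ℕ}

local notation "V" => EuclideanSpace ℝ (Fin d)

/-- The integrand of the nonlinear nonlocal form with kernel `k`. -/
noncomputable def formIntegrand (p : ℝ) (k : V → ℝ) (u ψ : V → ℝ) (z : V × V) : ℝ :=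
  oddPow p (u z.1 - u z.2) * (ψ z.1 - ψ z.2) * k (z.1 - z.2)

lemma fracPLapForm_eq (s p : ℝ) (u φ : V → ℝ) :
    fracPLapForm s p u φ =
      ∫ x, ∫ y, formIntegrand p (fun z => ‖z‖ ^ (-((d : ℝ) + s * p))) u φ (x, y) := by
  unfold fracPLapForm formIntegrand oddPow
  congr 1; ext x; congr 1; ext y
  dsimp only
  rw [Real.rpow_neg (norm_nonneg _), div_eq_mul_inv]

lemma MemTailSpace.aestronglyMeasurable {q α : ℝ} {u : V → ℝ} (h : MemTailSpace q α u) :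
    AEStronglyMeasurable u volume := by
  have h1 : ∀ n : ℕ, AEStronglyMeasurable u (volume.restrict (Metric.closedBall (0 : V) n)) :=
    fun n => (h.1 _ (isCompact_closedBall 0 n)).1
  have h2 := aestronglyMeasurable_iUnion_iff.2 h1
  rwa [Metric.iUnion_closedBall_nat, Measure.restrict_univ] at h2

/-- The weight controlling the far-away contributions. -/
noncomputable def tailWeight (p a : ℝ) (u : V → ℝ) (y : V) : ℝ :=
  (1 + |u y| ^ (p - 1)) * (1 + ‖y‖) ^ (-a)

lemma tailWeight_nonneg (p a : ℝ) (u : V → ℝ) (y : V) : 0 ≤ tailWeight p a u y := by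
  unfold tailWeight; positivity

lemma integrable_tailWeight {p s : ℝ} {u : V → ℝ} (hsp : 0 < s * p)
    (h : MemTailSpace (p - 1) (s * p) u) : Integrable (tailWeight p ((d : ℝ) + s * p) u) := by
  have hu := h.aestronglyMeasurable
  have e : tailWeight p ((d : ℝ) + s * p) u = fun y => (1 + ‖y‖) ^ (-((d : ℝ) + s * p)) +
      |u y| ^ (p - 1) / (1 + ‖y‖) ^ ((d : ℝ) + s * p) := by
    ext y
    unfold tailWeight
    rw [add_mul, one_mul, div_eq_mul_inv, ← Real.rpow_neg (by positivity)]
  rw [e]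
  apply Integrable.add
  · apply integrable_one_add_norm
    rw [finrank_euclideanSpace_fin]; linarith
  · refine ⟨?_, ?_⟩
    · apply AEMeasurable.aestronglyMeasurable
      have := hu.aemeasurable
      fun_prop
    · rw [hasFiniteIntegral_iff_ofReal]
      · exact h.2
      · refine Filter.Eventually.of_forall fun y => ?_
        simp only [Pi.zero_apply]
        positivity

lemma aestronglyMeasurable_formIntegrand {p : ℝ} (hp : 2 ≤ p) {k u ψ : V → ℝ}
    (hk : Measurable k) (hu : AEStronglyMeasurable u) (hψ : AEStronglyMeasurable ψ) :
    AEStronglyMeasurable (formIntegrand p k u ψ) (volume.prod volume) := by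
  have h1 : AEStronglyMeasurable (fun z : V × V => u z.1 - u z.2) (volume.prod volume) :=
    hu.comp_fst.sub hu.comp_snd
  have h2 : AEStronglyMeasurable (fun z : V × V => ψ z.1 - ψ z.2) (volume.prod volume) :=
    hψ.comp_fst.sub hψ.comp_snd
  have h3 : Measurable (fun z : V × V => k (z.1 - z.2)) := hk.comp (by fun_prop)
  exact (((continuous_oddPow hp).comp_aestronglyMeasurable h1).mul h2).mul
    h3.aestronglyMeasurable

/-- The dominating function for the form. -/
noncomputable def formMajorant (p a C : ℝ) (u : V → ℝ) (z : V × V) : ℝ :=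
  C * ((Metric.ball (0 : V) 4).indicator 1 z.2 *
      (Metric.ball (0 : V) 8).indicator (fun w => ‖w‖ ^ (p - a)) (z.1 - z.2) +
    (Metric.ball (0 : V) 4).indicator 1 z.1 * tailWeight p a u z.2 +
    tailWeight p a u z.1 * (Metric.ball (0 : V) 4).indicator 1 z.2)

lemma integrable_indicator_ball (r : ℝ) :
    Integrable ((Metric.ball (0 : V) r).indicator (1 : V → ℝ)) := by
  rw [integrable_indicator_iff Metric.isOpen_ball.measurableSet]
  exact integrableOn_const measure_ball_lt_top.ne

lemma integrable_indicator_rpow_norm [Nontrivial V] {c r : ℝ} (hc : 0 < c) :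
    Integrable ((Metric.ball (0 : V) r).indicator (fun w => ‖w‖ ^ (c - (d : ℝ)))) := by
  rw [integrable_indicator_iff Metric.isOpen_ball.measurableSet]
  refine ⟨(measurable_norm.pow_const _).aestronglyMeasurable, ?_⟩
  rw [hasFiniteIntegral_iff_ofReal (Filter.Eventually.of_forall fun y => by
    simp only [Pi.zero_apply]; positivity)]
  exact lintegral_rpow_norm_ball_lt_top hc

/-- The singular term is a convolution with `‖w‖^(p-a)`, locally integrable because `a < p + d`. The
other two terms are products of integrable functions of one variable. -/
lemma integrable_formMajorant [Nontrivial V] {p a : ℝ} (hpa : a < p + d) {u : V → ℝ}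
    (hW : Integrable (tailWeight p a u)) (C : ℝ) :
    Integrable (formMajorant p a C u) (volume.prod volume) := by
  have h1 : Integrable ((Metric.ball (0 : V) 8).indicator (fun w => ‖w‖ ^ (p - a))) := by
    have := integrable_indicator_rpow_norm (d := d) (r := 8) (c := p - a + d) (by linarith)
    simpa using this
  have h2 := Integrable.convolution_integrand (ContinuousLinearMap.mul ℝ ℝ)
    (integrable_indicator_ball (d := d) 4) h1
  exact ((h2.add ((integrable_indicator_ball 4).mul_prod hW)).add
    (hW.mul_prod (integrable_indicator_ball 4))).const_mul C

/-- For two points of `B_4`, the Lipschitz bounds on `u` and `ψ` gain `‖x - y‖^p` against the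
kernel. Otherwise the integrand vanishes unless one point has norm at most 3 and the other at least
4. Then `‖x - y‖ ≥ (1 + ‖y‖)/5` for the far point `y`, and the tail weight takes over. -/
lemma abs_formIntegrand_le {p a Λ L M : ℝ} (hp : 2 ≤ p) (ha : 0 ≤ a) (hΛ : 0 ≤ Λ) (hL : 0 ≤ L)
    (hM : 0 ≤ M) {k u ψ : V → ℝ}
    (hu : ∀ x ∈ Metric.ball (0 : V) 4, ∀ y ∈ Metric.ball (0 : V) 4, |u x - u y| ≤ Λ * ‖x - y‖)
    (hub : ∀ x ∈ Metric.ball (0 : V) 4, |u x| ≤ Λ)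
    (hk : ∀ z, z ≠ 0 → |k z| ≤ ‖z‖ ^ (-a))
    (hψ : ∀ x y, |ψ x - ψ y| ≤ L * ‖x - y‖) (hψM : ∀ x, |ψ x| ≤ M)
    (hψ0 : ∀ x, 3 < ‖x‖ → ψ x = 0) (z : V × V) :
    ‖formIntegrand p k u ψ z‖ ≤
      formMajorant p a (Λ ^ (p - 1) * L + 2 ^ (p - 1) * (1 + Λ ^ (p - 1)) * M * 5 ^ a) u z := by
  obtain ⟨x, y⟩ := z
  have hp1 : 0 ≤ p - 1 := by linarith
  set C₁ := Λ ^ (p - 1) * L with hC₁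
  set C₂ := 2 ^ (p - 1) * (1 + Λ ^ (p - 1)) * M * 5 ^ a with hC₂
  have hC₁0 : 0 ≤ C₁ := by positivity
  have hC₂0 : 0 ≤ C₂ := by positivity
  have hW := tailWeight_nonneg p a u
  have hind : ∀ w : V, 0 ≤ (Metric.ball (0 : V) 4).indicator (1 : V → ℝ) w :=
    fun w => Set.indicator_nonneg (fun _ _ => zero_le_one) w
  have hind8 : ∀ w : V, 0 ≤ (Metric.ball (0 : V) 8).indicator (fun w => ‖w‖ ^ (p - a)) w :=
    fun w => Set.indicator_nonneg (fun _ _ => by positivity) w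
  have t1 := mul_nonneg (hind y) (hind8 (x - y))
  have t2 := mul_nonneg (hind x) (hW y)
  have t3 := mul_nonneg (hW x) (hind y)
  by_cases hxy : x = y
  · subst hxy
    simp only [formIntegrand, sub_self, mul_zero, zero_mul, norm_zero, formMajorant]
    simp only [sub_self] at t1
    positivity
  have hxy0 : 0 < ‖x - y‖ := norm_pos_iff.2 (sub_ne_zero.2 hxy)
  have hkxy := hk _ (sub_ne_zero.2 hxy)
  have hnorm : ‖formIntegrand p k u ψ (x, y)‖ =
      |oddPow p (u x - u y)| * |ψ x - ψ y| * |k (x - y)| := by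
    simp only [formIntegrand, norm_mul, Real.norm_eq_abs]
  rw [hnorm]
  -- the two far cases are symmetric
  have hfar : ∀ x y : V, ‖x‖ ≤ 3 → 4 ≤ ‖y‖ →
      |oddPow p (u x - u y)| * |ψ x - ψ y| * ‖x - y‖ ^ (-a) ≤ C₂ * tailWeight p a u y := by
    intro x y hx hy
    have h1 := abs_oddPow_sub_le hp (u x) (u y)
    have h2 : |u x| ^ (p - 1) ≤ Λ ^ (p - 1) :=
      Real.rpow_le_rpow (abs_nonneg _) (hub x (by simp; linarith)) hp1
    have h3 : |oddPow p (u x - u y)| ≤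
        2 ^ (p - 1) * (1 + Λ ^ (p - 1)) * (1 + |u y| ^ (p - 1)) := by
      refine h1.trans ?_
      rw [mul_assoc]
      gcongr
      have := Real.rpow_nonneg (abs_nonneg (u y)) (p - 1)
      have : 0 ≤ Λ ^ (p - 1) := by positivity
      nlinarith
    have h4 : |ψ x - ψ y| ≤ M := by
      rw [hψ0 y (by linarith), sub_zero]; exact hψM x
    have h5 : ‖x - y‖ ^ (-a) ≤ 5 ^ a * (1 + ‖y‖) ^ (-a) := by
      have h6 : (1 + ‖y‖) / 5 ≤ ‖x - y‖ := by
        have := norm_sub_norm_le y x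
        rw [norm_sub_rev] at this; linarith
      have h7 : ‖x - y‖ ^ (-a) ≤ ((1 + ‖y‖) / 5) ^ (-a) :=
        Real.rpow_le_rpow_of_nonpos (by positivity) h6 (by linarith)
      refine h7.trans_eq ?_
      rw [Real.div_rpow (by positivity) (by norm_num), Real.rpow_neg (by norm_num : (0:ℝ) ≤ 5)]
      field_simp
    calc |oddPow p (u x - u y)| * |ψ x - ψ y| * ‖x - y‖ ^ (-a)
        ≤ (2 ^ (p - 1) * (1 + Λ ^ (p - 1)) * (1 + |u y| ^ (p - 1))) * M *
          (5 ^ a * (1 + ‖y‖) ^ (-a)) := by gcongr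
      _ = C₂ * tailWeight p a u y := by rw [hC₂]; unfold tailWeight; ring
  have hle : |oddPow p (u x - u y)| * |ψ x - ψ y| * |k (x - y)| ≤
      |oddPow p (u x - u y)| * |ψ x - ψ y| * ‖x - y‖ ^ (-a) := by gcongr
  refine hle.trans ?_
  by_cases hx4 : x ∈ Metric.ball (0 : V) 4 <;> by_cases hy4 : y ∈ Metric.ball (0 : V) 4
  · have h1 : |oddPow p (u x - u y)| ≤ Λ ^ (p - 1) * ‖x - y‖ ^ (p - 1) := by
      rw [abs_oddPow hp, ← Real.mul_rpow hΛ hxy0.le]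
      exact Real.rpow_le_rpow (abs_nonneg _) (hu x hx4 y hy4) hp1
    have h8 : x - y ∈ Metric.ball (0 : V) 8 := by
      rw [mem_ball_zero_iff] at *
      exact (norm_sub_le _ _).trans_lt (by linarith)
    have hmain : |oddPow p (u x - u y)| * |ψ x - ψ y| * ‖x - y‖ ^ (-a) ≤
        C₁ * ‖x - y‖ ^ (p - a) := by
      calc _ ≤ (Λ ^ (p - 1) * ‖x - y‖ ^ (p - 1)) * (L * ‖x - y‖) * ‖x - y‖ ^ (-a) := by
            have := hψ x y
            gcongr
        _ = C₁ * (‖x - y‖ ^ (p - 1) * ‖x - y‖ ^ (1 : ℝ) * ‖x - y‖ ^ (-a)) := by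
            rw [hC₁, Real.rpow_one]; ring
        _ = C₁ * ‖x - y‖ ^ (p - a) := by
            rw [← Real.rpow_add hxy0, ← Real.rpow_add hxy0]; congr 2; ring
    unfold formMajorant
    rw [Set.indicator_of_mem hx4, Set.indicator_of_mem hy4, Set.indicator_of_mem h8]
    simp only [Pi.one_apply, one_mul, mul_one]
    have := hW x
    have := hW y
    have h0 : 0 ≤ ‖x - y‖ ^ (p - a) := by positivity
    nlinarith [mul_nonneg hC₂0 h0, mul_nonneg hC₁0 (hW x), mul_nonneg hC₁0 (hW y),
      mul_nonneg hC₂0 (hW x), mul_nonneg hC₂0 (hW y)]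
  · have hy4' : 4 ≤ ‖y‖ := by simpa using hy4
    have hmain : |oddPow p (u x - u y)| * |ψ x - ψ y| * ‖x - y‖ ^ (-a) ≤
        C₂ * tailWeight p a u y := by
      by_cases hx3 : ‖x‖ ≤ 3
      · exact hfar x y hx3 hy4'
      · rw [hψ0 x (by linarith), hψ0 y (by linarith)]
        simp only [sub_self, abs_zero, mul_zero, zero_mul]
        exact mul_nonneg hC₂0 (hW y)
    unfold formMajorant
    simp only [Set.indicator_of_mem hx4, Set.indicator_of_notMem hy4, Pi.one_apply]
    nlinarith [mul_nonneg hC₁0 (hW y)]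
  · have hx4' : 4 ≤ ‖x‖ := by simpa using hx4
    have hmain : |oddPow p (u x - u y)| * |ψ x - ψ y| * ‖x - y‖ ^ (-a) ≤
        C₂ * tailWeight p a u x := by
      by_cases hy3 : ‖y‖ ≤ 3
      · have := hfar y x hy3 hx4'
        rwa [oddPow_sub_comm, abs_neg, abs_sub_comm (ψ y), norm_sub_rev] at this
      · rw [hψ0 x (by linarith), hψ0 y (by linarith)]
        simp only [sub_self, abs_zero, mul_zero, zero_mul]
        exact mul_nonneg hC₂0 (hW x)
    unfold formMajorant
    rw [Set.indicator_of_notMem hx4, Set.indicator_of_mem hy4] at *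
    simp only [Pi.one_apply, mul_one, one_mul, zero_mul, add_zero] at *
    nlinarith [mul_nonneg hC₁0 (hW x), mul_nonneg hC₁0 t1, mul_nonneg hC₂0 t1]
  · have hx4' : 4 ≤ ‖x‖ := by simpa using hx4
    have hy4' : 4 ≤ ‖y‖ := by simpa using hy4
    rw [hψ0 x (by linarith), hψ0 y (by linarith)]
    simp only [sub_self, abs_zero, mul_zero, zero_mul]
    unfold formMajorant
    positivity

lemma abs_sub_le_convolution {φ : ContDiffBump (0 : V)} {ψ : V → ℝ} {L : ℝ}
    (hψc : Continuous ψ)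
    (hψ : ∀ x y, |ψ x - ψ y| ≤ L * ‖x - y‖) (x y : V) :
    |convolution (φ.normed volume) ψ (ContinuousLinearMap.lsmul ℝ ℝ) volume x -
      convolution (φ.normed volume) ψ (ContinuousLinearMap.lsmul ℝ ℝ) volume y| ≤
      L * ‖x - y‖ := by
  have hi : ∀ x : V, Integrable (fun t => φ.normed volume t * ψ (x - t)) := by
    intro x
    apply Continuous.integrable_of_hasCompactSupport
    · exact φ.continuous_normed.mul (hψc.comp (by fun_prop))
    · exact φ.hasCompactSupport_normed.mul_right
  simp only [convolution, ContinuousLinearMap.lsmul_apply, smul_eq_mul]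
  rw [← integral_sub (hi x) (hi y), ← Real.norm_eq_abs]
  calc _ ≤ ∫ t, φ.normed volume t * (L * ‖x - y‖) := by
        apply norm_integral_le_of_norm_le
        · exact φ.integrable_normed.mul_const _
        · refine Filter.Eventually.of_forall fun t => ?_
          rw [← mul_sub, norm_mul, Real.norm_of_nonneg (φ.nonneg_normed t)]
          have := hψ (x - t) (y - t)
          rw [sub_sub_sub_cancel_right] at this
          exact mul_le_mul_of_nonneg_left this (φ.nonneg_normed t)
    _ = L * ‖x - y‖ := by rw [integral_mul_const, φ.integral_normed, one_mul]


lemma continuous_of_abs_sub_le {ψ : V → ℝ} {L : ℝ} (hψ : ∀ x y, |ψ x - ψ y| ≤ L * ‖x - y‖) :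
    Continuous ψ := by
  have : LipschitzWith (Real.toNNReal L) ψ := by
    apply LipschitzWith.of_dist_le_mul
    intro x y
    rw [Real.dist_eq, dist_eq_norm]
    refine (hψ x y).trans ?_
    gcongr
    exact Real.le_coe_toNNReal L
  exact this.continuous

/-- Lipschitz nonnegative functions with compact support are limits of smooth test functions,
with uniform bounds. -/
lemma exists_smooth_approx {ψ : V → ℝ} {L M : ℝ} (hψ0 : ∀ x, 0 ≤ ψ x)
    (hψ : ∀ x y, |ψ x - ψ y| ≤ L * ‖x - y‖) (hψM : ∀ x, |ψ x| ≤ M)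
    (hψs : ∀ x, 2 < ‖x‖ → ψ x = 0) :
    ∃ φ : ℕ → V → ℝ, (∀ n, IsNonnegTest (Metric.ball (0 : V) 4) (φ n)) ∧
      (∀ n x y, |φ n x - φ n y| ≤ L * ‖x - y‖) ∧ (∀ n x, |φ n x| ≤ M) ∧
      (∀ n x, 3 < ‖x‖ → φ n x = 0) ∧
      ∀ x, Filter.Tendsto (fun n => φ n x) Filter.atTop (nhds (ψ x)) := by
  have hψc := continuous_of_abs_sub_le hψ
  have hψK : HasCompactSupport ψ :=
    HasCompactSupport.of_support_subset_isCompact (isCompact_closedBall (0 : V) 2) (by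
      intro x hx
      by_contra h
      exact hx (hψs x (by simpa using h)))
  -- The shift by 2 keeps the mollification radius at most `1/2`, so supports stay in the closed
  -- ball of radius `5/2`.
  have hε : ∀ n : ℕ, 0 < 1 / ((n : ℝ) + 2) := fun n => by positivity
  let ρ : ℕ → ContDiffBump (0 : V) := fun n =>
    ⟨1 / ((n : ℝ) + 2) / 2, 1 / ((n : ℝ) + 2), by have := hε n; positivity, by
      have := hε n; linarith⟩
  have hρ : ∀ n, (ρ n).rOut = 1 / ((n : ℝ) + 2) := fun n => rfl
  have hρ1 : ∀ n, (ρ n).rOut ≤ 1 / 2 := by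
    intro n
    rw [hρ]
    apply one_div_le_one_div_of_le (by norm_num)
    have : (0:ℝ) ≤ n := Nat.cast_nonneg n
    linarith
  set φ : ℕ → V → ℝ := fun n =>
    convolution ((ρ n).normed volume) ψ (ContinuousLinearMap.lsmul ℝ ℝ) volume with hφ
  have hφdef : ∀ n x, φ n x = ∫ t, (ρ n).normed volume t * ψ (x - t) := fun n x => rfl
  have hφ0 : ∀ n x, 0 ≤ φ n x := by
    intro n x
    rw [hφdef]
    exact integral_nonneg fun t => mul_nonneg ((ρ n).nonneg_normed t) (hψ0 _)
  have hsupp : ∀ n x, 5 / 2 < ‖x‖ → φ n x = 0 := by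
    intro n x hx
    rw [hφdef]
    apply integral_eq_zero_of_ae
    refine Filter.Eventually.of_forall fun t => ?_
    by_cases ht : t ∈ Metric.ball (0 : V) (ρ n).rOut
    · have ht' : ‖t‖ < 1 / 2 := by
        rw [mem_ball_zero_iff] at ht; exact ht.trans_le (hρ1 n)
      have : 2 < ‖x - t‖ := by
        have := norm_sub_norm_le x t; linarith
      simp [hψs _ this]
    · rw [← (ρ n).support_normed_eq (μ := volume), Function.notMem_support] at ht
      simp [ht]
  refine ⟨φ, ?_, fun n => abs_sub_le_convolution hψc hψ, ?_, fun n x hx => hsupp n x (by linarith), ?_⟩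
  · intro n
    have hcs : Function.support (φ n) ⊆ Metric.closedBall (0 : V) (5 / 2) := by
      intro x hx
      by_contra h
      exact hx (hsupp n x (by simpa using h))
    refine ⟨?_, ?_, ?_, hφ0 n⟩
    · exact (ρ n).hasCompactSupport_normed.contDiff_convolution_left _ (ρ n).contDiff_normed
        hψc.locallyIntegrable
    · exact HasCompactSupport.of_support_subset_isCompact (isCompact_closedBall _ _) hcs
    · refine (closure_minimal hcs Metric.isClosed_closedBall).trans ?_
      exact Metric.closedBall_subset_ball (by norm_num)
  · intro n x
    rw [hφdef, ← Real.norm_eq_abs]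
    calc _ ≤ ∫ t, (ρ n).normed volume t * M := by
          apply norm_integral_le_of_norm_le
          · exact (ρ n).integrable_normed.mul_const _
          · refine Filter.Eventually.of_forall fun t => ?_
            rw [norm_mul, Real.norm_of_nonneg ((ρ n).nonneg_normed t)]
            exact mul_le_mul_of_nonneg_left (hψM _) ((ρ n).nonneg_normed t)
      _ = M := by rw [integral_mul_const, (ρ n).integral_normed, one_mul]
  · intro x
    apply ContDiffBump.convolution_tendsto_right_of_continuous _ hψc x
    simp only [hρ]
    have h1 := tendsto_one_div_add_atTop_nhds_zero_nat (𝕜 := ℝ)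
    have h2 := h1.comp (Filter.tendsto_add_atTop_nat 1)
    refine h2.congr fun n => ?_
    simp only [Function.comp]
    push_cast
    congr 1; ring

/-- The standing hypotheses on a weak solution that is Lipschitz near the origin. -/
structure LipschitzWeakSolution (p a Λ : ℝ) (u : V → ℝ) : Prop where
  aesm : AEStronglyMeasurable u
  integrable_weight : Integrable (tailWeight p a u)
  lipschitz : ∀ x ∈ Metric.ball (0 : V) 4, ∀ y ∈ Metric.ball (0 : V) 4,
    |u x - u y| ≤ Λ * ‖x - y‖
  bounded : ∀ x ∈ Metric.ball (0 : V) 4, |u x| ≤ Λ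
  weak : ∀ φ, IsNonnegTest (Metric.ball (0 : V) 4) φ →
    ∫ x, ∫ y, formIntegrand p (fun z => ‖z‖ ^ (-a)) u φ (x, y) = 0

lemma LipschitzWeakSolution.nonneg {p a Λ : ℝ} {u : V → ℝ} (h : LipschitzWeakSolution p a Λ u) :
    0 ≤ Λ :=
  (abs_nonneg _).trans (h.bounded 0 (by simp))

lemma LipschitzWeakSolution.integrable_form [Nontrivial V] {p a Λ L M : ℝ} {u : V → ℝ}
    (h : LipschitzWeakSolution p a Λ u) (hp : 2 ≤ p) (ha : 0 ≤ a) (hpa : a < p + d)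
    {k : V → ℝ} (hkm : Measurable k) (hk : ∀ z, z ≠ 0 → |k z| ≤ ‖z‖ ^ (-a))
    {ψ : V → ℝ} (hL : 0 ≤ L)
    (hψ : ∀ x y, |ψ x - ψ y| ≤ L * ‖x - y‖) (hψM : ∀ x, |ψ x| ≤ M)
    (hψ0 : ∀ x, 3 < ‖x‖ → ψ x = 0) :
    Integrable (formIntegrand p k u ψ) (volume.prod volume) :=
  (integrable_formMajorant hpa h.integrable_weight _).mono'
    (aestronglyMeasurable_formIntegrand hp hkm h.aesm
      (continuous_of_abs_sub_le hψ).aestronglyMeasurable)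
    (Filter.Eventually.of_forall fun z => abs_formIntegrand_le hp ha h.nonneg hL
      ((abs_nonneg _).trans (hψM 0)) h.lipschitz h.bounded hk hψ hψM hψ0 z)

lemma measurable_rpow_norm (a : ℝ) : Measurable fun z : V => ‖z‖ ^ (-a) :=
  measurable_norm.pow_const _

/-- The weak equation may be tested with Lipschitz functions. -/
theorem LipschitzWeakSolution.integral_form_eq_zero [Nontrivial V] {p a Λ L M : ℝ} {u : V → ℝ}
    (h : LipschitzWeakSolution p a Λ u) (hp : 2 ≤ p) (ha : 0 ≤ a) (hpa : a < p + d)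
    {ψ : V → ℝ} (hL : 0 ≤ L) (hψn : ∀ x, 0 ≤ ψ x)
    (hψ : ∀ x y, |ψ x - ψ y| ≤ L * ‖x - y‖) (hψM : ∀ x, |ψ x| ≤ M)
    (hψ0 : ∀ x, 2 < ‖x‖ → ψ x = 0) :
    ∫ z, formIntegrand p (fun z => ‖z‖ ^ (-a)) u ψ z ∂(volume.prod volume) = 0 := by
  obtain ⟨φ, hφt, hφL, hφM, hφs, hφlim⟩ := exists_smooth_approx hψn hψ hψM hψ0
  have hk : ∀ z : V, z ≠ 0 → |(fun z : V => ‖z‖ ^ (-a)) z| ≤ ‖z‖ ^ (-a) := fun z _ =>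
    (abs_of_nonneg (by positivity)).le
  have hzero : ∀ n, ∫ z, formIntegrand p (fun z => ‖z‖ ^ (-a)) u (φ n) z
      ∂(volume.prod volume) = 0 := by
    intro n
    rw [integral_prod _ (h.integrable_form hp ha hpa (measurable_rpow_norm a) hk hL (hφL n) (hφM n)
      (hφs n))]
    exact h.weak _ (hφt n)
  -- The mollified functions keep the constants `L` and `M`, so one majorant serves all of them.
  have hlim := tendsto_integral_of_dominated_convergence
    (F := fun n => formIntegrand p (fun z => ‖z‖ ^ (-a)) u (φ n))
    (f := formIntegrand p (fun z => ‖z‖ ^ (-a)) u ψ) (μ := volume.prod volume) _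
    (fun n => aestronglyMeasurable_formIntegrand hp (measurable_rpow_norm a) h.aesm
      (continuous_of_abs_sub_le (hφL n)).aestronglyMeasurable)
    (integrable_formMajorant hpa h.integrable_weight _)
    (fun n => Filter.Eventually.of_forall fun z => abs_formIntegrand_le hp ha h.nonneg hL
      ((abs_nonneg _).trans (hφM n 0)) h.lipschitz h.bounded hk (hφL n) (hφM n) (hφs n) z)
    (Filter.Eventually.of_forall fun z => by
      unfold formIntegrand
      exact ((((hφlim z.1).sub (hφlim z.2)).const_mul _).mul_const _))
  simp only [hzero] at hlim
  exact (tendsto_nhds_unique hlim tendsto_const_nhds)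


/-! ### Splitting of the kernel and translation of the equation -/

/-- The bounded part of the kernel `‖z‖^(-a)`. -/
noncomputable def farKernel (a T : ℝ) (z : V) : ℝ := max ‖z‖ T ^ (-a)

/-- The compactly supported part of the kernel `‖z‖^(-a)`. -/
noncomputable def nearKernel (a T : ℝ) (z : V) : ℝ := ‖z‖ ^ (-a) - farKernel a T z

lemma measurable_farKernel (a T : ℝ) : Measurable (farKernel (d := d) a T) :=
  (measurable_norm.max measurable_const).pow_const _

lemma measurable_nearKernel (a T : ℝ) : Measurable (nearKernel (d := d) a T) :=
  (measurable_rpow_norm a).sub (measurable_farKernel a T)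

lemma farKernel_nonneg {a T : ℝ} (z : V) : 0 ≤ farKernel a T z := by
  unfold farKernel
  have : 0 ≤ max ‖z‖ T := le_max_of_le_left (norm_nonneg z)
  positivity

lemma farKernel_le {a T : ℝ} (ha : 0 ≤ a) {z : V} (hz : z ≠ 0) :
    farKernel a T z ≤ ‖z‖ ^ (-a) :=
  Real.rpow_le_rpow_of_nonpos (norm_pos_iff.2 hz) (le_max_left _ _) (by linarith)

lemma farKernel_neg (a T : ℝ) (z : V) : farKernel a T (-z) = farKernel a T z := by
  simp [farKernel]

lemma abs_farKernel_le {a T : ℝ} (ha : 0 ≤ a) {z : V} (hz : z ≠ 0) :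
    |farKernel a T z| ≤ ‖z‖ ^ (-a) := by
  rw [abs_of_nonneg (farKernel_nonneg z)]; exact farKernel_le ha hz

lemma abs_nearKernel_le {a T : ℝ} (ha : 0 ≤ a) {z : V} (hz : z ≠ 0) :
    |nearKernel a T z| ≤ ‖z‖ ^ (-a) := by
  have h1 := farKernel_le (T := T) ha hz
  have h2 := farKernel_nonneg (a := a) (T := T) z
  unfold nearKernel
  rw [abs_of_nonneg (by linarith)]; linarith

lemma nearKernel_nonneg {a T : ℝ} (ha : 0 ≤ a) {z : V} (hz : z ≠ 0) : 0 ≤ nearKernel a T z := by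
  have h1 := farKernel_le (T := T) ha hz
  unfold nearKernel; linarith

lemma nearKernel_eq_zero {a T : ℝ} {z : V} (hz : T ≤ ‖z‖) : nearKernel a T z = 0 := by
  unfold nearKernel farKernel
  rw [max_eq_left hz, sub_self]

/-- Doubling the distance reduces `‖z‖^(-a)` by `2^(-a) ≤ 1/2`, so subtracting the far kernel
removes at most half. -/
lemma half_le_nearKernel {a T : ℝ} (ha : 1 ≤ a) {z : V} (hz : z ≠ 0) (hT : 2 * ‖z‖ ≤ T) :
    ‖z‖ ^ (-a) / 2 ≤ nearKernel a T z := by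
  have hz0 : 0 < ‖z‖ := norm_pos_iff.2 hz
  have h1 : farKernel a T z ≤ ‖z‖ ^ (-a) / 2 := by
    unfold farKernel
    calc max ‖z‖ T ^ (-a) ≤ (2 * ‖z‖) ^ (-a) :=
          Real.rpow_le_rpow_of_nonpos (by positivity) (hT.trans (le_max_right _ _)) (by linarith)
      _ = 2 ^ (-a) * ‖z‖ ^ (-a) := Real.mul_rpow (by norm_num) hz0.le
      _ ≤ 2 ^ (-1 : ℝ) * ‖z‖ ^ (-a) := by
          gcongr
          · norm_num
      _ = ‖z‖ ^ (-a) / 2 := by rw [Real.rpow_neg_one]; ring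
  unfold nearKernel; linarith

lemma abs_farKernel_sub_le {a T B : ℝ} (ha : 0 ≤ a) (hB : 0 < B) {z w : V}
    (hz : B ≤ max ‖z‖ T) (hw : B ≤ max ‖w‖ T) :
    |farKernel a T z - farKernel a T w| ≤ a * B ^ (-a - 1) * ‖z - w‖ := by
  have key : ∀ s t : ℝ, B ≤ t → t ≤ s → t ^ (-a) - s ^ (-a) ≤ a * B ^ (-a - 1) * (s - t) := by
    intro s t ht hts
    refine (rpow_neg_sub_rpow_neg_le ha (hB.trans_le ht) hts).trans ?_
    have : t ^ (-a - 1) ≤ B ^ (-a - 1) := Real.rpow_le_rpow_of_nonpos hB ht (by linarith)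
    have : 0 ≤ s - t := by linarith
    gcongr
  have hmax : |max ‖z‖ T - max ‖w‖ T| ≤ ‖z - w‖ :=
    (abs_max_sub_max_le_abs _ _ _).trans (abs_norm_sub_norm_le z w)
  have hc : 0 ≤ a * B ^ (-a - 1) := by positivity
  unfold farKernel
  rcases le_total (max ‖w‖ T) (max ‖z‖ T) with h | h
  · have h1 := key _ _ hw h
    have h2 : max ‖z‖ T ^ (-a) ≤ max ‖w‖ T ^ (-a) :=
      Real.rpow_le_rpow_of_nonpos (hB.trans_le hw) h (by linarith)
    rw [abs_sub_comm, abs_of_nonneg (by linarith)]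
    refine h1.trans (mul_le_mul_of_nonneg_left ((le_abs_self _).trans hmax) hc)
  · have h1 := key _ _ hz h
    have h2 : max ‖w‖ T ^ (-a) ≤ max ‖z‖ T ^ (-a) :=
      Real.rpow_le_rpow_of_nonpos (hB.trans_le hz) h (by linarith)
    rw [abs_of_nonneg (by linarith)]
    rw [abs_sub_comm] at hmax
    refine h1.trans (mul_le_mul_of_nonneg_left ((le_abs_self _).trans hmax) hc)

/-- If `‖y‖ ≤ 2T` then `T` alone suffices, and otherwise `‖x - y‖ ≥ ‖y‖ - 3` does. Far kernels
centred near the origin are therefore controlled by `(T + ‖y‖)^(-a)`. -/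
lemma add_le_max_norm_sub {T : ℝ} (hT : 8 ≤ T) {x y : V} (hx : ‖x‖ ≤ 3) :
    (T + ‖y‖) / 4 ≤ max ‖x - y‖ T := by
  have h1 := norm_sub_norm_le y x
  rw [norm_sub_rev] at h1
  rcases le_total ‖y‖ (2 * T) with h | h
  · exact le_max_of_le_right (by linarith)
  · exact le_max_of_le_left (by linarith)

/-- The operator with the far kernel. -/
noncomputable def farOperator (p a T : ℝ) (u : V → ℝ) (x : V) : ℝ :=
  ∫ y, oddPow p (u x - u y) * farKernel a T (x - y)

lemma abs_oddPow_mul_farKernel_le {p a T Λ : ℝ} (hp : 2 ≤ p) (ha : 0 ≤ a) (hT : 8 ≤ T)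
    {u : V → ℝ} {t : ℝ} (ht : |t| ≤ Λ) {x : V} (hx : ‖x‖ ≤ 3) (y : V) :
    |oddPow p (t - u y) * farKernel a T (x - y)| ≤
      2 ^ (p - 1) * (1 + Λ ^ (p - 1)) * 4 ^ a * tailWeight p a u y := by
  have hp1 : 0 ≤ p - 1 := by linarith
  have hΛ : 0 ≤ Λ := (abs_nonneg t).trans ht
  have h1 := abs_oddPow_sub_le hp t (u y)
  have h2 : |t| ^ (p - 1) ≤ Λ ^ (p - 1) := Real.rpow_le_rpow (abs_nonneg _) ht hp1
  have h3 : |oddPow p (t - u y)| ≤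
      2 ^ (p - 1) * (1 + Λ ^ (p - 1)) * (1 + |u y| ^ (p - 1)) := by
    refine h1.trans ?_
    rw [mul_assoc]
    gcongr
    have := Real.rpow_nonneg (abs_nonneg (u y)) (p - 1)
    have : 0 ≤ Λ ^ (p - 1) := by positivity
    nlinarith
  have h4 : farKernel a T (x - y) ≤ 4 ^ a * (1 + ‖y‖) ^ (-a) := by
    have h5 : (1 + ‖y‖) / 4 ≤ max ‖x - y‖ T :=
      le_trans (by linarith) (add_le_max_norm_sub hT hx)
    have h7 : max ‖x - y‖ T ^ (-a) ≤ ((1 + ‖y‖) / 4) ^ (-a) :=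
      Real.rpow_le_rpow_of_nonpos (by positivity) h5 (by linarith)
    refine h7.trans_eq ?_
    rw [Real.div_rpow (by positivity) (by norm_num), Real.rpow_neg (by norm_num : (0:ℝ) ≤ 4)]
    field_simp
  rw [abs_mul, abs_of_nonneg (farKernel_nonneg _)]
  calc _ ≤ (2 ^ (p - 1) * (1 + Λ ^ (p - 1)) * (1 + |u y| ^ (p - 1))) *
        (4 ^ a * (1 + ‖y‖) ^ (-a)) := by
        have := farKernel_nonneg (a := a) (T := T) (x - y)
        gcongr
    _ = _ := by unfold tailWeight; ring

namespace LipschitzWeakSolution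

variable {p a Λ : ℝ} {u : EuclideanSpace ℝ (Fin d) → ℝ}

lemma integrable_far (h : LipschitzWeakSolution p a Λ u) (hp : 2 ≤ p) (ha : 0 ≤ a) {T : ℝ}
    (hT : 8 ≤ T) {x x' : V} (hx : ‖x‖ ≤ 3) (hx' : ‖x'‖ ≤ 3) :
    Integrable fun y => oddPow p (u x' - u y) * farKernel a T (x - y) := by
  refine (h.integrable_weight.const_mul
    (2 ^ (p - 1) * (1 + Λ ^ (p - 1)) * 4 ^ a)).mono' ?_ (Filter.Eventually.of_forall fun y => ?_)
  · apply AEStronglyMeasurable.mul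
    · exact (continuous_oddPow hp).comp_aestronglyMeasurable
        (aestronglyMeasurable_const.sub h.aesm)
    · exact ((measurable_farKernel a T).comp (by fun_prop)).aestronglyMeasurable
  · rw [Real.norm_eq_abs]
    exact abs_oddPow_mul_farKernel_le hp ha hT (h.bounded x' (by
      rw [mem_ball_zero_iff]; linarith)) hx y

/-- The half of the far form. -/
lemma integrable_far_half (h : LipschitzWeakSolution p a Λ u) (hp : 2 ≤ p) (ha : 0 ≤ a) {T : ℝ}
    (hT : 8 ≤ T) {ψ : V → ℝ} {M : ℝ} (hψc : Continuous ψ) (hψM : ∀ x, |ψ x| ≤ M)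
    (hψ0 : ∀ x, 3 < ‖x‖ → ψ x = 0) :
    Integrable (fun z : V × V => oddPow p (u z.1 - u z.2) * ψ z.1 * farKernel a T (z.1 - z.2))
      (volume.prod volume) := by
  have hM : 0 ≤ M := (abs_nonneg _).trans (hψM 0)
  have hΛ := h.nonneg
  refine (((integrable_indicator_ball (d := d) 4).mul_prod h.integrable_weight).const_mul
    (M * (2 ^ (p - 1) * (1 + Λ ^ (p - 1)) * 4 ^ a))).mono' ?_
      (Filter.Eventually.of_forall fun z => ?_)
  · apply AEStronglyMeasurable.mul
    · apply AEStronglyMeasurable.mul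
      · exact (continuous_oddPow hp).comp_aestronglyMeasurable
          (h.aesm.comp_fst.sub h.aesm.comp_snd)
      · exact hψc.aestronglyMeasurable.comp_fst
    · exact ((measurable_farKernel a T).comp (by fun_prop)).aestronglyMeasurable
  · obtain ⟨x, y⟩ := z
    have hW := tailWeight_nonneg p a u y
    by_cases hx : ‖x‖ ≤ 3
    · have hx4 : x ∈ Metric.ball (0 : V) 4 := by rw [mem_ball_zero_iff]; linarith
      have h1 := abs_oddPow_mul_farKernel_le (u := u) hp ha hT (h.bounded x hx4) hx y
      simp only [Set.indicator_of_mem hx4, Pi.one_apply, one_mul]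
      rw [Real.norm_eq_abs]
      have e : oddPow p (u x - u y) * ψ x * farKernel a T (x - y) =
        ψ x * (oddPow p (u x - u y) * farKernel a T (x - y)) := by ring
      rw [e, abs_mul, mul_assoc M]
      have := hψM x
      gcongr
    · simp only [hψ0 x (by linarith), mul_zero, zero_mul, norm_zero]
      have : 0 ≤ (Metric.ball (0 : V) 4).indicator (1 : V → ℝ) x :=
        Set.indicator_nonneg (fun _ _ => zero_le_one) x
      positivity

/-- The bounded far kernel makes the two halves of the form separately integrable. The kernel is
even and `oddPow` is odd, so the halves have equal integrals and the operator can be applied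
pointwise to `u`. -/
lemma integral_far_form (h : LipschitzWeakSolution p a Λ u) (hp : 2 ≤ p) (ha : 0 ≤ a) {T : ℝ}
    (hT : 8 ≤ T) {ψ : V → ℝ} {M : ℝ} (hψc : Continuous ψ) (hψM : ∀ x, |ψ x| ≤ M)
    (hψ0 : ∀ x, 3 < ‖x‖ → ψ x = 0) :
    ∫ z, formIntegrand p (farKernel a T) u ψ z ∂(volume.prod volume) =
      2 * ∫ x, ψ x * farOperator p a T u x := by
  set H : V × V → ℝ := fun z =>
    oddPow p (u z.1 - u z.2) * ψ z.1 * farKernel a T (z.1 - z.2) with hH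
  have hHi : Integrable H (volume.prod volume) := h.integrable_far_half hp ha hT hψc hψM hψ0
  have hHs : Integrable (fun z : V × V => H z.swap) (volume.prod volume) := hHi.swap
  have e : formIntegrand p (farKernel a T) u ψ = fun z => H z + H z.swap := by
    ext ⟨x, y⟩
    simp only [formIntegrand, hH, Prod.swap]
    rw [oddPow_sub_comm p (u y), ← neg_sub x y, farKernel_neg]
    ring
  rw [e, integral_add hHi hHs, integral_prod_swap, integral_prod _ hHi, two_mul]
  have e2 : ∀ x, ∫ y, H (x, y) = ψ x * farOperator p a T u x := by
    intro x
    unfold farOperator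
    rw [← integral_const_mul]
    congr 1; ext y
    simp only [hH]; ring
  simp only [e2]

lemma integrable_far_operator (h : LipschitzWeakSolution p a Λ u) (hp : 2 ≤ p) (ha : 0 ≤ a) {T : ℝ}
    (hT : 8 ≤ T) {ψ : V → ℝ} {M : ℝ} (hψc : Continuous ψ) (hψM : ∀ x, |ψ x| ≤ M)
    (hψ0 : ∀ x, 3 < ‖x‖ → ψ x = 0) :
    Integrable fun x => ψ x * farOperator p a T u x := by
  refine (h.integrable_far_half hp ha hT hψc hψM hψ0).integral_prod_left.congr ?_
  refine Filter.Eventually.of_forall fun x => ?_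
  unfold farOperator
  dsimp only
  rw [← integral_const_mul]
  congr 1; ext y; ring

lemma measurePreserving_translate (v : V) :
    MeasurePreserving (fun z : V × V => (z.1 + v, z.2 + v)) (volume.prod volume)
      (volume.prod volume) :=
  (measurePreserving_add_right volume v).prod (measurePreserving_add_right volume v)

lemma formIntegrand_translate (k u ψ : V → ℝ) (v : V) (z : V × V) :
    formIntegrand p k u (fun x => ψ (x - v)) (z.1 + v, z.2 + v) =
      formIntegrand p k (fun x => u (x + v)) ψ z := by
  simp [formIntegrand]

/-- The difference of the weak equations for `u` and its translate. -/
theorem integral_near_form_diff [Nontrivial V] (h : LipschitzWeakSolution p a Λ u) (hp : 2 ≤ p)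
    (ha : 0 ≤ a) (hpa : a < p + d) {T : ℝ} (hT : 8 ≤ T) {v : V} (hv : ‖v‖ ≤ 1)
    {ψ : V → ℝ} {L M : ℝ} (hL : 0 ≤ L) (hψn : ∀ x, 0 ≤ ψ x)
    (hψ : ∀ x y, |ψ x - ψ y| ≤ L * ‖x - y‖) (hψM : ∀ x, |ψ x| ≤ M)
    (hψ0 : ∀ x, 1 < ‖x‖ → ψ x = 0) :
    Integrable (fun z => formIntegrand p (nearKernel a T) (fun x => u (x + v)) ψ z -
      formIntegrand p (nearKernel a T) u ψ z) (volume.prod volume) ∧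
    Integrable (fun x => ψ x * (farOperator p a T u (x + v) - farOperator p a T u x)) ∧
    ∫ z, (formIntegrand p (nearKernel a T) (fun x => u (x + v)) ψ z -
      formIntegrand p (nearKernel a T) u ψ z) ∂(volume.prod volume) =
      -(2 * ∫ x, ψ x * (farOperator p a T u (x + v) - farOperator p a T u x)) := by
  -- Testing the equation for `u` with the translate of `ψ` amounts to testing the equation for `u(·
  -- + v)` with `ψ`. The support moves only from `B_1` into `B_2`.
  set ψv : V → ℝ := fun x => ψ (x - v) with hψv
  have hψvL : ∀ x y, |ψv x - ψv y| ≤ L * ‖x - y‖ := fun x y => by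
    have := hψ (x - v) (y - v)
    rwa [sub_sub_sub_cancel_right] at this
  have hψv0 : ∀ x, 2 < ‖x‖ → ψv x = 0 := fun x hx => by
    apply hψ0
    have := norm_sub_norm_le x v; linarith
  have hψc := continuous_of_abs_sub_le hψ
  have hψvc := continuous_of_abs_sub_le hψvL
  -- splitting of the equation for a test function
  have hsplit : ∀ φ : V → ℝ, (∀ x, 0 ≤ φ x) → (∀ x y, |φ x - φ y| ≤ L * ‖x - y‖) →
      (∀ x, |φ x| ≤ M) → (∀ x, 2 < ‖x‖ → φ x = 0) →
      ∫ z, formIntegrand p (nearKernel a T) u φ z ∂(volume.prod volume) =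
        -(2 * ∫ x, φ x * farOperator p a T u x) := by
    intro φ h0 h1 h2 h3
    have h3' : ∀ x, 3 < ‖x‖ → φ x = 0 := fun x hx => h3 x (by linarith)
    have hz := h.integral_form_eq_zero hp ha hpa hL h0 h1 h2 h3
    have hf := h.integral_far_form hp ha hT (continuous_of_abs_sub_le h1) h2 h3'
    have hni := h.integrable_form hp ha hpa (measurable_nearKernel a T)
      (fun z hz => abs_nearKernel_le ha hz) hL h1 h2 h3'
    have hfi := h.integrable_form hp ha hpa (measurable_farKernel a T)
      (fun z hz => abs_farKernel_le ha hz) hL h1 h2 h3'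
    have e : formIntegrand p (fun z => ‖z‖ ^ (-a)) u φ = fun z =>
        formIntegrand p (nearKernel a T) u φ z + formIntegrand p (farKernel a T) u φ z := by
      ext z
      simp only [formIntegrand, nearKernel]; ring
    rw [e, integral_add hni hfi, hf] at hz
    linarith
  have hn1 := hsplit ψ hψn hψ hψM (fun x hx => hψ0 x (by linarith))
  have hn2 := hsplit ψv (fun x => hψn _) hψvL (fun x => hψM _) hψv0
  have hi1 := h.integrable_form hp ha hpa (measurable_nearKernel a T)
      (fun z hz => abs_nearKernel_le ha hz) hL hψ hψM (fun x hx => hψ0 x (by linarith))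
  have hi2 := h.integrable_form hp ha hpa (measurable_nearKernel a T)
      (fun z hz => abs_nearKernel_le ha hz) hL hψvL (fun x => hψM _)
      (fun x hx => hψv0 x (by linarith))
  have hi3 : Integrable (formIntegrand p (nearKernel a T) (fun x => u (x + v)) ψ)
      (volume.prod volume) := by
    have := (measurePreserving_translate v).integrable_comp_of_integrable hi2
    refine this.congr (Filter.Eventually.of_forall fun z => ?_)
    exact formIntegrand_translate _ u ψ v z
  have hn3 : ∫ z, formIntegrand p (nearKernel a T) (fun x => u (x + v)) ψ z
      ∂(volume.prod volume) = ∫ z, formIntegrand p (nearKernel a T) u ψv z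
      ∂(volume.prod volume) := by
    have hemb : MeasurableEmbedding (fun z : V × V => (z.1 + v, z.2 + v)) :=
      ((MeasurableEquiv.addRight v).prodCongr (MeasurableEquiv.addRight v)).measurableEmbedding
    rw [← (measurePreserving_translate v).integral_comp hemb
      (formIntegrand p (nearKernel a T) u ψv)]
    congr 1; ext z
    exact (formIntegrand_translate _ u ψ v z).symm
  have hf1 := h.integrable_far_operator hp ha hT hψc hψM (fun x hx => hψ0 x (by linarith))
  have hf2 := h.integrable_far_operator hp ha hT hψvc (fun x => hψM _)
    (fun x hx => hψv0 x (by linarith))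
  have hf3 : Integrable fun x => ψ x * farOperator p a T u (x + v) := by
    have := hf2.comp_add_right v
    simpa [hψv] using this
  have hf4 : ∫ x, ψv x * farOperator p a T u x = ∫ x, ψ x * farOperator p a T u (x + v) := by
    rw [← integral_add_right_eq_self _ v]
    simp [hψv]
  refine ⟨hi3.sub hi1, ?_, ?_⟩
  · refine (hf3.sub hf1).congr (Filter.Eventually.of_forall fun x => ?_)
    simp only [Pi.sub_apply]; ring
  · rw [integral_sub hi3 hi1, hn3, hn2, hn1, hf4]
    have : ∫ x, ψ x * (farOperator p a T u (x + v) - farOperator p a T u x) =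
        (∫ x, ψ x * farOperator p a T u (x + v)) - ∫ x, ψ x * farOperator p a T u x := by
      rw [← integral_sub hf3 hf1]
      congr 1; ext x; ring
    rw [this]; ring

/-- One-sided bound for the increment of the far operator. -/
theorem neg_le_farOperator_sub (h : LipschitzWeakSolution p a Λ u) (hp : 2 ≤ p) (ha : 0 ≤ a)
    {T : ℝ} (hT : 8 ≤ T) {x v : V} (hx : ‖x‖ ≤ 1) (hv : ‖v‖ ≤ 1) (hu : u x ≤ u (x + v))
    (hi : Integrable fun y => (1 + |u y| ^ (p - 1)) * (T + ‖y‖) ^ (-a - 1)) :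
    -(2 ^ (p - 1) * (1 + Λ ^ (p - 1)) * (a * 4 ^ (a + 1)) *
      (∫ y, (1 + |u y| ^ (p - 1)) * (T + ‖y‖) ^ (-a - 1)) * ‖v‖) ≤
      farOperator p a T u (x + v) - farOperator p a T u x := by
  have hΛ := h.nonneg
  have hp1 : 0 ≤ p - 1 := by linarith
  have hxv : ‖x + v‖ ≤ 2 := (norm_add_le _ _).trans (by linarith)
  have i1 := h.integrable_far hp ha hT (x := x + v) (x' := x + v) (by linarith) (by linarith)
  have i2 := h.integrable_far hp ha hT (x := x) (x' := x + v) (by linarith) (by linarith)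
  have i3 := h.integrable_far hp ha hT (x := x) (x' := x) (by linarith) (by linarith)
  -- The first integral moves the kernel at a fixed value of `u`, and Lipschitz decay of the kernel
  -- gives the weight with exponent `-a - 1`. The second moves the value of `u` at a fixed kernel,
  -- and is nonnegative because `oddPow` is monotone and `u x ≤ u (x + v)`.
  have e : farOperator p a T u (x + v) - farOperator p a T u x =
      (∫ y, (oddPow p (u (x + v) - u y) * farKernel a T (x + v - y) -
        oddPow p (u (x + v) - u y) * farKernel a T (x - y))) +
      ∫ y, (oddPow p (u (x + v) - u y) * farKernel a T (x - y) -
        oddPow p (u x - u y) * farKernel a T (x - y)) := by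
    rw [integral_sub i1 i2, integral_sub i2 i3]
    unfold farOperator; ring
  have hpos : 0 ≤ ∫ y, (oddPow p (u (x + v) - u y) * farKernel a T (x - y) -
        oddPow p (u x - u y) * farKernel a T (x - y)) := by
    apply integral_nonneg
    intro y
    have h1 := monotone_oddPow hp (show u x - u y ≤ u (x + v) - u y by linarith)
    have h2 := farKernel_nonneg (a := a) (T := T) (x - y)
    simp only [Pi.zero_apply]
    rw [← sub_mul]
    exact mul_nonneg (by linarith) h2
  set Cst := 2 ^ (p - 1) * (1 + Λ ^ (p - 1)) * (a * 4 ^ (a + 1)) with hCst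
  have hbd : |∫ y, (oddPow p (u (x + v) - u y) * farKernel a T (x + v - y) -
        oddPow p (u (x + v) - u y) * farKernel a T (x - y))| ≤
      ∫ y, Cst * ‖v‖ * ((1 + |u y| ^ (p - 1)) * (T + ‖y‖) ^ (-a - 1)) := by
    rw [← Real.norm_eq_abs]
    apply norm_integral_le_of_norm_le (hi.const_mul _)
    refine Filter.Eventually.of_forall fun y => ?_
    rw [← mul_sub, norm_mul, Real.norm_eq_abs, Real.norm_eq_abs]
    have h1 := abs_oddPow_sub_le hp (u (x + v)) (u y)
    have h2 : |u (x + v)| ^ (p - 1) ≤ Λ ^ (p - 1) :=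
      Real.rpow_le_rpow (abs_nonneg _) (h.bounded _ (by
        rw [mem_ball_zero_iff]; linarith)) hp1
    have h3 : |oddPow p (u (x + v) - u y)| ≤
        2 ^ (p - 1) * (1 + Λ ^ (p - 1)) * (1 + |u y| ^ (p - 1)) := by
      refine h1.trans ?_
      rw [mul_assoc]
      gcongr
      have := Real.rpow_nonneg (abs_nonneg (u y)) (p - 1)
      have : 0 ≤ Λ ^ (p - 1) := by positivity
      nlinarith
    have hB : 0 < (T + ‖y‖) / 4 := by positivity
    have h4 := abs_farKernel_sub_le (T := T) ha hB
      (add_le_max_norm_sub hT (x := x + v) (y := y) (by linarith))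
      (add_le_max_norm_sub hT (x := x) (y := y) (by linarith))
    have e1 : x + v - y - (x - y) = v := by abel
    rw [e1] at h4
    have e2 : ((T + ‖y‖) / 4) ^ (-a - 1) = 4 ^ (a + 1) * (T + ‖y‖) ^ (-a - 1) := by
      rw [Real.div_rpow (by positivity) (by norm_num),
        show -a - 1 = -(a + 1) by ring, Real.rpow_neg (by norm_num : (0:ℝ) ≤ 4)]
      field_simp
    rw [e2] at h4
    calc _ ≤ (2 ^ (p - 1) * (1 + Λ ^ (p - 1)) * (1 + |u y| ^ (p - 1))) *
          (a * (4 ^ (a + 1) * (T + ‖y‖) ^ (-a - 1)) * ‖v‖) := by gcongr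
      _ = _ := by rw [hCst]; ring
  rw [integral_const_mul] at hbd
  have := (abs_le.1 hbd).1
  rw [e]
  linarith

end LipschitzWeakSolution

end Form

/-! ### Energy estimate for difference quotients -/

section Energy

variable {d : ℕ}

local notation "V" => EuclideanSpace ℝ (Fin d)

/-- Bounds for the increments of `u` used in the energy estimate. -/
structure IncrementBounds (p a β Λ C₀ δ T : ℝ) (e : V) (u : V → ℝ) : Prop where
  lip : ∀ x ∈ Metric.ball (0 : V) 9, ∀ y ∈ Metric.ball (0 : V) 9, |u x - u y| ≤ Λ * ‖x - y‖
  lip_far : ∀ x ∈ Metric.ball (0 : V) 2, ∀ y ∈ Metric.ball (0 : V) (T + 2),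
    |u x - u y| ≤ Λ * (1 + ‖y‖) ^ (1 + β)
  incr : ∀ y ∈ Metric.ball (0 : V) 8, ∀ t, 0 < t → t ≤ 1 → u (y + t • e) - u y ≤ t * (1 + C₀ * δ)
  incr_far : ∀ y ∈ Metric.ball (0 : V) (T + 1), ∀ t, 0 < t → t ≤ 1 →
    u (y + t • e) - u y ≤ t * (1 + C₀ * δ * (1 + ‖y‖) ^ β)
  far : ∀ x ∈ Metric.ball (0 : V) 1, ∀ t, 0 < t → t ≤ 1 → u x ≤ u (x + t • e) →
    -(δ * t) ≤ farOperator p a T u (x + t • e) - farOperator p a T u x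

/-- Difference quotient minus barrier and level. -/
noncomputable def incrExcess (u : V → ℝ) (e : V) (t b m : ℝ) (x : V) : ℝ :=
  (u (x + t • e) - u x) / t - b * ‖x‖ - m

/-- The truncated test function. -/
noncomputable def incrTest (u : V → ℝ) (e : V) (t b m : ℝ) (x : V) : ℝ :=
  (Metric.ball (0 : V) 8).indicator (fun x => max (incrExcess u e t b m x) 0) x

/-- The positivity set of the test function. -/
def incrSet (u : V → ℝ) (e : V) (t b m : ℝ) : Set V :=
  {x | x ∈ Metric.ball (0 : V) 1 ∧ 0 < incrExcess u e t b m x}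

namespace IncrementBounds

variable {p a β Λ C₀ δ T t m : ℝ} {e : EuclideanSpace ℝ (Fin d)}
  {u : EuclideanSpace ℝ (Fin d) → ℝ}

lemma excess_le (h : IncrementBounds p a β Λ C₀ δ T e u)
    (ht : 0 < t) (ht1 : t ≤ 1) (hm : 1 - δ - (4 * C₀ + 12) * δ / 2 - δ ≤ m)
    {x : V} (hx : x ∈ Metric.ball (0 : V) 8) :
    incrExcess u e t ((4 * C₀ + 12) * δ) m x ≤
      (3 * C₀ + 8) * δ - (4 * C₀ + 12) * δ * ‖x‖ := by
  have h1 := h.incr x hx t ht ht1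
  have h2 : (u (x + t • e) - u x) / t ≤ 1 + C₀ * δ := by
    rw [div_le_iff₀ ht]; linarith
  unfold incrExcess
  nlinarith

lemma test_eq_max (hx : x ∈ Metric.ball (0 : EuclideanSpace ℝ (Fin d)) 8) (b : ℝ) :
    incrTest u e t b m x = max (incrExcess u e t b m x) 0 :=
  Set.indicator_of_mem hx _

/-- On `B_8` outside `B_1` the barrier is at least `(4C₀ + 12)δ`, which exceeds the largest possible
excess `(3C₀ + 8)δ`. -/
lemma mem_of_excess_pos (h : IncrementBounds p a β Λ C₀ δ T e u) (hδ : 0 < δ) (hC₀ : 0 ≤ C₀)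
    (ht : 0 < t) (ht1 : t ≤ 1) (hm : 1 - δ - (4 * C₀ + 12) * δ / 2 - δ ≤ m)
    {x : V} (hx : x ∈ Metric.ball (0 : V) 8)
    (hw : 0 < incrExcess u e t ((4 * C₀ + 12) * δ) m x) : x ∈ Metric.ball (0 : V) 1 := by
  have h1 := h.excess_le ht ht1 hm hx
  rw [mem_ball_zero_iff]
  by_contra! hge
  have h2 : (4 * C₀ + 12) * δ * 1 ≤ (4 * C₀ + 12) * δ * ‖x‖ := by gcongr
  nlinarith [mul_nonneg hC₀ hδ.le]

lemma test_nonneg (b : ℝ) (x : EuclideanSpace ℝ (Fin d)) : 0 ≤ incrTest u e t b m x :=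
  Set.indicator_nonneg (fun _ _ => le_max_right _ _) x

lemma test_eq_zero (h : IncrementBounds p a β Λ C₀ δ T e u) (hδ : 0 < δ) (hC₀ : 0 ≤ C₀)
    (ht : 0 < t) (ht1 : t ≤ 1) (hm : 1 - δ - (4 * C₀ + 12) * δ / 2 - δ ≤ m)
    {x : V} (hx : x ∉ incrSet u e t ((4 * C₀ + 12) * δ) m) :
    incrTest u e t ((4 * C₀ + 12) * δ) m x = 0 := by
  by_cases h8 : x ∈ Metric.ball (0 : V) 8
  · rw [test_eq_max h8]
    apply max_eq_right
    by_contra! hpos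
    exact hx ⟨h.mem_of_excess_pos hδ hC₀ ht ht1 hm h8 hpos, hpos⟩
  · exact Set.indicator_of_notMem h8 _

lemma test_le (h : IncrementBounds p a β Λ C₀ δ T e u) (hδ : 0 < δ) (hC₀ : 0 ≤ C₀)
    (ht : 0 < t) (ht1 : t ≤ 1) (hm : 1 - δ - (4 * C₀ + 12) * δ / 2 - δ ≤ m) (x : V) :
    incrTest u e t ((4 * C₀ + 12) * δ) m x ≤ (3 * C₀ + 8) * δ := by
  by_cases h8 : x ∈ Metric.ball (0 : V) 8
  · rw [test_eq_max h8]
    apply max_le _ (by positivity)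
    have h1 := h.excess_le ht ht1 hm h8
    have : 0 ≤ (4 * C₀ + 12) * δ * ‖x‖ := by positivity
    linarith
  · rw [incrTest, Set.indicator_of_notMem h8]; positivity

lemma excess_lipschitz (h : IncrementBounds p a β Λ C₀ δ T e u) (he : ‖e‖ = 1)
    (ht : 0 < t) (ht1 : t ≤ 1) {b : ℝ} (hb : 0 ≤ b)
    {x y : V} (hx : x ∈ Metric.ball (0 : V) 8) (hy : y ∈ Metric.ball (0 : V) 8) :
    |incrExcess u e t b m x - incrExcess u e t b m y| ≤ (2 * Λ / t + b) * ‖x - y‖ := by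
  have hsh : ∀ z ∈ Metric.ball (0 : V) 8, z + t • e ∈ Metric.ball (0 : V) 9 := by
    intro z hz
    rw [mem_ball_zero_iff] at *
    refine (norm_add_le _ _).trans_lt ?_
    rw [norm_smul, he, Real.norm_of_nonneg ht.le]; linarith
  have hs : Metric.ball (0 : V) 8 ⊆ Metric.ball (0 : V) 9 := Metric.ball_subset_ball (by norm_num)
  have h1 := h.lip _ (hsh x hx) _ (hsh y hy)
  have h2 := h.lip _ (hs hx) _ (hs hy)
  rw [add_sub_add_right_eq_sub] at h1
  have h3 : |‖x‖ - ‖y‖| ≤ ‖x - y‖ := abs_norm_sub_norm_le x y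
  have e1 : incrExcess u e t b m x - incrExcess u e t b m y =
      ((u (x + t • e) - u (y + t • e)) - (u x - u y)) / t - b * (‖x‖ - ‖y‖) := by
    unfold incrExcess; ring
  rw [e1]
  refine (abs_sub _ _).trans ?_
  rw [abs_div, abs_of_pos ht, abs_mul, abs_of_nonneg hb, add_mul]
  have h4 : |u (x + t • e) - u (y + t • e) - (u x - u y)| / t ≤ 2 * Λ / t * ‖x - y‖ := by
    rw [div_mul_eq_mul_div]
    gcongr
    refine (abs_sub _ _).trans (by linarith)
  gcongr

/-- Cutting off at `B_8` creates no jump, since the positive part already vanishes outside `B_1`.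
The Lipschitz constant blows up as `t` tends to 0, which is harmless because it does not enter the
energy bound. -/
lemma test_lipschitz (h : IncrementBounds p a β Λ C₀ δ T e u) (he : ‖e‖ = 1)
    (hΛ : 0 ≤ Λ) (hδ : 0 < δ) (hC₀ : 0 ≤ C₀)
    (ht : 0 < t) (ht1 : t ≤ 1) (hm : 1 - δ - (4 * C₀ + 12) * δ / 2 - δ ≤ m) (x y : V) :
    |incrTest u e t ((4 * C₀ + 12) * δ) m x - incrTest u e t ((4 * C₀ + 12) * δ) m y| ≤
      (2 * Λ / t + (4 * C₀ + 12) * δ + (3 * C₀ + 8) * δ) * ‖x - y‖ := by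
  set b := (4 * C₀ + 12) * δ with hb
  have hb0 : 0 ≤ b := by positivity
  have hfar : ∀ x y : V, y ∉ Metric.ball (0 : V) 8 →
      |incrTest u e t b m x - incrTest u e t b m y| ≤
      (2 * Λ / t + b + (3 * C₀ + 8) * δ) * ‖x - y‖ := by
    intro x y hy
    have hy0 : incrTest u e t b m y = 0 := Set.indicator_of_notMem hy _
    rw [hy0, sub_zero, abs_of_nonneg (test_nonneg _ _)]
    by_cases hx : x ∈ incrSet u e t b m
    · have hx1 : ‖x‖ < 1 := by simpa using hx.1
      have hy8 : 8 ≤ ‖y‖ := by simpa using hy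
      have h1 : 1 ≤ ‖x - y‖ := by
        have := norm_sub_norm_le y x
        rw [norm_sub_rev] at this; linarith
      have h2 := h.test_le hδ hC₀ ht ht1 hm x
      calc _ ≤ (3 * C₀ + 8) * δ * 1 := by linarith
        _ ≤ (2 * Λ / t + b + (3 * C₀ + 8) * δ) * ‖x - y‖ := by
          have h3 : 0 ≤ 2 * Λ / t + b := by positivity
          gcongr
          linarith
    · rw [h.test_eq_zero hδ hC₀ ht ht1 hm hx]; positivity
  by_cases hx : x ∈ Metric.ball (0 : V) 8
  · by_cases hy : y ∈ Metric.ball (0 : V) 8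
    · rw [test_eq_max hx, test_eq_max hy]
      refine (abs_max_sub_max_le_abs _ _ _).trans ((h.excess_lipschitz he ht ht1 hb0 hx hy).trans ?_)
      have : 0 ≤ (3 * C₀ + 8) * δ := by positivity
      exact mul_le_mul_of_nonneg_right (by linarith) (norm_nonneg _)
    · exact hfar x y hy
  · rw [abs_sub_comm, norm_sub_rev]; exact hfar y x hx

end IncrementBounds

/-- Here `β` is the increment of the barrier. If both `w₁` and `w₂` are nonpositive the product is
zero, otherwise completing the square absorbs `β`. Its cost is charged only to the positivity set
through `i₁` and `i₂`, which is why the energy bound carries the measure of that set. Half of the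
cross term is kept for the non-flat case. -/
lemma mul_sub_max_ge (w₁ w₂ β : ℝ) {i₁ i₂ : ℝ} (h₁ : 0 ≤ i₁) (h₂ : 0 ≤ i₂)
    (hi₁ : 0 < w₁ → i₁ = 1) (hi₂ : 0 < w₂ → i₂ = 1) :
    (max w₁ 0 - max w₂ 0) ^ 2 / 2 + max w₁ 0 * max (-w₂) 0 / 2 - β ^ 2 / 2 * (i₁ + i₂) ≤
      (w₁ - w₂ + β) * (max w₁ 0 - max w₂ 0) := by
  rcases le_or_gt w₁ 0 with c1 | c1 <;> rcases le_or_gt w₂ 0 with c2 | c2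
  · rw [max_eq_right c1, max_eq_right c2]
    have : 0 ≤ β ^ 2 / 2 * (i₁ + i₂) := by positivity
    linarith
  · rw [max_eq_right c1, max_eq_left c2.le, max_eq_right (by linarith), hi₂ c2]
    have : 0 ≤ β ^ 2 / 2 * i₁ := by positivity
    nlinarith [sq_nonneg (w₂ - β), mul_nonneg (neg_nonneg.2 c1) c2.le]
  · rw [max_eq_left c1.le, max_eq_right c2, max_eq_left (by linarith : 0 ≤ -w₂), hi₁ c1]
    have : 0 ≤ β ^ 2 / 2 * i₂ := by positivity
    nlinarith [sq_nonneg (w₁ + β), mul_nonneg (neg_nonneg.2 c2) c1.le]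
  · rw [max_eq_left c1.le, max_eq_left c2.le, max_eq_right (by linarith : -w₂ ≤ 0), hi₁ c1, hi₂ c2]
    nlinarith [sq_nonneg (w₁ - w₂ + β)]


/-- The error terms in the energy estimate. -/
noncomputable def energyError (p a β Λ C₀ δ : ℝ) (S : Set V) (φ : V → ℝ) (z : V × V) : ℝ :=
  (p - 1) * (2 * Λ) ^ (p - 2) * ((4 * C₀ + 12) * δ) ^ 2 / 2 *
      (S.indicator 1 z.2 * (Metric.ball (0 : V) 16).indicator (fun w => ‖w‖ ^ (p - a)) (z.1 - z.2) +
        S.indicator 1 z.1 *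
          (Metric.ball (0 : V) 16).indicator (fun w => ‖w‖ ^ (p - a)) (z.1 - z.2)) +
    (p - 1) * (2 * Λ * 2 ^ (1 + β)) ^ (p - 2) * (3 * C₀ + 8) * 2 ^ a * δ *
      (φ z.1 * (1 + ‖z.2‖) ^ ((1 + β) * (p - 2) + β - a) +
        (1 + ‖z.1‖) ^ ((1 + β) * (p - 2) + β - a) * φ z.2)

namespace IncrementBounds

variable {p a β Λ C₀ δ T t m : ℝ} {e : EuclideanSpace ℝ (Fin d)}
  {u : EuclideanSpace ℝ (Fin d) → ℝ}

/-- Increment of the near form integrand in terms of the slope. -/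
lemma near_form_local (h : IncrementBounds p a β Λ C₀ δ T e u) (he : ‖e‖ = 1) (hp : 2 ≤ p)
    (ha : 1 ≤ a) (hT : 32 ≤ T) (hΛ : 0 ≤ Λ) (ht : 0 < t)
    (ht1 : t ≤ 1) {b : ℝ} {S : Set V}
    (hS : ∀ z ∈ Metric.ball (0 : V) 8, 0 < incrExcess u e t b m z → z ∈ S)
    {x y : V} (hx : x ∈ Metric.ball (0 : V) 8) (hy : y ∈ Metric.ball (0 : V) 8) (hxy : x ≠ y) :
    t * (energyDensity u (p - 2) a (incrExcess u e t b m) x y / 8 -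
      (p - 1) * (2 * Λ) ^ (p - 2) * b ^ 2 / 2 *
        ((S.indicator (1 : V → ℝ) x + S.indicator 1 y) * ‖x - y‖ ^ (p - a))) ≤
    (oddPow p (u (x + t • e) - u (y + t • e)) - oddPow p (u x - u y)) *
      (max (incrExcess u e t b m x) 0 - max (incrExcess u e t b m y) 0) *
      nearKernel a T (x - y) := by
  set w := incrExcess u e t b m with hw
  have hsh : ∀ z ∈ Metric.ball (0 : V) 8, z + t • e ∈ Metric.ball (0 : V) 9 := by
    intro z hz
    rw [mem_ball_zero_iff] at *
    refine (norm_add_le _ _).trans_lt ?_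
    rw [norm_smul, he, Real.norm_of_nonneg ht.le]; linarith
  have hs : Metric.ball (0 : V) 8 ⊆ Metric.ball (0 : V) 9 := Metric.ball_subset_ball (by norm_num)
  have h1 := h.lip _ (hsh x hx) _ (hsh y hy)
  have h2 := h.lip _ (hs hx) _ (hs hy)
  rw [add_sub_add_right_eq_sub] at h1
  have hxy0 : x - y ≠ 0 := sub_ne_zero.2 hxy
  have hn0 : 0 < ‖x - y‖ := norm_pos_iff.2 hxy0
  obtain ⟨κ, hκ1, hκ2, hκ3⟩ := exists_slope_oddPow hp (u (x + t • e) - u (y + t • e)) (u x - u y)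
  have hκ0 : 0 ≤ κ := le_trans (by positivity) hκ1
  have hκ4 : κ ≤ (p - 1) * ((2 * Λ) ^ (p - 2) * ‖x - y‖ ^ (p - 2)) := by
    refine hκ2.trans ?_
    have : 0 ≤ p - 1 := by linarith
    gcongr
    rw [← Real.mul_rpow (by positivity) hn0.le]
    apply Real.rpow_le_rpow (by positivity) _ (by linarith)
    linarith
  have hk0 := nearKernel_nonneg (T := T) (by linarith : 0 ≤ a) hxy0
  have hk1 : nearKernel a T (x - y) ≤ ‖x - y‖ ^ (-a) :=
    (le_abs_self _).trans (abs_nearKernel_le (by linarith) hxy0)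
  have hk2 : ‖x - y‖ ^ (-a) / 2 ≤ nearKernel a T (x - y) := by
    apply half_le_nearKernel ha hxy0
    rw [mem_ball_zero_iff] at hx hy
    have := norm_sub_le x y
    linarith
  set i₁ := S.indicator (1 : V → ℝ) x
  set i₂ := S.indicator (1 : V → ℝ) y
  have hi₁ : 0 ≤ i₁ := Set.indicator_nonneg (fun _ _ => zero_le_one) x
  have hi₂ : 0 ≤ i₂ := Set.indicator_nonneg (fun _ _ => zero_le_one) y
  have halg := mul_sub_max_ge (w x) (w y) (b * (‖x‖ - ‖y‖)) hi₁ hi₂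
    (fun hpos => Set.indicator_of_mem (hS x hx hpos) _)
    (fun hpos => Set.indicator_of_mem (hS y hy hpos) _)
  have hdiff : (u (x + t • e) - u (y + t • e)) - (u x - u y) =
      t * (w x - w y + b * (‖x‖ - ‖y‖)) := by
    rw [hw]; unfold incrExcess; field_simp; ring
  rw [hκ3, hdiff]
  set E := (max (w x) 0 - max (w y) 0) ^ 2 + max (w x) 0 * max (-w y) 0 with hE
  have hE0 : 0 ≤ E := by positivity
  have hβ : (b * (‖x‖ - ‖y‖)) ^ 2 ≤ b ^ 2 * ‖x - y‖ ^ 2 := by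
    rw [mul_pow]
    apply mul_le_mul_of_nonneg_left _ (sq_nonneg b)
    rw [← sq_abs (‖x‖ - ‖y‖)]
    exact pow_le_pow_left₀ (abs_nonneg _) (abs_norm_sub_norm_le x y) 2
  have hκk0 : 0 ≤ κ * nearKernel a T (x - y) := mul_nonneg hκ0 hk0
  -- The slope and the near kernel lose one factor 2 each. With the factor 2 lost in
  -- `mul_sub_max_ge` this makes the constant `1/8`.
  have hlow : |u x - u y| ^ (p - 2) * ‖x - y‖ ^ (-a) / 4 ≤ κ * nearKernel a T (x - y) := by
    have : (|u x - u y| ^ (p - 2) / 2) * (‖x - y‖ ^ (-a) / 2) ≤ κ * nearKernel a T (x - y) := by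
      gcongr
    linarith
  have hup : κ * nearKernel a T (x - y) ≤
      (p - 1) * ((2 * Λ) ^ (p - 2) * ‖x - y‖ ^ (p - 2)) * ‖x - y‖ ^ (-a) := by
    have : 0 ≤ p - 1 := by linarith
    gcongr
  have hpow : ‖x - y‖ ^ (p - 2) * ‖x - y‖ ^ (-a) * ‖x - y‖ ^ 2 = ‖x - y‖ ^ (p - a) := by
    rw [← Real.rpow_natCast, ← Real.rpow_add hn0, ← Real.rpow_add hn0]
    congr 1; push_cast; ring
  have step : energyDensity u (p - 2) a w x y / 8 -
      (p - 1) * (2 * Λ) ^ (p - 2) * b ^ 2 / 2 * ((i₁ + i₂) * ‖x - y‖ ^ (p - a)) ≤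
      κ * nearKernel a T (x - y) *
        ((w x - w y + b * (‖x‖ - ‖y‖)) * (max (w x) 0 - max (w y) 0)) := by
    have s1 : energyDensity u (p - 2) a w x y / 8 ≤ κ * nearKernel a T (x - y) * (E / 2) := by
      unfold energyDensity
      have := mul_le_mul_of_nonneg_right hlow (show 0 ≤ E / 2 by positivity)
      linarith
    have s2 : κ * nearKernel a T (x - y) * ((b * (‖x‖ - ‖y‖)) ^ 2 / 2 * (i₁ + i₂)) ≤
        (p - 1) * (2 * Λ) ^ (p - 2) * b ^ 2 / 2 * ((i₁ + i₂) * ‖x - y‖ ^ (p - a)) := by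
      calc _ ≤ ((p - 1) * ((2 * Λ) ^ (p - 2) * ‖x - y‖ ^ (p - 2)) * ‖x - y‖ ^ (-a)) *
            (b ^ 2 * ‖x - y‖ ^ 2 / 2 * (i₁ + i₂)) := by
            have : 0 ≤ p - 1 := by linarith
            gcongr
        _ = _ := by rw [← hpow]; ring
    have s3 := mul_le_mul_of_nonneg_left halg hκk0
    have e1 : κ * nearKernel a T (x - y) * ((max (w x) 0 - max (w y) 0) ^ 2 / 2 +
        max (w x) 0 * max (-w y) 0 / 2 - (b * (‖x‖ - ‖y‖)) ^ 2 / 2 * (i₁ + i₂)) =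
        κ * nearKernel a T (x - y) * (E / 2) -
        κ * nearKernel a T (x - y) * ((b * (‖x‖ - ‖y‖)) ^ 2 / 2 * (i₁ + i₂)) := by
      rw [hE]; ring
    rw [e1] at s3
    linarith
  have := mul_le_mul_of_nonneg_left step ht.le
  refine this.trans_eq ?_
  ring

/-- The contribution of one point near the origin and one far away. -/
lemma near_form_far (h : IncrementBounds p a β Λ C₀ δ T e u) (he : ‖e‖ = 1) (hp : 2 ≤ p)
    (ha : 1 ≤ a) (hΛ : 0 ≤ Λ) (hβ : 0 ≤ β) (hC₀ : 0 ≤ C₀) (hδ : 0 < δ) (ht : 0 < t)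
    (ht1 : t ≤ 1) {b : ℝ} (hb : 0 ≤ b) (hm : 1 - δ - (4 * C₀ + 12) * δ / 2 - δ ≤ m)
    {x y : V} (hx : x ∈ Metric.ball (0 : V) 1) (hy : y ∉ Metric.ball (0 : V) 8)
    (hw : 0 < incrExcess u e t b m x) {φ : ℝ} (hφ : 0 ≤ φ) :
    -(t * ((p - 1) * (2 * Λ * 2 ^ (1 + β)) ^ (p - 2) * (3 * C₀ + 8) * 2 ^ a * δ *
      (φ * (1 + ‖y‖) ^ ((1 + β) * (p - 2) + β - a)))) ≤
    (oddPow p (u (x + t • e) - u (y + t • e)) - oddPow p (u x - u y)) * φ *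
      nearKernel a T (x - y) := by
  have hx1 : ‖x‖ < 1 := by simpa using hx
  have hy8 : 8 ≤ ‖y‖ := by simpa using hy
  have hp1 : 0 ≤ p - 1 := by linarith
  set Y := 1 + ‖y‖ with hY
  have hY1 : 1 ≤ Y := by rw [hY]; linarith
  have hY0 : 0 < Y := by linarith
  have hrhs : 0 ≤ t * ((p - 1) * (2 * Λ * 2 ^ (1 + β)) ^ (p - 2) * (3 * C₀ + 8) * 2 ^ a * δ *
      (φ * Y ^ ((1 + β) * (p - 2) + β - a))) := by positivity
  -- Beyond distance `T` the near kernel vanishes. Below it `y` lies in `B_{T+1}`, where the growth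
  -- bounds on `u` apply.
  rcases le_or_gt T ‖x - y‖ with hTxy | hTxy
  · rw [nearKernel_eq_zero hTxy, mul_zero]; linarith
  have hyT : ‖y‖ < T + 1 := by
    have := norm_sub_norm_le y x
    rw [norm_sub_rev] at this; linarith
  have hxy0 : x - y ≠ 0 := by
    rw [sub_ne_zero]; rintro rfl; linarith
  have hte : ‖t • e‖ ≤ 1 := by rw [norm_smul, he, Real.norm_of_nonneg ht.le]; linarith
  obtain ⟨κ, hκ1, hκ2, hκ3⟩ := exists_slope_oddPow hp (u (x + t • e) - u (y + t • e)) (u x - u y)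
  have hκ0 : 0 ≤ κ := le_trans (by positivity) hκ1
  have h1 : |u (x + t • e) - u (y + t • e)| ≤ Λ * (2 * Y) ^ (1 + β) := by
    have hyt : ‖y + t • e‖ ≤ ‖y‖ + 1 := (norm_add_le _ _).trans (by linarith)
    refine (h.lip_far _ ?_ _ ?_).trans ?_
    · rw [mem_ball_zero_iff]; exact (norm_add_le _ _).trans_lt (by linarith)
    · rw [mem_ball_zero_iff]; linarith
    · gcongr
      rw [hY]; linarith
  have h2 : |u x - u y| ≤ Λ * (2 * Y) ^ (1 + β) := by
    refine (h.lip_far _ ?_ _ ?_).trans ?_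
    · rw [mem_ball_zero_iff]; linarith
    · rw [mem_ball_zero_iff]; linarith
    · gcongr
      linarith
  have hκ4 : κ ≤ (p - 1) * ((2 * Λ * 2 ^ (1 + β)) ^ (p - 2) * Y ^ ((1 + β) * (p - 2))) := by
    refine hκ2.trans ?_
    gcongr
    rw [Real.rpow_mul hY0.le, ← Real.mul_rpow (by positivity) (by positivity)]
    apply Real.rpow_le_rpow (by positivity) _ (by linarith)
    rw [Real.mul_rpow (by norm_num) hY0.le] at h1 h2
    linarith
  have hk0 := nearKernel_nonneg (T := T) (by linarith : 0 ≤ a) hxy0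
  have hk1 : nearKernel a T (x - y) ≤ 2 ^ a * Y ^ (-a) := by
    refine (le_abs_self _).trans ((abs_nearKernel_le (by linarith) hxy0).trans ?_)
    have h5 : Y / 2 ≤ ‖x - y‖ := by
      have := norm_sub_norm_le y x
      rw [norm_sub_rev] at this; rw [hY]; linarith
    refine (Real.rpow_le_rpow_of_nonpos (by positivity) h5 (by linarith)).trans_eq ?_
    rw [Real.div_rpow hY0.le (by norm_num), Real.rpow_neg (by norm_num : (0:ℝ) ≤ 2)]
    field_simp
  -- Positive excess at `x` makes its increment at least `m t`, with `m ≥ 1 - (2C₀ + 8)δ`. The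
  -- increment at `y` is at most `t (1 + C₀ δ Y^β)`. The leading terms cancel and an error of order
  -- `δ` remains.
  have hincr : -(t * ((3 * C₀ + 8) * δ * Y ^ β)) ≤
      (u (x + t • e) - u (y + t • e)) - (u x - u y) := by
    have h6 := h.incr_far y (by rwa [mem_ball_zero_iff]) t ht ht1
    have h7 : m * t ≤ u (x + t • e) - u x := by
      unfold incrExcess at hw
      have : 0 ≤ b * ‖x‖ := by positivity
      rw [← le_div_iff₀ ht]; linarith
    have h8 : (1:ℝ) ≤ Y ^ β := Real.one_le_rpow hY1 hβ
    have h9 : (1 - (2 * C₀ + 8) * δ * Y ^ β) * t ≤ m * t := by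
      apply mul_le_mul_of_nonneg_right _ ht.le
      have : (2 * C₀ + 8) * δ * 1 ≤ (2 * C₀ + 8) * δ * Y ^ β := by gcongr
      linarith
    rw [← hY] at h6
    nlinarith
  rw [hκ3]
  have hφk : 0 ≤ φ * nearKernel a T (x - y) := mul_nonneg hφ hk0
  have s1 : κ * -(t * ((3 * C₀ + 8) * δ * Y ^ β)) ≤
      κ * ((u (x + t • e) - u (y + t • e)) - (u x - u y)) := by gcongr
  have s2 := mul_le_mul_of_nonneg_right s1 hφk
  have s3 : κ * (t * ((3 * C₀ + 8) * δ * Y ^ β)) * (φ * nearKernel a T (x - y)) ≤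
      ((p - 1) * ((2 * Λ * 2 ^ (1 + β)) ^ (p - 2) * Y ^ ((1 + β) * (p - 2)))) *
        (t * ((3 * C₀ + 8) * δ * Y ^ β)) * (φ * (2 ^ a * Y ^ (-a))) := by
    gcongr
  have hpow : Y ^ ((1 + β) * (p - 2) + β - a) = Y ^ ((1 + β) * (p - 2)) * Y ^ β * Y ^ (-a) := by
    rw [← Real.rpow_add hY0, ← Real.rpow_add hY0]; congr 1
  rw [hpow]
  calc _ = -(((p - 1) * ((2 * Λ * 2 ^ (1 + β)) ^ (p - 2) * Y ^ ((1 + β) * (p - 2)))) *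
        (t * ((3 * C₀ + 8) * δ * Y ^ β)) * (φ * (2 ^ a * Y ^ (-a)))) := by ring
    _ ≤ -(κ * (t * ((3 * C₀ + 8) * δ * Y ^ β)) * (φ * nearKernel a T (x - y))) := by linarith
    _ = κ * -(t * ((3 * C₀ + 8) * δ * Y ^ β)) * (φ * nearKernel a T (x - y)) := by ring
    _ ≤ _ := s2.trans_eq (by ring)

/-- Pointwise lower bound for the increment of the near form. -/
theorem near_form_ge (h : IncrementBounds p a β Λ C₀ δ T e u) (he : ‖e‖ = 1) (hp : 2 ≤ p)
    (ha : 1 ≤ a) (hT : 32 ≤ T) (hΛ : 0 ≤ Λ) (hβ : 0 ≤ β) (hC₀ : 0 ≤ C₀) (hδ : 0 < δ) (ht : 0 < t)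
    (ht1 : t ≤ 1) (hm : 1 - δ - (4 * C₀ + 12) * δ / 2 - δ ≤ m) (z : V × V) :
    t * ((Metric.ball (0 : V) 8 ×ˢ Metric.ball (0 : V) 8).indicator (fun z =>
        energyDensity u (p - 2) a (incrExcess u e t ((4 * C₀ + 12) * δ) m) z.1 z.2 / 8) z -
      energyError p a β Λ C₀ δ (incrSet u e t ((4 * C₀ + 12) * δ) m)
        (incrTest u e t ((4 * C₀ + 12) * δ) m) z) ≤
    formIntegrand p (nearKernel a T) (fun x => u (x + t • e))
        (incrTest u e t ((4 * C₀ + 12) * δ) m) z -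
      formIntegrand p (nearKernel a T) u (incrTest u e t ((4 * C₀ + 12) * δ) m) z := by
  obtain ⟨x, y⟩ := z
  set b := (4 * C₀ + 12) * δ with hb
  have hb0 : 0 ≤ b := by positivity
  set S := incrSet u e t b m with hSdef
  set φ := incrTest u e t b m with hφdef
  have hφ0 : ∀ x, 0 ≤ φ x := test_nonneg b
  have hp1 : 0 ≤ p - 1 := by linarith
  have hp2 : 0 ≤ p - 2 := by linarith
  have hφS : ∀ x, x ∉ S → φ x = 0 := fun x hx => h.test_eq_zero hδ hC₀ ht ht1 hm hx
  have hSx : ∀ z ∈ Metric.ball (0 : V) 8, 0 < incrExcess u e t b m z → z ∈ S := fun z hz hw =>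
    ⟨h.mem_of_excess_pos hδ hC₀ ht ht1 hm hz hw, hw⟩
  have hi : ∀ w, 0 ≤ S.indicator (1 : V → ℝ) w :=
    fun w => Set.indicator_nonneg (fun _ _ => zero_le_one) w
  have hg : ∀ w : V, 0 ≤ (Metric.ball (0 : V) 16).indicator (fun w => ‖w‖ ^ (p - a)) w :=
    fun w => Set.indicator_nonneg (fun _ _ => by positivity) w
  set Ca := (p - 1) * (2 * Λ) ^ (p - 2) * b ^ 2 / 2 with hCa
  set Cb := (p - 1) * (2 * Λ * 2 ^ (1 + β)) ^ (p - 2) * (3 * C₀ + 8) * 2 ^ a * δ with hCb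
  have hCa0 : 0 ≤ Ca := by positivity
  have hCb0 : 0 ≤ Cb := by positivity
  set γ := (1 + β) * (p - 2) + β - a with hγ
  have herr : energyError p a β Λ C₀ δ S φ (x, y) =
      Ca * (S.indicator 1 y * (Metric.ball (0 : V) 16).indicator (fun w => ‖w‖ ^ (p - a)) (x - y) +
        S.indicator 1 x * (Metric.ball (0 : V) 16).indicator (fun w => ‖w‖ ^ (p - a)) (x - y)) +
      Cb * (φ x * (1 + ‖y‖) ^ γ + (1 + ‖x‖) ^ γ * φ y) := rfl
  have n1 : 0 ≤ Ca * (S.indicator 1 y *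
      (Metric.ball (0 : V) 16).indicator (fun w => ‖w‖ ^ (p - a)) (x - y) +
        S.indicator 1 x *
          (Metric.ball (0 : V) 16).indicator (fun w => ‖w‖ ^ (p - a)) (x - y)) :=
    mul_nonneg hCa0 (add_nonneg (mul_nonneg (hi y) (hg _)) (mul_nonneg (hi x) (hg _)))
  have n2 : 0 ≤ Cb * (φ x * (1 + ‖y‖) ^ γ) := by have := hφ0 x; positivity
  have n3 : 0 ≤ Cb * ((1 + ‖x‖) ^ γ * φ y) := by have := hφ0 y; positivity
  have hD : formIntegrand p (nearKernel a T) (fun x => u (x + t • e)) φ (x, y) -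
      formIntegrand p (nearKernel a T) u φ (x, y) =
      (oddPow p (u (x + t • e) - u (y + t • e)) - oddPow p (u x - u y)) * (φ x - φ y) *
      nearKernel a T (x - y) := by
    simp only [formIntegrand]; ring
  rw [hD, herr]
  -- the mixed case, stated so that it can be used twice
  have hmix : ∀ x y : V, y ∉ Metric.ball (0 : V) 8 →
      -(t * (Cb * (φ x * (1 + ‖y‖) ^ γ))) ≤
      (oddPow p (u (x + t • e) - u (y + t • e)) - oddPow p (u x - u y)) * φ x *
      nearKernel a T (x - y) := by
    intro x y hy
    by_cases hxS : x ∈ S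
    · exact h.near_form_far he hp ha hΛ hβ hC₀ hδ ht ht1 hb0 hm hxS.1 hy hxS.2 (hφ0 x)
    · rw [hφS x hxS]; simp
  by_cases hx : x ∈ Metric.ball (0 : V) 8
  · by_cases hy : y ∈ Metric.ball (0 : V) 8
    · by_cases hxy : x = y
      · subst hxy
        rw [Set.indicator_of_mem (Set.mk_mem_prod hx hx)]
        have he0 : energyDensity u (p - 2) a (incrExcess u e t b m) x x = 0 := by
          unfold energyDensity
          rcases le_total (incrExcess u e t b m x) 0 with hw | hw
          · rw [max_eq_right hw]; simp
          · rw [max_eq_right (by linarith : -incrExcess u e t b m x ≤ 0)]; simp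
        simp only [sub_self] at n1
        simp only [he0, sub_self, mul_zero, zero_mul]
        have hnn : 0 ≤ Cb * (φ x * (1 + ‖x‖) ^ γ + (1 + ‖x‖) ^ γ * φ x) := by
          rw [mul_add]; exact add_nonneg n2 n3
        have := mul_nonneg ht.le (add_nonneg n1 hnn)
        linarith
      · have hloc := h.near_form_local he hp ha hT hΛ ht ht1 hSx (m := m) hx hy hxy
        have ex : φ x = max (incrExcess u e t b m x) 0 := test_eq_max hx b
        have ey : φ y = max (incrExcess u e t b m y) 0 := test_eq_max hy b
        rw [← ex, ← ey] at hloc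
        refine le_trans ?_ hloc
        have h16 : x - y ∈ Metric.ball (0 : V) 16 := by
          rw [mem_ball_zero_iff] at *
          exact (norm_sub_le _ _).trans_lt (by linarith)
        rw [Set.indicator_of_mem (Set.mk_mem_prod hx hy), Set.indicator_of_mem h16]
        rw [← hCa]
        apply mul_le_mul_of_nonneg_left _ ht.le
        have : Ca * (S.indicator 1 y * ‖x - y‖ ^ (p - a) + S.indicator 1 x * ‖x - y‖ ^ (p - a)) =
          Ca * ((S.indicator (1 : V → ℝ) x + S.indicator 1 y) * ‖x - y‖ ^ (p - a)) := by ring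
        rw [this]
        dsimp only
        rw [mul_add Cb]
        linarith
    · rw [Set.indicator_of_notMem (fun hm => hy hm.2)]
      have hφy : φ y = 0 := Set.indicator_of_notMem hy _
      have h1 := hmix x y hy
      rw [hφy, sub_zero]
      refine le_trans ?_ h1
      rw [hφy] at n3
      have := mul_nonneg ht.le n1
      simp only [mul_zero, add_zero, zero_sub]
      linarith
  · rw [Set.indicator_of_notMem (fun hm => hx hm.1)]
    have hφx : φ x = 0 := Set.indicator_of_notMem hx _
    have h1 := hmix y x hx
    rw [hφx]
    -- The integrand is invariant under exchange of `x` and `y`, so the mixed case applies with the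
    -- roles reversed.
    have e1 : (oddPow p (u (y + t • e) - u (x + t • e)) - oddPow p (u y - u x)) * φ y *
      nearKernel a T (y - x) = (oddPow p (u (x + t • e) - u (y + t • e)) - oddPow p (u x - u y)) *
        (0 - φ y) * nearKernel a T (x - y) := by
      rw [oddPow_sub_comm p (u (y + t • e)), oddPow_sub_comm p (u y), ← neg_sub x y]
      unfold nearKernel
      rw [farKernel_neg, norm_neg]
      ring
    rw [← e1]
    refine le_trans ?_ h1
    have := mul_nonneg ht.le n1
    simp only [zero_mul, zero_add, zero_sub]
    linarith

end IncrementBounds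


lemma integrable_convolution_kernel {f g : V → ℝ} (hf : Integrable f) (hg : Integrable g) :
    Integrable (fun z : V × V => f z.2 * g (z.1 - z.2)) (volume.prod volume) :=
  Integrable.convolution_integrand (ContinuousLinearMap.mul ℝ ℝ) hf hg

lemma integral_convolution_kernel {f g : V → ℝ} (hf : Integrable f) (hg : Integrable g) :
    ∫ z : V × V, f z.2 * g (z.1 - z.2) ∂(volume.prod volume) = (∫ y, f y) * ∫ x, g x := by
  rw [integral_prod_symm _ (integrable_convolution_kernel hf hg), ← integral_mul_const]
  congr 1; ext y
  dsimp only
  rw [integral_const_mul, integral_sub_right_eq_self g y]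

lemma aestronglyMeasurable_incrExcess {u : V → ℝ} (hu : AEStronglyMeasurable u) (e : V)
    (t b m : ℝ) : AEStronglyMeasurable (incrExcess u e t b m) := by
  have h1 : AEStronglyMeasurable (fun x => u (x + t • e)) :=
    hu.comp_measurePreserving (measurePreserving_add_right volume (t • e))
  unfold incrExcess
  apply AEMeasurable.aestronglyMeasurable
  exact (((h1.aemeasurable.sub hu.aemeasurable).div_const t).sub
    (measurable_norm.const_mul b).aemeasurable).sub aemeasurable_const

lemma nullMeasurableSet_incrSet {u : V → ℝ} (hu : AEStronglyMeasurable u) (e : V)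
    (t b m : ℝ) : NullMeasurableSet (incrSet u e t b m) :=
  Metric.isOpen_ball.measurableSet.nullMeasurableSet.inter
    (nullMeasurableSet_lt aemeasurable_const (aestronglyMeasurable_incrExcess hu e t b m).aemeasurable)

lemma volume_incrSet_le (u : V → ℝ) (e : V) (t b m : ℝ) :
    volume (incrSet u e t b m) ≤ volume (Metric.ball (0 : V) 1) :=
  measure_mono fun _ h => h.1

lemma volume_incrSet_ne_top (u : V → ℝ) (e : V) (t b m : ℝ) :
    volume (incrSet u e t b m) ≠ ⊤ :=
  ((volume_incrSet_le u e t b m).trans_lt measure_ball_lt_top).ne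

lemma aemeasurable_energyDensity {u w : V → ℝ} (hu : AEStronglyMeasurable u)
    (hw : AEStronglyMeasurable w) (q a : ℝ) :
    AEMeasurable (fun z : V × V => energyDensity u q a w z.1 z.2) (volume.prod volume) := by
  have u1 : AEMeasurable (fun z : V × V => u z.1) (volume.prod volume) := hu.comp_fst.aemeasurable
  have u2 : AEMeasurable (fun z : V × V => u z.2) (volume.prod volume) := hu.comp_snd.aemeasurable
  have w1 : AEMeasurable (fun z : V × V => w z.1) (volume.prod volume) := hw.comp_fst.aemeasurable
  have w2 : AEMeasurable (fun z : V × V => w z.2) (volume.prod volume) := hw.comp_snd.aemeasurable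
  have k : Measurable (fun z : V × V => ‖z.1 - z.2‖ ^ (-a)) := by fun_prop
  unfold energyDensity
  have hd := (u1.sub u2).norm.pow_const q
  simp only [Pi.sub_apply, Real.norm_eq_abs] at hd
  exact (hd.mul k.aemeasurable).mul ((((w1.max aemeasurable_const).sub
    (w2.max aemeasurable_const)).pow_const 2).add
    ((w1.max aemeasurable_const).mul (w2.neg.max aemeasurable_const)))

lemma energyDensity_nonneg (u w : V → ℝ) (q a : ℝ) (x y : V) : 0 ≤ energyDensity u q a w x y := by
  unfold energyDensity; positivity

/-- The constant in the energy estimate. -/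
noncomputable def energyConst (d : ℕ) (p a β Λ C₀ : ℝ) : ℝ :=
  8 * (2 * (3 * C₀ + 8) +
    2 * ((p - 1) * (2 * Λ) ^ (p - 2) * (4 * C₀ + 12) ^ 2 / 2) *
      (∫ w : EuclideanSpace ℝ (Fin d), (Metric.ball (0 : EuclideanSpace ℝ (Fin d)) 16).indicator (fun w => ‖w‖ ^ (p - a)) w) +
    2 * ((p - 1) * (2 * Λ * 2 ^ (1 + β)) ^ (p - 2) * (3 * C₀ + 8) * 2 ^ a) * (3 * C₀ + 8) *
      (∫ y : EuclideanSpace ℝ (Fin d), (1 + ‖y‖) ^ ((1 + β) * (p - 2) + β - a)))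

lemma energyConst_nonneg {p a β Λ C₀ : ℝ} (hp : 2 ≤ p) (hΛ : 0 ≤ Λ) (hC₀ : 0 ≤ C₀) :
    0 ≤ energyConst d p a β Λ C₀ := by
  have hp1 : 0 ≤ p - 1 := by linarith
  have h1 : 0 ≤ ∫ w : V, (Metric.ball (0 : V) 16).indicator (fun w => ‖w‖ ^ (p - a)) w :=
    integral_nonneg fun w => Set.indicator_nonneg (fun _ _ => by positivity) w
  have h2 : 0 ≤ ∫ y : V, (1 + ‖y‖) ^ ((1 + β) * (p - 2) + β - a) :=
    integral_nonneg fun w => by positivity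
  unfold energyConst
  positivity

/-- By Fubini each term factors, as a convolution with `‖w‖^(p-a)` or as a tensor product with a
weight decaying faster than `‖y‖^(-d)`. The results are multiples of `δ² |S|` and of `δ ∫ φ`. -/
lemma integral_energyError [Nontrivial V] {p a β Λ C₀ δ : ℝ} (hpa : a < p + d)
    (hγ : (1 + β) * (p - 2) + β - a < -d) {S : Set V} (hSm : NullMeasurableSet S)
    (hSt : volume S ≠ ⊤) {φ : V → ℝ} (hφi : Integrable φ) :
    Integrable (energyError p a β Λ C₀ δ S φ) (volume.prod volume) ∧
    ∫ z, energyError p a β Λ C₀ δ S φ z ∂(volume.prod volume) =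
      2 * ((p - 1) * (2 * Λ) ^ (p - 2) * ((4 * C₀ + 12) * δ) ^ 2 / 2) * ((volume S).toReal *
        ∫ z : V, (Metric.ball (0 : V) 16).indicator (fun w => ‖w‖ ^ (p - a)) z) +
      2 * ((p - 1) * (2 * Λ * 2 ^ (1 + β)) ^ (p - 2) * (3 * C₀ + 8) * 2 ^ a * δ) *
        ((∫ x, φ x) * ∫ y : V, (1 + ‖y‖) ^ ((1 + β) * (p - 2) + β - a)) := by
  set b := (4 * C₀ + 12) * δ with hb
  have hSi : Integrable (S.indicator (1 : V → ℝ)) :=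
    (integrableOn_const hSt).integrable_indicator₀ hSm
  have hSI : ∫ x, S.indicator (1 : V → ℝ) x = (volume S).toReal := by
    rw [integral_indicator₀ hSm]; simp [Measure.real]
  set g : V → ℝ := (Metric.ball (0 : V) 16).indicator (fun w => ‖w‖ ^ (p - a)) with hg
  have hgi : Integrable g := by
    have := integrable_indicator_rpow_norm (d := d) (r := 16) (c := p - a + d) (by linarith)
    simpa using this
  have hgn : ∀ z, g (-z) = g z := fun z => by
    simp only [hg, Set.indicator, mem_ball_zero_iff, norm_neg]
  set γ := (1 + β) * (p - 2) + β - a with hγd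
  set ρ : V → ℝ := fun y => (1 + ‖y‖) ^ γ with hρ
  have hρi : Integrable ρ := by
    have := integrable_one_add_norm (E := V) (μ := volume) (r := -γ) (by
      rw [finrank_euclideanSpace_fin]; linarith)
    simpa using this
  set Ca := (p - 1) * (2 * Λ) ^ (p - 2) * b ^ 2 / 2 with hCa
  set Cb := (p - 1) * (2 * Λ * 2 ^ (1 + β)) ^ (p - 2) * (3 * C₀ + 8) * 2 ^ a * δ with hCb
  have hF1 := integrable_convolution_kernel hSi hgi
  have hF2 : Integrable (fun z : V × V => φ z.1 * ρ z.2) (volume.prod volume) := hφi.mul_prod hρi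
  have herr : energyError p a β Λ C₀ δ S φ = fun z =>
      Ca * (S.indicator 1 z.2 * g (z.1 - z.2) + S.indicator 1 z.swap.2 * g (z.swap.1 - z.swap.2)) +
      Cb * (φ z.1 * ρ z.2 + φ z.swap.1 * ρ z.swap.2) := by
    ext z
    have e1 : g (z.swap.1 - z.swap.2) = g (z.1 - z.2) := by
      rw [← hgn (z.1 - z.2), neg_sub]; rfl
    rw [e1]
    simp only [energyError, Prod.fst_swap, Prod.snd_swap]
    rw [mul_comm (φ z.2)]
  have hF1s := hF1.swap
  have hF2s := hF2.swap
  have hEi : Integrable (energyError p a β Λ C₀ δ S φ) (volume.prod volume) := by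
    rw [herr]
    exact ((hF1.add hF1s).const_mul Ca).add ((hF2.add hF2s).const_mul Cb)
  refine ⟨hEi, ?_⟩
  have i1 : ∫ z : V × V, S.indicator 1 z.swap.2 * g (z.swap.1 - z.swap.2) ∂(volume.prod volume) =
      (volume S).toReal * ∫ z, g z := by
    rw [integral_prod_swap (fun z : V × V => S.indicator 1 z.2 * g (z.1 - z.2)),
      integral_convolution_kernel hSi hgi, hSI]
  have i2 : ∫ z : V × V, φ z.swap.1 * ρ z.swap.2 ∂(volume.prod volume) =
      (∫ x, φ x) * ∫ y, ρ y := by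
    rw [integral_prod_swap (fun z : V × V => φ z.1 * ρ z.2), integral_prod_mul]
  rw [herr]
  have := integral_add ((hF1.add hF1s).const_mul Ca) ((hF2.add hF2s).const_mul Cb)
  refine this.trans ?_
  rw [integral_const_mul, integral_const_mul]
  have j1 := integral_add hF1 hF1s
  have j2 := integral_add hF2 hF2s
  have k1 : ∫ z : V × V, S.indicator 1 z.2 * g (z.1 - z.2) ∂(volume.prod volume) =
      (volume S).toReal * ∫ z, g z := by
    rw [integral_convolution_kernel hSi hgi, hSI]
  have k2 : ∫ z : V × V, φ z.1 * ρ z.2 ∂(volume.prod volume) =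
      (∫ x, φ x) * ∫ y, ρ y := integral_prod_mul _ _
  simp only [Pi.add_apply, Function.comp_apply] at j1 j2 ⊢
  rw [j1, j2, i1, i2, k1, k2]
  ring

namespace IncrementBounds

variable {p a β Λ C₀ δ T t m : ℝ} {e : EuclideanSpace ℝ (Fin d)}
  {u : EuclideanSpace ℝ (Fin d) → ℝ}

/-- The energy estimate for increments. -/
theorem energy_le [Nontrivial V] (h : IncrementBounds p a β Λ C₀ δ T e u)
    (hsol : LipschitzWeakSolution p a Λ u) (he : ‖e‖ = 1) (hp : 2 ≤ p)
    (ha : 1 ≤ a) (hpa : a < p + d) (hγ : (1 + β) * (p - 2) + β - a < -d)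
    (hT : 32 ≤ T) (hβ : 0 ≤ β) (hC₀ : 0 ≤ C₀) (hδ : 0 < δ)
    (hδ1 : (2 * C₀ + 8) * δ < 1) (ht : 0 < t)
    (ht1 : t ≤ 1) (hm : 1 - δ - (4 * C₀ + 12) * δ / 2 - δ ≤ m) :
    ∫⁻ z in Metric.ball (0 : V) 8 ×ˢ Metric.ball (0 : V) 8,
      ENNReal.ofReal (energyDensity u (p - 2) a (incrExcess u e t ((4 * C₀ + 12) * δ) m) z.1 z.2)
        ∂(volume.prod volume) ≤
    ENNReal.ofReal (energyConst d p a β Λ C₀ * δ ^ 2) *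
      volume (incrSet u e t ((4 * C₀ + 12) * δ) m) := by
  have hΛ := hsol.nonneg
  have hp1 : 0 ≤ p - 1 := by linarith
  have hNF := h.near_form_ge he hp ha hT hΛ hβ hC₀ hδ ht ht1 hm
  have htL := h.test_lipschitz he hΛ hδ hC₀ ht ht1 hm
  have htle := h.test_le hδ hC₀ ht ht1 hm
  have htz : ∀ x, x ∉ incrSet u e t ((4 * C₀ + 12) * δ) m →
      incrTest u e t ((4 * C₀ + 12) * δ) m x = 0 := fun x hx => h.test_eq_zero hδ hC₀ ht ht1 hm hx
  have htn : ∀ x, 0 ≤ incrTest u e t ((4 * C₀ + 12) * δ) m x := test_nonneg _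
  set b := (4 * C₀ + 12) * δ with hb
  have hb0 : 0 ≤ b := by positivity
  set S := incrSet u e t b m with hS
  set φ := incrTest u e t b m with hφ
  set w := incrExcess u e t b m with hw
  have hSm : NullMeasurableSet S := nullMeasurableSet_incrSet hsol.aesm e t b m
  have hSt : volume S ≠ ⊤ := volume_incrSet_ne_top u e t b m
  have hφc : Continuous φ := continuous_of_abs_sub_le htL
  have hSi : Integrable (S.indicator (1 : V → ℝ)) :=
    (integrableOn_const hSt).integrable_indicator₀ hSm
  have hSI : ∫ x, S.indicator (1 : V → ℝ) x = (volume S).toReal := by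
    rw [integral_indicator₀ hSm]; simp [Measure.real]
  have hφS : ∀ x, φ x ≤ (3 * C₀ + 8) * δ * S.indicator (1 : V → ℝ) x := by
    intro x
    by_cases hx : x ∈ S
    · rw [Set.indicator_of_mem hx]; simpa using htle x
    · rw [Set.indicator_of_notMem hx, htz x hx]; simp
  have hφi : Integrable φ := (hSi.const_mul ((3 * C₀ + 8) * δ)).mono' hφc.aestronglyMeasurable
    (Filter.Eventually.of_forall fun x => by
      rw [Real.norm_of_nonneg (htn x)]; exact hφS x)
  -- The test function is itself of order `δ` and lives on `S`, so the errors of order `δ ∫ φ` are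
  -- of order `δ² |S|` as well.
  have hφI : ∫ x, φ x ≤ (3 * C₀ + 8) * δ * (volume S).toReal := by
    rw [← hSI, ← integral_const_mul]
    exact integral_mono hφi (hSi.const_mul _) hφS
  obtain ⟨hDi, hFi, hDI⟩ := hsol.integral_near_form_diff hp (by linarith) hpa
    (by linarith : 8 ≤ T) (v := t • e) (by rw [norm_smul, he, Real.norm_of_nonneg ht.le]; linarith)
    (ψ := φ) (L := 2 * Λ / t + b + (3 * C₀ + 8) * δ) (M := (3 * C₀ + 8) * δ) (by positivity)
    htn htL (fun x => by rw [abs_of_nonneg (htn x)]; exact htle x)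
    (fun x hx => htz x fun hxS => by
      have := hxS.1
      rw [mem_ball_zero_iff] at this; linarith)
  have hDle : ∫ z, (formIntegrand p (nearKernel a T) (fun x => u (x + t • e)) φ z -
      formIntegrand p (nearKernel a T) u φ z) ∂(volume.prod volume) ≤ t * (2 * δ * ∫ x, φ x) := by
    rw [hDI]
    have h1 : ∫ x, φ x * -(δ * t) ≤
        ∫ x, φ x * (farOperator p a T u (x + t • e) - farOperator p a T u x) := by
      refine integral_mono (hφi.mul_const _) hFi fun x => ?_
      by_cases hx : x ∈ S
      · apply mul_le_mul_of_nonneg_left _ (htn x)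
        apply h.far x hx.1 t ht ht1
        have h2 := hx.2
        unfold incrExcess at h2
        have h3 : 0 ≤ b * ‖x‖ := by positivity
        -- The condition `(2C₀ + 8)δ < 1` makes `m` positive. Positive excess then forces `u` to
        -- increase from `x` to `x + te`, as the one-sided far estimate requires.
        have h4 : 0 < (u (x + t • e) - u x) / t := by
          rw [hb] at *
          linarith
        rw [div_pos_iff_of_pos_right ht] at h4
        linarith
      · simp [htz x hx]
    rw [integral_mul_const] at h1
    linarith
  obtain ⟨hEi, hEI⟩ := integral_energyError (Λ := Λ) (C₀ := C₀) (δ := δ) hpa hγ hSm hSt hφi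
  rw [← hb] at hEI
  set G := ∫ z : V, (Metric.ball (0 : V) 16).indicator (fun w => ‖w‖ ^ (p - a)) z with hG
  set R := ∫ y : V, (1 + ‖y‖) ^ ((1 + β) * (p - 2) + β - a) with hR
  set P : V × V → ℝ := fun z => energyDensity u (p - 2) a w z.1 z.2 with hP
  have hPm : AEMeasurable P (volume.prod volume) :=
    aemeasurable_energyDensity hsol.aesm (aestronglyMeasurable_incrExcess hsol.aesm e t b m) _ _
  set B := Metric.ball (0 : V) 8 ×ˢ Metric.ball (0 : V) 8 with hB
  have hBm : MeasurableSet B := Metric.isOpen_ball.measurableSet.prod Metric.isOpen_ball.measurableSet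
  set D : V × V → ℝ := fun z => formIntegrand p (nearKernel a T) (fun x => u (x + t • e)) φ z -
      formIntegrand p (nearKernel a T) u φ z with hD
  have hle : ∀ z, B.indicator P z ≤ 8 * (D z / t + energyError p a β Λ C₀ δ S φ z) := by
    intro z
    have h1 := hNF z
    rw [← le_div_iff₀' ht] at h1
    have h2 : B.indicator P z = 8 * B.indicator
        (fun z => energyDensity u (p - 2) a w z.1 z.2 / 8) z := by
      by_cases hz : z ∈ B
      · rw [Set.indicator_of_mem hz, Set.indicator_of_mem hz]; ring
      · rw [Set.indicator_of_notMem hz, Set.indicator_of_notMem hz]; ring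
    rw [h2]
    simp only [hD]
    linarith
  -- Finiteness of the energy is not known beforehand. It follows from domination by this integrable
  -- right side.
  have hMi := ((hDi.div_const t).add hEi).const_mul 8
  have hPn : ∀ z, 0 ≤ B.indicator P z := fun z =>
    Set.indicator_nonneg (fun z _ => energyDensity_nonneg _ _ _ _ _ _) z
  have hPi : Integrable (B.indicator P) (volume.prod volume) :=
    hMi.mono' (hPm.indicator hBm).aestronglyMeasurable
      (Filter.Eventually.of_forall fun z => by
        rw [Real.norm_of_nonneg (hPn z)]; exact hle z)
  have hPI : ∫ z, B.indicator P z ∂(volume.prod volume) ≤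
      energyConst d p a β Λ C₀ * δ ^ 2 * (volume S).toReal := by
    have h1 := integral_mono hPi hMi hle
    have h2 : ∫ z, 8 * (D z / t + energyError p a β Λ C₀ δ S φ z) ∂(volume.prod volume) =
        8 * ((∫ z, D z ∂(volume.prod volume)) / t +
          ∫ z, energyError p a β Λ C₀ δ S φ z ∂(volume.prod volume)) := by
      rw [integral_const_mul, integral_add (hDi.div_const t) hEi, integral_div]
    have h3 : (∫ z, D z ∂(volume.prod volume)) / t ≤ 2 * δ * ∫ x, φ x := by
      rw [div_le_iff₀' ht]; exact hDle
    have hR0 : 0 ≤ R := integral_nonneg fun w => by positivity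
    have h4 := mul_le_mul_of_nonneg_left hφI (show 0 ≤ 2 * δ by positivity)
    have h5 := mul_le_mul_of_nonneg_left (mul_le_mul_of_nonneg_right hφI hR0)
      (show 0 ≤ 2 * ((p - 1) * (2 * Λ * 2 ^ (1 + β)) ^ (p - 2) * (3 * C₀ + 8) * 2 ^ a * δ) by
        positivity)
    refine h1.trans (h2.le.trans ?_)
    rw [hEI]
    have h6 : energyConst d p a β Λ C₀ * δ ^ 2 * (volume S).toReal =
        8 * (2 * δ * ((3 * C₀ + 8) * δ * (volume S).toReal) +
          (2 * ((p - 1) * (2 * Λ) ^ (p - 2) * b ^ 2 / 2) * ((volume S).toReal * G) +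
            2 * ((p - 1) * (2 * Λ * 2 ^ (1 + β)) ^ (p - 2) * (3 * C₀ + 8) * 2 ^ a * δ) *
              (((3 * C₀ + 8) * δ * (volume S).toReal) * R))) := by
      unfold energyConst
      rw [← hG, ← hR, hb]
      generalize (volume S).toReal = v
      generalize (2 * Λ) ^ (p - 2) = x₁
      generalize (2 * Λ * 2 ^ (1 + β)) ^ (p - 2) = x₂
      generalize (2 : ℝ) ^ a = x₃
      ring
    rw [h6]
    linarith
  have hfin : ∫⁻ z in B, ENNReal.ofReal (P z) ∂(volume.prod volume) =
      ENNReal.ofReal (∫ z, B.indicator P z ∂(volume.prod volume)) := by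
    rw [ofReal_integral_eq_lintegral_ofReal hPi (Filter.Eventually.of_forall hPn),
      ← lintegral_indicator hBm]
    congr 1; ext z
    by_cases hz : z ∈ B
    · rw [Set.indicator_of_mem hz, Set.indicator_of_mem hz]
    · rw [Set.indicator_of_notMem hz, Set.indicator_of_notMem hz]; simp
  rw [hfin]
  refine (ENNReal.ofReal_le_ofReal hPI).trans_eq ?_
  rw [ENNReal.ofReal_mul (mul_nonneg (energyConst_nonneg hp hΛ hC₀) (sq_nonneg δ)),
    ENNReal.ofReal_toReal hSt]

end IncrementBounds


/-! ### Passage from difference quotients to the directional derivative -/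

lemma tendsto_incrExcess {u : V → ℝ} {x : V} (hx : DifferentiableAt ℝ u x) (e : V) (b m : ℝ) :
    Filter.Tendsto (fun n : ℕ => incrExcess u e (1 / ((n : ℝ) + 1)) b m x) Filter.atTop
      (nhds (excess u e b m x)) := by
  have h1 := (hx.hasFDerivAt.hasLineDerivAt e).tendsto_slope_zero
  have h2 : Filter.Tendsto (fun n : ℕ => 1 / ((n : ℝ) + 1)) Filter.atTop (nhdsWithin 0 {0}ᶜ) := by
    rw [tendsto_nhdsWithin_iff]
    refine ⟨tendsto_one_div_add_atTop_nhds_zero_nat, Filter.Eventually.of_forall fun n => ?_⟩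
    simp only [Set.mem_compl_iff, Set.mem_singleton_iff]
    positivity
  have h3 := h1.comp h2
  have h4 : inner ℝ e (gradient u x) = fderiv ℝ u x e := by
    rw [real_inner_comm, gradient, InnerProductSpace.toDual_symm_apply]
  unfold incrExcess excess
  rw [h4]
  refine ((h3.congr fun n => ?_).sub_const _).sub_const _
  simp only [Function.comp_apply, smul_eq_mul]
  rw [inv_mul_eq_div]

/-- The unions of the tails of `S` decrease, with finite measure. Their intersection lies in `A`,
because a point outside `A` leaves the `S n` eventually. -/
lemma liminf_volume_le {S : ℕ → Set V} {A B : Set V} (hS : ∀ n, NullMeasurableSet (S n))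
    (hB : volume B ≠ ⊤) (hSB : ∀ n, S n ⊆ B)
    (hA : ∀ x, x ∉ A → ∀ᶠ n in Filter.atTop, x ∉ S n) :
    Filter.liminf (fun n => volume (S n)) Filter.atTop ≤ volume A := by
  set U : ℕ → Set V := fun N => ⋃ n, ⋃ (_ : N ≤ n), S n with hU
  have hUm : ∀ N, NullMeasurableSet (U N) := fun N =>
    NullMeasurableSet.iUnion fun n => NullMeasurableSet.iUnion fun _ => hS n
  have hanti : Antitone U := by
    intro N M hNM x hx
    simp only [hU, Set.mem_iUnion, exists_prop] at hx ⊢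
    obtain ⟨n, hn, hxn⟩ := hx
    exact ⟨n, hNM.trans hn, hxn⟩
  have h0 : volume (U 0) ≠ ⊤ :=
    ((measure_mono (Set.iUnion_subset fun n => Set.iUnion_subset fun _ => hSB n)).trans_lt
      hB.lt_top).ne
  have ht := tendsto_measure_iInter_atTop hUm hanti ⟨0, h0⟩
  calc _ ≤ Filter.liminf (fun n => volume (U n)) Filter.atTop := by
        refine Filter.liminf_le_liminf (Filter.Eventually.of_forall fun n =>
          measure_mono fun x hx => ?_)
        simp only [hU, Set.mem_iUnion, exists_prop]
        exact ⟨n, le_rfl, hx⟩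
    _ = volume (⋂ n, U n) := ht.liminf_eq
    _ ≤ volume A := by
        apply measure_mono
        intro x hx
        by_contra hxA
        obtain ⟨N, hN⟩ := Filter.eventually_atTop.1 (hA x hxA)
        have := Set.mem_iInter.1 hx N
        simp only [hU, Set.mem_iUnion, exists_prop] at this
        obtain ⟨n, hn, hxn⟩ := this
        exact hN n hn hxn

/-- The energy estimate for the directional derivative. -/
theorem IncrementBounds.energy_gradient_le [Nontrivial V] {p a β Λ C₀ δ T m : ℝ} {e : V}
    {u : V → ℝ} (h : IncrementBounds p a β Λ C₀ δ T e u)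
    (hsol : LipschitzWeakSolution p a Λ u) (he : ‖e‖ = 1)
    (hdiff : ∀ x ∈ Metric.ball (0 : V) 8, DifferentiableAt ℝ u x) (hp : 2 ≤ p)
    (ha : 1 ≤ a) (hpa : a < p + d) (hγ : (1 + β) * (p - 2) + β - a < -d)
    (hT : 32 ≤ T) (hβ : 0 ≤ β) (hC₀ : 0 ≤ C₀) (hδ : 0 < δ)
    (hδ1 : (2 * C₀ + 8) * δ < 1) (hm : 1 - δ - (4 * C₀ + 12) * δ / 2 - δ ≤ m) :
    ∫⁻ x in Metric.ball (0 : V) 8, ∫⁻ y in Metric.ball (0 : V) 8,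
      ENNReal.ofReal (energyDensity u (p - 2) a (excess u e ((4 * C₀ + 12) * δ) m) x y) ≤
    ENNReal.ofReal (energyConst d p a β Λ C₀ * δ ^ 2) *
      volume (excessSet u e ((4 * C₀ + 12) * δ) m) := by
  have htn : ∀ n : ℕ, 0 < 1 / ((n : ℝ) + 1) := fun n => by positivity
  have htn1 : ∀ n : ℕ, 1 / ((n : ℝ) + 1) ≤ 1 := fun n => by
    rw [div_le_one (by positivity)]; linarith [(Nat.cast_nonneg n : (0:ℝ) ≤ n)]
  have hE := fun n : ℕ => h.energy_le hsol he hp ha hpa hγ hT hβ hC₀ hδ hδ1 (htn n) (htn1 n) hm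
  set b := (4 * C₀ + 12) * δ with hb
  set C := ENNReal.ofReal (energyConst d p a β Λ C₀ * δ ^ 2) with hC
  set B := Metric.ball (0 : V) 8 with hB
  have hBm : MeasurableSet B := Metric.isOpen_ball.measurableSet
  have hEm : ∀ {w : V → ℝ}, AEStronglyMeasurable w →
      AEMeasurable (fun z : V × V => ENNReal.ofReal (energyDensity u (p - 2) a w z.1 z.2))
        ((volume.prod volume).restrict (B ×ˢ B)) := fun hw =>
    (aemeasurable_energyDensity hsol.aesm hw _ _).ennreal_ofReal.restrict
  have hiter : ∫⁻ x in B, ∫⁻ y in B,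
      ENNReal.ofReal (energyDensity u (p - 2) a (excess u e b m) x y) =
      ∫⁻ z in B ×ˢ B, ENNReal.ofReal (energyDensity u (p - 2) a (excess u e b m) z.1 z.2)
        ∂(volume.prod volume) := by
    rw [setLIntegral_prod _ (hEm (measurable_excess u e b m).aestronglyMeasurable)]
  rw [hiter]
  have hlim : ∀ x ∈ B, Filter.Tendsto (fun n : ℕ => incrExcess u e (1 / ((n : ℝ) + 1)) b m x)
      Filter.atTop (nhds (excess u e b m x)) := fun x hx =>
    tendsto_incrExcess (hdiff x hx) e b m
  -- Fatou's lemma applies since the densities converge pointwise on `B × B`. The bounds for the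
  -- difference quotients have a constant independent of the step.
  calc _ ≤ ∫⁻ z in B ×ˢ B, Filter.liminf (fun n : ℕ => ENNReal.ofReal
          (energyDensity u (p - 2) a (incrExcess u e (1 / ((n : ℝ) + 1)) b m) z.1 z.2))
          Filter.atTop ∂(volume.prod volume) := by
        refine setLIntegral_mono' (hBm.prod hBm) fun z hz => ?_
        have h1 := hlim z.1 hz.1
        have h2 := hlim z.2 hz.2
        have h3 : Filter.Tendsto (fun n : ℕ => energyDensity u (p - 2) a
            (incrExcess u e (1 / ((n : ℝ) + 1)) b m) z.1 z.2) Filter.atTop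
            (nhds (energyDensity u (p - 2) a (excess u e b m) z.1 z.2)) := by
          unfold energyDensity
          exact ((((h1.max tendsto_const_nhds).sub (h2.max tendsto_const_nhds)).pow 2).add
            ((h1.max tendsto_const_nhds).mul (h2.neg.max tendsto_const_nhds))).const_mul _
        exact (ENNReal.tendsto_ofReal h3).liminf_eq.ge
    _ ≤ Filter.liminf (fun n : ℕ => ∫⁻ z in B ×ˢ B, ENNReal.ofReal
          (energyDensity u (p - 2) a (incrExcess u e (1 / ((n : ℝ) + 1)) b m) z.1 z.2)
          ∂(volume.prod volume)) Filter.atTop :=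
        lintegral_liminf_le' fun n => hEm (aestronglyMeasurable_incrExcess hsol.aesm e _ b m)
    _ ≤ Filter.liminf (fun n : ℕ => C * volume (incrSet u e (1 / ((n : ℝ) + 1)) b m))
          Filter.atTop :=
        Filter.liminf_le_liminf (Filter.Eventually.of_forall hE)
    _ = C * Filter.liminf (fun n : ℕ => volume (incrSet u e (1 / ((n : ℝ) + 1)) b m))
          Filter.atTop := ENNReal.liminf_const_mul_of_ne_top ENNReal.ofReal_ne_top
    _ ≤ C * volume (excessSet u e b m) := by
        gcongr
        -- In `B_1` off `excessSet` the limiting excess is strictly negative, so the quotients are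
        -- eventually negative too. This is why `excessSet` uses a non-strict inequality.
        refine liminf_volume_le (fun n => nullMeasurableSet_incrSet hsol.aesm e _ b m)
          (measure_ball_lt_top (x := (0 : V)) (r := 1)).ne (fun n x hx => hx.1) fun x hx => ?_
        by_cases hx1 : x ∈ Metric.ball (0 : V) 1
        · have hneg : excess u e b m x < 0 := by
            by_contra! hge
            exact hx ⟨hx1, hge⟩
          have := (hlim x (Metric.ball_subset_ball (by norm_num) hx1)).eventually_lt_const hneg
          filter_upwards [this] with n hn hmem
          exact absurd hmem.2 (not_lt.2 hn.le)
        · exact Filter.Eventually.of_forall fun n hmem => hx1 hmem.1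

end Energy

/-! ### Growth of `u` and `∇u` from the dyadic gradient bounds -/

section Growth

variable {d : ℕ}

local notation "V" => EuclideanSpace ℝ (Fin d)

/-- Geometric growth along dyadic scales with ratio close to one is a small multiple of a
small power. -/
lemma exists_zpow_neg_le {β : ℝ} (hβ : 0 < β) : ∃ C > 0, ∃ δ₀ > 0, δ₀ ≤ 1 / 2 ∧
    ∀ δ, 0 < δ → δ ≤ δ₀ → ∀ (n : ℕ) (Y : ℝ), 2 ^ n ≤ 2 * Y →
      (1 - δ) ^ (-(n : ℤ)) ≤ 1 + C * δ * Y ^ β := by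
  have hl : 0 < Real.log 2 := Real.log_pos (by norm_num)
  -- The exponent is halved because two factors `exp(nc)` appear, one absorbing `n` and one
  -- absorbing the geometric growth. Their product is `2^(nβ)`.
  set c := β * Real.log 2 / 2 with hc
  have hc0 : 0 < c := by positivity
  refine ⟨2 / c * 2 ^ β, by positivity, min (1 / 2) (c / 2), by positivity, min_le_left _ _, ?_⟩
  intro δ hδ hδ0 n Y hY
  have hδ1 : δ ≤ 1 / 2 := hδ0.trans (min_le_left _ _)
  have hδ2 : 2 * δ ≤ c := by linarith [hδ0.trans (min_le_right _ _)]
  have hpos : 0 < 1 - δ := by linarith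
  have hY0 : 0 < Y := by linarith [show (0 : ℝ) < 2 ^ n by positivity]
  have hlog : -Real.log (1 - δ) ≤ 2 * δ := by
    have h1 := Real.one_sub_inv_le_log_of_pos hpos
    have h2 : (1 - δ)⁻¹ ≤ 1 + 2 * δ := by
      rw [inv_le_iff_one_le_mul₀ hpos]; nlinarith
    linarith
  have e1 : (1 - δ) ^ (-(n : ℤ)) = Real.exp (n * -Real.log (1 - δ)) := by
    rw [← Real.rpow_intCast, Real.rpow_def_of_pos hpos]
    congr 1; push_cast; ring
  have hn : (0 : ℝ) ≤ n := Nat.cast_nonneg n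
  have h2 : (n : ℝ) * -Real.log (1 - δ) ≤ n * (2 * δ) := by gcongr
  -- The bound `exp x ≤ 1 + x exp x` pulls out the factor `δ`, so the deviation from 1 is linear in
  -- `δ`.
  have h3 : Real.exp (n * (2 * δ)) ≤ 1 + n * (2 * δ) * Real.exp (n * (2 * δ)) := by
    have h := Real.add_one_le_exp (-(n * (2 * δ)))
    have h' := mul_le_mul_of_nonneg_right h (Real.exp_pos (n * (2 * δ))).le
    rw [← Real.exp_add, neg_add_cancel, Real.exp_zero] at h'
    linarith
  have h4 : Real.exp (n * (2 * δ)) ≤ Real.exp (n * c) := by gcongr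
  have h5 : (n : ℝ) * c ≤ Real.exp (n * c) := by linarith [Real.add_one_le_exp (n * c)]
  have h6 : Real.exp (n * c) * Real.exp (n * c) = ((2 : ℝ) ^ n) ^ β := by
    rw [← Real.exp_add, ← Real.rpow_natCast, ← Real.rpow_mul (by norm_num),
      Real.rpow_def_of_pos (by norm_num), hc]
    congr 1; ring
  have h7 : ((2 : ℝ) ^ n) ^ β ≤ 2 ^ β * Y ^ β := by
    rw [← Real.mul_rpow (by norm_num) hY0.le]
    exact Real.rpow_le_rpow (by positivity) hY hβ.le
  have h8 : (n : ℝ) ≤ Real.exp (n * c) / c := by rwa [le_div_iff₀ hc0]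
  rw [e1]
  calc _ ≤ Real.exp (n * (2 * δ)) := by gcongr
    _ ≤ 1 + n * (2 * δ) * Real.exp (n * (2 * δ)) := h3
    _ ≤ 1 + Real.exp (n * c) / c * (2 * δ) * Real.exp (n * c) := by gcongr
    _ = 1 + 2 / c * δ * (Real.exp (n * c) * Real.exp (n * c)) := by ring
    _ ≤ 1 + 2 / c * δ * (2 ^ β * Y ^ β) := by rw [h6]; gcongr
    _ = _ := by ring

/-- By continuity the set where the bound fails is open, and an open null set is empty. -/
lemma norm_le_of_eLpNorm_top_le {F : Type*} [NormedAddCommGroup F] {f : V → F} {U : Set V}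
    (hU : IsOpen U) (hf : ContinuousOn f U) {c : ℝ} (hc : 0 ≤ c)
    (h : eLpNorm f ⊤ (volume.restrict U) ≤ ENNReal.ofReal c) : ∀ x ∈ U, ‖f x‖ ≤ c := by
  rw [eLpNorm_exponent_top] at h
  have h1 : ∀ᵐ x ∂(volume.restrict U), ‖f x‖ ≤ c := by
    filter_upwards [ae_le_eLpNormEssSup (f := f) (μ := volume.restrict U)] with x hx
    have := hx.trans h
    rwa [← ofReal_norm, ENNReal.ofReal_le_ofReal_iff hc] at this
  have hW : IsOpen (U ∩ (fun x => ‖f x‖) ⁻¹' Set.Ioi c) :=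
    hf.norm.isOpen_inter_preimage hU isOpen_Ioi
  have h2 : volume (U ∩ (fun x => ‖f x‖) ⁻¹' Set.Ioi c) = 0 := by
    rw [ae_restrict_iff' hU.measurableSet] at h1
    refine measure_mono_null (fun x hx => ?_) h1
    simp only [Set.mem_compl_iff, Set.mem_ofPred_eq, not_forall]
    exact ⟨hx.1, not_le.2 hx.2⟩
  have h3 := hW.measure_eq_zero_iff (μ := volume) |>.1 h2
  intro x hx
  by_contra! hlt
  have : x ∈ U ∩ (fun x => ‖f x‖) ⁻¹' Set.Ioi c := ⟨hx, hlt⟩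
  rw [h3] at this
  exact this

lemma continuousOn_gradient {u : V → ℝ} {U : Set V} (hU : IsOpen U) (hu : ContDiffOn ℝ 1 u U) :
    ContinuousOn (gradient u) U :=
  (InnerProductSpace.toDual ℝ V).symm.continuous.comp_continuousOn
    (hu.continuousOn_fderiv_of_isOpen hU le_rfl)

lemma exists_dyadic_scale {x : ℝ} {K : ℕ} (hx : x < 2 ^ K) (hx0 : 0 ≤ x) :
    ∃ n ≤ K, x < 2 ^ n ∧ (2 : ℝ) ^ n ≤ 2 * (1 + x) := by
  classical
  have hex : ∃ n : ℕ, x < 2 ^ n := ⟨K, hx⟩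
  refine ⟨Nat.find hex, Nat.find_min' hex hx, Nat.find_spec hex, ?_⟩
  -- Minimality of the scale gives `2^(n-1) ≤ x`. At `n = 0` the additional 1 in `1 + x` is what is
  -- needed.
  rcases hn : Nat.find hex with _ | k
  · simp; linarith
  · have := Nat.find_min hex (m := k) (by omega)
    push Not at this
    rw [pow_succ]; linarith

/-- Sublinear growth bounds for the gradient. -/
structure GradientGrowth (β C δ N : ℝ) (u : V → ℝ) : Prop where
  diff : ∀ y ∈ Metric.ball (0 : V) N, DifferentiableAt ℝ u y
  grad_le : ∀ y ∈ Metric.ball (0 : V) N, ‖gradient u y‖ ≤ 1 + C * δ * (1 + ‖y‖) ^ β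

namespace GradientGrowth

variable {p a β C δ N : ℝ} {u : EuclideanSpace ℝ (Fin d) → ℝ} {e : EuclideanSpace ℝ (Fin d)}

lemma grad_le_of_norm_le (h : GradientGrowth β C δ N u) (hβ : 0 ≤ β) (hC : 0 ≤ C * δ)
    {y : V} (hy : ‖y‖ < N) {Y : ℝ} (hyY : 1 + ‖y‖ ≤ Y) :
    ‖gradient u y‖ ≤ 1 + C * δ * Y ^ β := by
  refine (h.grad_le y (by simpa using hy)).trans ?_
  gcongr

lemma grad_le_two_mul (h : GradientGrowth β C δ N u) (hβ : 0 ≤ β) (hC : 0 ≤ C * δ)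
    (hC1 : C * δ ≤ 1) {y : V} (hy : ‖y‖ < N) {Y : ℝ} (hyY : 1 + ‖y‖ ≤ Y) :
    ‖gradient u y‖ ≤ 2 * Y ^ β := by
  have h1 := h.grad_le_of_norm_le hβ hC hy hyY
  have hY : 1 ≤ Y := by linarith [norm_nonneg y]
  have h2 : 1 ≤ Y ^ β := Real.one_le_rpow hY hβ
  nlinarith

lemma abs_sub_le (h : GradientGrowth β C δ N u) (hβ : 0 ≤ β) (hC : 0 ≤ C * δ)
    (hC1 : C * δ ≤ 1) {R : ℝ} (hR : R ≤ N) {x y : V} (hx : ‖x‖ < R) (hy : ‖y‖ < R) :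
    |u x - u y| ≤ 2 * (1 + R) ^ β * ‖x - y‖ := by
  refine abs_sub_le_of_norm_gradient_le (B := Metric.ball (0 : V) R)
    (fun z hz => h.diff z (Metric.ball_subset_ball hR hz)) (fun z hz => ?_) (convex_ball _ _)
    (by simpa using hy) (by simpa using hx)
  rw [mem_ball_zero_iff] at hz
  exact h.grad_le_two_mul hβ hC hC1 (hz.trans_le hR) (by linarith)

lemma abs_le (h : GradientGrowth β C δ N u) (hβ : 0 ≤ β) (hC : 0 ≤ C * δ)
    (hC1 : C * δ ≤ 1) (hu0 : u 0 = 0) {y : V} (hy : ‖y‖ < N) :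
    |u y| ≤ 2 * (1 + ‖y‖) ^ (1 + β) := by
  have h1 := abs_sub_le_of_norm_gradient_le (u := u) (B := Metric.closedBall (0 : V) ‖y‖)
    (L := 2 * (1 + ‖y‖) ^ β) (fun z hz => h.diff z (by
      rw [mem_closedBall_zero_iff] at hz
      rw [mem_ball_zero_iff]; exact hz.trans_lt hy)) (fun z hz => by
      rw [mem_closedBall_zero_iff] at hz
      exact h.grad_le_two_mul hβ hC hC1 (hz.trans_lt hy) (by linarith)) (convex_closedBall _ _)
      (x := 0) (y := y) (by simp) (by simp)
  rw [hu0, sub_zero, sub_zero] at h1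
  have hY : 0 < 1 + ‖y‖ := by positivity
  rw [Real.rpow_add hY, Real.rpow_one]
  refine h1.trans ?_
  have : 0 ≤ (1 + ‖y‖) ^ β := by positivity
  nlinarith

lemma increment_le (h : GradientGrowth β C δ N u) (hβ : 0 ≤ β) (hC : 0 ≤ C * δ)
    (he : ‖e‖ = 1) {y : V} (hy : ‖y‖ + 2 ≤ N) {t : ℝ} (ht : 0 < t) (ht1 : t ≤ 1) :
    u (y + t • e) - u y ≤ t * (1 + C * 3 ^ β * δ * (1 + ‖y‖) ^ β) := by
  have hb : ∀ z ∈ Metric.ball y 2, ‖z‖ < ‖y‖ + 2 := fun z hz => by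
    rw [mem_ball_iff_norm] at hz
    linarith [norm_sub_norm_le z y]
  refine (sub_le_of_inner_gradient_le (B := Metric.ball y 2)
    (fun z hz => h.diff z (by
      rw [mem_ball_zero_iff]; exact (hb z hz).trans_le hy)) (fun z hz => ?_) (convex_ball _ _)
    (by simp) (by
      rw [mem_ball_iff_norm, add_sub_cancel_left, norm_smul, he, Real.norm_of_nonneg ht.le]
      linarith) ht.le).trans_eq (mul_comm _ _)
  have h1 := h.grad_le_of_norm_le hβ hC ((hb z hz).trans_le hy) (Y := 3 * (1 + ‖y‖))
    (by linarith [hb z hz, norm_nonneg y])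
  have h2 : inner ℝ e (gradient u z) ≤ ‖gradient u z‖ := by
    have := real_inner_le_norm e (gradient u z)
    rwa [he, one_mul] at this
  rw [Real.mul_rpow (by norm_num) (by positivity)] at h1
  refine h2.trans (h1.trans_eq ?_)
  ring

/-- The increment bounds follow from the growth of the gradient and the far field estimate. -/
theorem incrementBounds (h : GradientGrowth β C δ N u) (hβ : 0 ≤ β) (hC : 0 ≤ C)
    (hδ : 0 < δ) (hC1 : C * δ ≤ 1) (he : ‖e‖ = 1) (hN : 128 ≤ N)
    (far : ∀ x ∈ Metric.ball (0 : V) 1, ∀ t, 0 < t → t ≤ 1 → u x ≤ u (x + t • e) →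
      -(δ * t) ≤ farOperator p a (N / 4) u (x + t • e) - farOperator p a (N / 4) u x) :
    IncrementBounds p a β (8 * 10 ^ β) (C * 27 ^ β) δ (N / 4) e u where
  lip := by
    intro x hx y hy
    rw [mem_ball_zero_iff] at hx hy
    refine (h.abs_sub_le hβ (by positivity) hC1 (by linarith) hx hy).trans ?_
    rw [show (1 : ℝ) + 9 = 10 by norm_num]
    have : (0 : ℝ) ≤ 10 ^ β := by positivity
    gcongr
    norm_num
  lip_far := by
    intro x hx y hy
    rw [mem_ball_zero_iff] at hx hy
    refine (h.abs_sub_le hβ (by positivity) hC1 (R := 2 + ‖y‖) (by linarith)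
      (by linarith [norm_nonneg y]) (by linarith)).trans ?_
    have hY : 0 < 1 + ‖y‖ := by positivity
    have h1 : (1 + (2 + ‖y‖)) ^ β ≤ 10 ^ β * (1 + ‖y‖) ^ β := by
      rw [← Real.mul_rpow (by norm_num) hY.le]
      exact Real.rpow_le_rpow (by positivity) (by linarith [norm_nonneg y]) hβ
    have h2 : ‖x - y‖ ≤ 2 * (1 + ‖y‖) := (norm_sub_le x y).trans (by linarith [norm_nonneg y])
    rw [Real.rpow_add hY, Real.rpow_one]
    calc _ ≤ 2 * (10 ^ β * (1 + ‖y‖) ^ β) * (2 * (1 + ‖y‖)) := by gcongr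
      _ ≤ _ := by
        have : 0 ≤ 10 ^ β * ((1 + ‖y‖) * (1 + ‖y‖) ^ β) := by positivity
        linarith
  incr := by
    intro y hy t ht ht1
    rw [mem_ball_zero_iff] at hy
    refine (h.increment_le hβ (by positivity) he (by linarith) ht ht1).trans ?_
    -- The factor 3 pays for the neighbourhood of radius 2 around `y`, and 9 bounds `1 + ‖y‖` in
    -- `B_8`.
    have h1 : (27 : ℝ) ^ β = 3 ^ β * 9 ^ β := by
      rw [← Real.mul_rpow (by norm_num) (by norm_num)]; norm_num
    have h2 : (1 + ‖y‖) ^ β ≤ 9 ^ β := Real.rpow_le_rpow (by positivity) (by linarith) hβ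
    rw [h1]
    calc _ ≤ t * (1 + C * 3 ^ β * δ * 9 ^ β) := by gcongr
      _ = _ := by ring
  incr_far := by
    intro y hy t ht ht1
    rw [mem_ball_zero_iff] at hy
    refine (h.increment_le hβ (by positivity) he (by linarith) ht ht1).trans ?_
    gcongr
    norm_num
  far := far

end GradientGrowth

end Growth

/-! ### Smallness of the far field and reduction to the standing hypotheses -/

section Assembly

variable {d : ℕ}

local notation "V" => EuclideanSpace ℝ (Fin d)

/-- The weight of the far field is integrable and small. -/
lemma integral_far_weight_le {p a σ β T N κ : ℝ} {u : V → ℝ} (hp : 2 ≤ p) (hσ : 0 < σ)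
    (hβ : β * (p - 1) = σ) (ha : a = d + 2 * σ + (p - 2)) (hT : 1 ≤ T) (hκ : 0 ≤ κ) (hN : 0 < N)
    (hu : AEStronglyMeasurable u) (hW : Integrable (tailWeight p a u))
    (hgrow : ∀ y, ‖y‖ < N → |u y| ≤ 2 * (1 + ‖y‖) ^ (1 + β))
    (htail : ∫⁻ y in (Metric.ball (0 : V) N)ᶜ,
      ENNReal.ofReal (|u y| ^ (p - 1) / ‖0 - y‖ ^ (a + 1)) ≤ ENNReal.ofReal κ) :
    Integrable (fun y => (1 + |u y| ^ (p - 1)) * (T + ‖y‖) ^ (-a - 1)) ∧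
    ∫ y, (1 + |u y| ^ (p - 1)) * (T + ‖y‖) ^ (-a - 1) ≤
      2 ^ p * T ^ (-(σ / 2)) * (∫ y : V, (1 + ‖y‖) ^ (-(d + σ / 2))) + κ := by
  have hp1 : 0 ≤ p - 1 := by linarith
  have hd : (0 : ℝ) ≤ d := Nat.cast_nonneg d
  set f : V → ℝ := fun y => (1 + |u y| ^ (p - 1)) * (T + ‖y‖) ^ (-a - 1) with hf
  have hT0 : ∀ y : V, 0 < T + ‖y‖ := fun y => by positivity
  have hfn : ∀ y, 0 ≤ f y := fun y => by
    have := hT0 y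
    simp only [hf]; positivity
  have hum : AEMeasurable (fun y => |u y| ^ (p - 1)) := by
    have := hu.aemeasurable.norm.pow_const (p - 1)
    simpa only [Real.norm_eq_abs] using this
  have hfm : AEStronglyMeasurable f := by
    have h2 : Measurable fun y : V => (T + ‖y‖) ^ (-a - 1) := by fun_prop
    exact ((aemeasurable_const.add hum).mul h2.aemeasurable).aestronglyMeasurable
  have hfi : Integrable f := by
    refine hW.mono' hfm (Filter.Eventually.of_forall fun y => ?_)
    rw [Real.norm_of_nonneg (hfn y)]
    simp only [hf, tailWeight]
    have h1 : (T + ‖y‖) ^ (-a - 1) ≤ (1 + ‖y‖) ^ (-a) :=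
      (Real.rpow_le_rpow_of_nonpos (by positivity) (by linarith) (by linarith)).trans
        (Real.rpow_le_rpow_of_exponent_le (by linarith [norm_nonneg y]) (by linarith))
    gcongr
  refine ⟨hfi, ?_⟩
  set g : V → ℝ := fun y => 2 ^ p * T ^ (-(σ / 2)) * (1 + ‖y‖) ^ (-(d + σ / 2)) with hg
  set h : V → ℝ := (Metric.ball (0 : V) N)ᶜ.indicator
    (fun y => |u y| ^ (p - 1) / ‖0 - y‖ ^ (a + 1)) with hh
  have hgi : Integrable g := by
    refine (integrable_one_add_norm ?_).const_mul _
    rw [finrank_euclideanSpace_fin]; linarith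
  have hgn : ∀ y, 0 ≤ g y := fun y => by simp only [hg]; positivity
  have hhn : ∀ y, 0 ≤ h y := fun y => Set.indicator_nonneg (fun y _ => by positivity) y
  have hbase : ∀ y : V, (1 + ‖y‖) ^ (p - 1 + σ) * (T + ‖y‖) ^ (-a - 1) ≤
      T ^ (-(σ / 2)) * (1 + ‖y‖) ^ (-(d + σ / 2)) := by
    intro y
    have hY : 0 < 1 + ‖y‖ := by positivity
    -- Against growth of order `p - 1 + σ` the weight has spare decay `σ` beyond integrability. Half
    -- becomes the small factor `T^(-σ/2)` and the other half keeps the remaining integral finite.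
    have e1 : (T + ‖y‖) ^ (-a - 1) =
        (T + ‖y‖) ^ (-(σ / 2)) * (T + ‖y‖) ^ (-(d + 3 * σ / 2 + (p - 1))) := by
      rw [← Real.rpow_add (hT0 y)]; congr 1; rw [ha]; ring
    have h1 : (T + ‖y‖) ^ (-(σ / 2)) ≤ T ^ (-(σ / 2)) :=
      Real.rpow_le_rpow_of_nonpos (by linarith) (by linarith [norm_nonneg y]) (by linarith)
    have h2 : (T + ‖y‖) ^ (-(d + 3 * σ / 2 + (p - 1))) ≤
        (1 + ‖y‖) ^ (-(d + 3 * σ / 2 + (p - 1))) :=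
      Real.rpow_le_rpow_of_nonpos hY (by linarith) (by linarith)
    have h3 : (1 + ‖y‖) ^ (p - 1 + σ) * (1 + ‖y‖) ^ (-(d + 3 * σ / 2 + (p - 1))) =
        (1 + ‖y‖) ^ (-(d + σ / 2)) := by
      rw [← Real.rpow_add hY]; congr 1; ring
    have := hT0 y
    calc _ ≤ (1 + ‖y‖) ^ (p - 1 + σ) *
          (T ^ (-(σ / 2)) * (1 + ‖y‖) ^ (-(d + 3 * σ / 2 + (p - 1)))) := by
          rw [e1]; gcongr
      _ = T ^ (-(σ / 2)) * ((1 + ‖y‖) ^ (p - 1 + σ) *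
          (1 + ‖y‖) ^ (-(d + 3 * σ / 2 + (p - 1)))) := by ring
      _ = _ := by rw [h3]
  have hle : ∀ y, f y ≤ g y + h y := by
    intro y
    have hY1 : 1 ≤ 1 + ‖y‖ := by linarith [norm_nonneg y]
    have hY : 0 < 1 + ‖y‖ := by positivity
    have hone : 1 ≤ (1 + ‖y‖) ^ (p - 1 + σ) := Real.one_le_rpow hY1 (by linarith)
    have hk : 0 ≤ (T + ‖y‖) ^ (-a - 1) := by have := hT0 y; positivity
    have e2 : (2 : ℝ) ^ p = 2 * 2 ^ (p - 1) := by
      rw [← Real.rpow_one_add' (by norm_num) (by linarith)]; congr 1; ring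
    have h2p : (1 : ℝ) ≤ 2 ^ (p - 1) := Real.one_le_rpow (by norm_num) hp1
    -- Inside `B_N` the growth of `u` is used. Outside, the constant 1 is absorbed by `g` and the
    -- part containing `u` by the tail.
    by_cases hy : y ∈ Metric.ball (0 : V) N
    · have h0 : h y = 0 := Set.indicator_of_notMem (Set.notMem_compl_iff.2 hy) _
      have h1 : |u y| ^ (p - 1) ≤ 2 ^ (p - 1) * (1 + ‖y‖) ^ (p - 1 + σ) := by
        have := Real.rpow_le_rpow (abs_nonneg _) (hgrow y (by simpa using hy)) hp1
        rw [Real.mul_rpow (by norm_num) (by positivity), ← Real.rpow_mul hY.le] at this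
        refine this.trans_eq ?_
        rw [← hβ]; congr 2; ring
      have h2 : 1 + |u y| ^ (p - 1) ≤ 2 ^ p * (1 + ‖y‖) ^ (p - 1 + σ) := by
        rw [e2]; nlinarith
      rw [h0, add_zero]
      calc f y ≤ 2 ^ p * (1 + ‖y‖) ^ (p - 1 + σ) * (T + ‖y‖) ^ (-a - 1) := by
            simp only [hf]; gcongr
        _ = 2 ^ p * ((1 + ‖y‖) ^ (p - 1 + σ) * (T + ‖y‖) ^ (-a - 1)) := by ring
        _ ≤ 2 ^ p * (T ^ (-(σ / 2)) * (1 + ‖y‖) ^ (-(d + σ / 2))) :=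
            mul_le_mul_of_nonneg_left (hbase y) (by positivity)
        _ = g y := by simp only [hg]; ring
    · have h0 : h y = |u y| ^ (p - 1) / ‖0 - y‖ ^ (a + 1) := Set.indicator_of_mem hy _
      have hyN : N ≤ ‖y‖ := by simpa using hy
      have hy0 : 0 < ‖y‖ := hN.trans_le hyN
      rw [h0, zero_sub, norm_neg, div_eq_mul_inv, ← Real.rpow_neg hy0.le]
      have h1 : (T + ‖y‖) ^ (-a - 1) ≤ ‖y‖ ^ (-(a + 1)) := by
        rw [show -a - 1 = -(a + 1) by ring]
        exact Real.rpow_le_rpow_of_nonpos hy0 (by linarith) (by linarith)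
      have h2 : 1 * (T + ‖y‖) ^ (-a - 1) ≤ g y := by
        have h3 : 1 * (T + ‖y‖) ^ (-a - 1) ≤ (1 + ‖y‖) ^ (p - 1 + σ) * (T + ‖y‖) ^ (-a - 1) := by
          gcongr
        have h4 : T ^ (-(σ / 2)) * (1 + ‖y‖) ^ (-(d + σ / 2)) ≤ g y := by
          have h5 : 0 ≤ T ^ (-(σ / 2)) * (1 + ‖y‖) ^ (-(d + σ / 2)) := by positivity
          simp only [hg]
          rw [mul_assoc]
          nlinarith
        exact h3.trans ((hbase y).trans h4)
      simp only [hf]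
      rw [add_mul]
      gcongr
  have hgh : ∫⁻ y, ENNReal.ofReal (f y) ≤
      ENNReal.ofReal ((∫ y, g y) + κ) := by
    calc _ ≤ ∫⁻ y, (ENNReal.ofReal (g y) + ENNReal.ofReal (h y)) := by
          apply lintegral_mono
          intro y
          exact (ENNReal.ofReal_le_ofReal (hle y)).trans ENNReal.ofReal_add_le
      _ = (∫⁻ y, ENNReal.ofReal (g y)) + ∫⁻ y, ENNReal.ofReal (h y) :=
          lintegral_add_left' hgi.aemeasurable.ennreal_ofReal _
      _ ≤ ENNReal.ofReal (∫ y, g y) + ENNReal.ofReal κ := by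
          gcongr
          · rw [ofReal_integral_eq_lintegral_ofReal hgi (Filter.Eventually.of_forall hgn)]
          · refine le_trans (le_of_eq ?_) htail
            rw [← lintegral_indicator Metric.isOpen_ball.measurableSet.compl]
            congr 1; ext y
            by_cases hy : y ∈ (Metric.ball (0 : V) N)ᶜ
            · rw [hh, Set.indicator_of_mem hy, Set.indicator_of_mem hy]
            · rw [hh, Set.indicator_of_notMem hy, Set.indicator_of_notMem hy]; simp
      _ = _ := (ENNReal.ofReal_add (integral_nonneg hgn) hκ).symm
  rw [← ofReal_integral_eq_lintegral_ofReal hfi (Filter.Eventually.of_forall hfn),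
    ENNReal.ofReal_le_ofReal_iff (add_nonneg (integral_nonneg hgn) hκ)] at hgh
  refine hgh.trans_eq ?_
  simp only [hg]
  rw [integral_const_mul]

lemma IsWeakSolution.lipschitzWeakSolution {s p Λ : ℝ} {Ω : Set V} {u : V → ℝ} (hsp : 0 < s * p)
    (h : IsWeakSolution s p Ω u) (hΩ : Metric.ball (0 : V) 4 ⊆ Ω)
    (hlip : ∀ x ∈ Metric.ball (0 : V) 4, ∀ y ∈ Metric.ball (0 : V) 4, |u x - u y| ≤ Λ * ‖x - y‖)
    (hb : ∀ x ∈ Metric.ball (0 : V) 4, |u x| ≤ Λ) :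
    LipschitzWeakSolution p (d + s * p) Λ u where
  aesm := h.1.2.1.aestronglyMeasurable
  integrable_weight := integrable_tailWeight hsp h.1.2.1
  lipschitz := hlip
  bounded := hb
  weak := by
    rintro φ ⟨h1, h2, h3, h4⟩
    have ht : IsNonnegTest Ω φ := ⟨h1, h2, h3.trans hΩ, h4⟩
    rw [← fracPLapForm_eq]
    exact le_antisymm (h.1.2.2 φ ht) (h.2.2.2 φ ht)

lemma exists_pow_rpow_neg_le {σ C δ : ℝ} (hσ : 0 < σ) (hδ : 0 < δ) :
    ∃ K : ℕ, 7 ≤ K ∧ C * ((2 : ℝ) ^ K / 4) ^ (-σ) ≤ δ := by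
  have h1 : Filter.Tendsto (fun K : ℕ => (2 : ℝ) ^ K / 4) Filter.atTop Filter.atTop :=
    (tendsto_pow_atTop_atTop_of_one_lt (by norm_num)).atTop_div_const (by norm_num)
  have h2 := ((tendsto_rpow_neg_atTop hσ).comp h1).const_mul C
  rw [mul_zero] at h2
  obtain ⟨K, hK, hK7⟩ := ((h2.eventually_le_const hδ).and
    (Filter.eventually_ge_atTop 7)).exists
  exact ⟨K, hK7, hK⟩

end Assembly

/-! ### The main theorem and the choice of constants -/

theorem lemma4p1 (d : ℕ) (s p : ℝ) (hs0 : 0 < s) (hs1 : s < 1)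
    (hp2 : 2 ≤ p) (hp : p < 2 / (1 - s)) (r μ : ℝ) (hr : 0 < r) (hμ : 0 < μ) :
    ∃ (δ ε₁ : ℝ) (K₀ : ℕ), 0 < δ ∧ δ < 1 ∧ 0 < ε₁ ∧ 0 < K₀ ∧
      ∀ (e : EuclideanSpace ℝ (Fin d)) (u : EuclideanSpace ℝ (Fin d) → ℝ),
        ‖e‖ = 1 →
        ContDiffOn ℝ 1 u (Metric.ball 0 ((2 : ℝ) ^ (K₀ + 1))) →
        IsWeakSolution s p (Metric.ball 0 ((2 : ℝ) ^ (K₀ + 1))) u →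
        u 0 = 0 →
        (∀ n : ℕ, n ≤ K₀ →
          eLpNorm (fun x => gradient u x) ⊤ (volume.restrict (Metric.ball 0 ((2 : ℝ) ^ n))) ≤
            ENNReal.ofReal ((1 - δ) ^ (-(n : ℤ)))) →
        tailFun (p - 1) (s * p + 1) u 0 ((2 : ℝ) ^ K₀) ≤ ENNReal.ofReal ε₁ →
        ENNReal.ofReal μ ≤
          volume {x : EuclideanSpace ℝ (Fin d) |
            x ∈ Metric.ball 0 1 ∧ r ≤ ‖gradient u x - e‖} →
        ∀ x ∈ Metric.ball (0 : EuclideanSpace ℝ (Fin d)) (1 / 2),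
          inner ℝ e (gradient u x) ≤ 1 - δ := by
  -- In dimension zero there is no unit vector.
  rcases Nat.eq_zero_or_pos d with rfl | hd
  · refine ⟨1 / 2, 1, 1, by norm_num, by norm_num, by norm_num, by norm_num, ?_⟩
    intro e u he
    rw [Subsingleton.elim e 0, norm_zero] at he
    exact absurd he (by norm_num)
  have : Nonempty (Fin d) := ⟨⟨0, hd⟩⟩
  have : Nontrivial (EuclideanSpace ℝ (Fin d)) := inferInstance
  have hd1 : (1 : ℝ) ≤ d := by exact_mod_cast hd
  have hp1 : 0 < p - 1 := by linarith
  have hsp : 0 < s * p := by positivity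
  have hσp : p - s * p < 2 := by
    rw [lt_div_iff₀ (by linarith)] at hp; linarith
  -- Set `2σ = sp - (p-2)`, positive by the upper bound on `p`, and `β(p-1) = σ`. Then `(1+β)(p-2) +
  -- β - a = -d - σ`, so the far errors are integrable.
  obtain ⟨a, ha⟩ : ∃ a : ℝ, a = d + s * p := ⟨_, rfl⟩
  obtain ⟨σ, hσdef⟩ : ∃ σ : ℝ, σ = (s * p - (p - 2)) / 2 := ⟨_, rfl⟩
  have hσ : 0 < σ := by linarith
  have haσ : a = d + 2 * σ + (p - 2) := by linarith
  obtain ⟨β, hβdef⟩ : ∃ β : ℝ, β = σ / (p - 1) := ⟨_, rfl⟩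
  have hβ : 0 < β := by rw [hβdef]; positivity
  have hβσ : β * (p - 1) = σ := by rw [hβdef]; field_simp
  obtain ⟨C, hC, δ₁, hδ₁, hδ₁2, hgrowth⟩ := exists_zpow_neg_le hβ
  obtain ⟨C₀, hC₀def⟩ : ∃ C₀ : ℝ, C₀ = C * 27 ^ β := ⟨_, rfl⟩
  have hC₀ : 0 < C₀ := by rw [hC₀def]; positivity
  obtain ⟨Λ, hΛdef⟩ : ∃ Λ : ℝ, Λ = 8 * 10 ^ β := ⟨_, rfl⟩
  have hΛ : 0 < Λ := by rw [hΛdef]; positivity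
  have hap : a < p + d := by
    have : s * p < 1 * p := mul_lt_mul_of_pos_right hs1 (by linarith)
    linarith
  obtain ⟨δ₂, hδ₂, hmain⟩ := inner_gradient_le_of_energy (d := d) (q := p - 2) (a := a)
    (by linarith) (by linarith) hr hμ hC₀.le
    (energyConst_nonneg (d := d) (a := a) (β := β) hp2 hΛ.le hC₀.le)
  -- `C`, `C₀`, `Λ` and the energy constant do not depend on `δ`, so `δ` can be chosen after them.
  -- Only then are `K₀` and the tail threshold fixed.
  obtain ⟨δ, hδdef⟩ : ∃ δ : ℝ, δ = min (min δ₁ δ₂) (min (1 / C) (1 / (2 * (2 * C₀ + 8)))) :=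
    ⟨_, rfl⟩
  have hδ : 0 < δ := by rw [hδdef]; positivity
  have hδδ₁ : δ ≤ δ₁ := by rw [hδdef]; exact (min_le_left _ _).trans (min_le_left _ _)
  have hδδ₂ : δ ≤ δ₂ := by rw [hδdef]; exact (min_le_left _ _).trans (min_le_right _ _)
  have hCδ : C * δ ≤ 1 := by
    have : δ ≤ 1 / C := by rw [hδdef]; exact (min_le_right _ _).trans (min_le_left _ _)
    rwa [le_div_iff₀' hC] at this
  have hC₀δ : (2 * C₀ + 8) * δ < 1 := by
    have : δ ≤ 1 / (2 * (2 * C₀ + 8)) := by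
      rw [hδdef]; exact (min_le_right _ _).trans (min_le_right _ _)
    rw [le_div_iff₀' (by positivity)] at this
    linarith
  obtain ⟨F, hFdef⟩ : ∃ F : ℝ,
      F = 2 ^ (p - 1) * (1 + Λ ^ (p - 1)) * (a * 4 ^ (a + 1)) := ⟨_, rfl⟩
  have ha1 : 1 ≤ a := by linarith
  have hF : 0 < F := by rw [hFdef]; positivity
  -- The far error has budget `δ`, shared equally by the growth of `u` inside `B_N`, made small by
  -- `K₀`, and the tail outside. The bound `7 ≤ K₀` gives `N ≥ 128`, hence a splitting radius `N/4 ≥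
  -- 32`.
  obtain ⟨K₀, hK7, hK⟩ := exists_pow_rpow_neg_le (σ := σ / 2)
    (C := 2 ^ p * ∫ y : EuclideanSpace ℝ (Fin d), (1 + ‖y‖) ^ (-(d + σ / 2)))
    (δ := δ / (2 * F)) (by positivity) (by positivity)
  obtain ⟨N, hNdef⟩ : ∃ N : ℝ, N = 2 ^ K₀ := ⟨_, rfl⟩
  have hN : 128 ≤ N := by
    rw [hNdef]
    calc (128 : ℝ) = 2 ^ 7 := by norm_num
      _ ≤ 2 ^ K₀ := pow_le_pow_right₀ (by norm_num) hK7
  have hN2 : (2 : ℝ) ^ (K₀ + 1) = 2 * N := by rw [hNdef, pow_succ]; ring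
  -- The power `1/(p-1)` matches the root in `tailFun`, so the tail integral itself is at most
  -- `δ/(2F)`.
  refine ⟨δ, (δ / (2 * F)) ^ (1 / (p - 1)), K₀, hδ, by linarith, by positivity, by omega, ?_⟩
  intro e u he hu hweak hu0 hgrad htail hmeas
  rw [hN2] at hu hweak
  rw [← hNdef] at hK htail
  have hcont : ContinuousOn (gradient u) (Metric.ball 0 (2 * N)) :=
    continuousOn_gradient Metric.isOpen_ball hu
  have hgradn : ∀ n ≤ K₀, ∀ y ∈ Metric.ball (0 : EuclideanSpace ℝ (Fin d)) (2 ^ n),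
      ‖gradient u y‖ ≤ (1 - δ) ^ (-(n : ℤ)) := by
    intro n hn
    have hle : (2 : ℝ) ^ n ≤ 2 * N := by
      rw [← hN2]; exact pow_le_pow_right₀ (by norm_num) (by omega)
    exact norm_le_of_eLpNorm_top_le Metric.isOpen_ball
      (hcont.mono (Metric.ball_subset_ball hle))
      (zpow_nonneg (by linarith) _) (hgrad n hn)
  have hG : GradientGrowth β C δ N u := by
    refine ⟨fun y hy => ?_, fun y hy => ?_⟩
    · exact (hu.differentiableOn one_ne_zero).differentiableAt
        (Metric.isOpen_ball.mem_nhds (Metric.ball_subset_ball (by linarith) hy))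
    · rw [mem_ball_zero_iff, hNdef] at hy
      obtain ⟨n, hn, h1, h2⟩ := exists_dyadic_scale hy (norm_nonneg y)
      exact (hgradn n hn y (by simpa using h1)).trans (hgrowth δ hδ hδδ₁ n _ h2)
  have hCδ0 : 0 ≤ C * δ := by positivity
  have hsol : LipschitzWeakSolution p a Λ u := by
    rw [ha]
    refine hweak.lipschitzWeakSolution hsp (Metric.ball_subset_ball (by linarith)) ?_ ?_
    · intro x hx y hy
      rw [mem_ball_zero_iff] at hx hy
      refine (hG.abs_sub_le hβ.le hCδ0 hCδ (R := 4) (by linarith) hx hy).trans ?_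
      have : ((1 : ℝ) + 4) ^ β ≤ 10 ^ β :=
        Real.rpow_le_rpow (by norm_num) (by norm_num) hβ.le
      rw [hΛdef]
      gcongr
      norm_num
    · intro x hx
      rw [mem_ball_zero_iff] at hx
      have h1 := hG.abs_sub_le hβ.le hCδ0 hCδ (R := 4) (by linarith) hx
        (y := 0) (by simp)
      rw [hu0, sub_zero, sub_zero] at h1
      have : ((1 : ℝ) + 4) ^ β ≤ 10 ^ β :=
        Real.rpow_le_rpow (by norm_num) (by norm_num) hβ.le
      rw [hΛdef]
      calc _ ≤ 2 * (1 + 4) ^ β * ‖x‖ := h1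
        _ ≤ 2 * 10 ^ β * 4 := by gcongr
        _ = _ := by ring
  have htail' : ∫⁻ y in (Metric.ball (0 : EuclideanSpace ℝ (Fin d)) N)ᶜ,
      ENNReal.ofReal (|u y| ^ (p - 1) / ‖0 - y‖ ^ (a + 1)) ≤ ENNReal.ofReal (δ / (2 * F)) := by
    unfold tailFun at htail
    rw [← add_assoc, ← ha, ← ENNReal.ofReal_rpow_of_pos (by positivity),
      ENNReal.rpow_le_rpow_iff (by positivity)] at htail
    exact htail
  obtain ⟨hfi, hfI⟩ := integral_far_weight_le hp2 hσ hβσ haσ (T := N / 4) (by linarith)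
    (κ := δ / (2 * F)) (by positivity) (by linarith) hsol.aesm hsol.integrable_weight
    (fun y hy => hG.abs_le hβ.le hCδ0 hCδ hu0 hy) htail'
  have hI : F * ∫ y, (1 + |u y| ^ (p - 1)) * (N / 4 + ‖y‖) ^ (-a - 1) ≤ δ := by
    rw [← le_div_iff₀' hF]
    refine hfI.trans ?_
    have : δ / F = δ / (2 * F) + δ / (2 * F) := by field_simp; ring
    rw [this]
    have h2 : 2 ^ p * (N / 4) ^ (-(σ / 2)) *
        (∫ y : EuclideanSpace ℝ (Fin d), (1 + ‖y‖) ^ (-(d + σ / 2))) ≤ δ / (2 * F) := by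
      refine le_trans (le_of_eq ?_) hK
      ring
    linarith
  have hinc : IncrementBounds p a β Λ C₀ δ (N / 4) e u := by
    rw [hΛdef, hC₀def]
    refine hG.incrementBounds hβ.le hC.le hδ hCδ he hN fun x hx t ht ht1 hut => ?_
    have hte : ‖t • e‖ = t := by rw [norm_smul, he, Real.norm_of_nonneg ht.le, mul_one]
    rw [mem_ball_zero_iff] at hx
    have h1 := hsol.neg_le_farOperator_sub hp2 (by linarith) (T := N / 4) (by linarith) hx.le
      (v := t • e) (by rw [hte]; exact ht1) hut hfi
    rw [hte, ← hFdef] at h1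
    have h2 := mul_le_mul_of_nonneg_right hI ht.le
    linarith
  refine hmain δ hδ hδδ₂ e u he (fun y hy => hG.diff y (Metric.ball_subset_ball (by linarith) hy))
    (hcont.mono (Metric.ball_subset_ball (by linarith))) ?_ ?_ hmeas ?_
  · intro y hy
    rw [mem_ball_zero_iff] at hy
    refine (hG.grad_le_of_norm_le hβ.le hCδ0 (by linarith) (Y := 27) (by linarith)).trans_eq ?_
    rw [hC₀def]; ring
  · intro y hy
    simpa using hgradn 0 (Nat.zero_le _) y (by simpa using hy)
  · intro m hm _
    exact hinc.energy_gradient_le hsol he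
      (fun y hy => hG.diff y (Metric.ball_subset_ball (by linarith) hy)) hp2 ha1 hap
      (by linarith) (by linarith) hβ.le hC₀.le hδ hC₀δ hm
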